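/- Notation. Matrices are real $n\times n$ matrices. A symmetric matrix is an SDDM matrix if it is positive definite, its off-diagonal entries are nonpositive, and each diagonal entry is at least the sum of the absolute values of the other entries in its row. The condition number of a positive definite matrix is the ratio of its largest eigenvalue to its smallest. Write $X\approx_{\epsilon}Y$ if $e^{\epsilon}X\succcurlyeq Y\succcurlyeq e^{-\epsilon}X$ in the positive semidefinite order. An approximate inverse chain of length $d$ for $M$ consists of nonnegative diagonal matrices $D_0,\dots,D_d$ and nonnegative symmetric matrices $A_0,\dots,A_d$ with $D_0-A_0=M$ and $M_i:=D_i-A_i\succ 0$ for all $i$, such that there are numbers $\epsilon_0,\dots,\epsilon_d$ with $\sum_{i=0}^d\epsilon_i\le 2$ and * $M_i\approx_{\epsilon_{i-1}}D_{i-1}-A_{i-1}D_{i-1}^{-1}A_{i-1}$ for $1\le i\le d$, * $D_i\approx_{\epsilon_{i-1}}D_{i-1}$ for $1\le i\le d$, * $D_d\approx_{\epsilon_d}M_d$. For $0<\epsilon\le 1/2$, an $\epsilon$-approximate solution of $Mx=b$ is a vector $y$ with $\|x-y\|_M\le\epsilon\|x\|_M$, where $x$ is the solution and $\|x\|_M=(x^TMx)^{1/2}$.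 Algorithms are uniform programs in the parallel work-depth model with exact real arithmetic: arithmetic operations and comparisons of reals, elementary operations on indices, and array accesses have unit cost; work is the total number of operations, and depth is the parallel time, where independent computations count with the maximum of their depths. A sparse matrix is given by listing, for each row, its nonzero entries with their column indices. Theorem. There are two algorithms and absolute constants such that the following holds for all $n\ge 2$, all $\kappa\ge 2$ and every $n$-dimensional SDDM matrix $M$ with $m$ nonzero entries and condition number at most $\kappa$. 1. On input $M$, the first algorithm produces, with a number of operations polynomial in $n$ and $\log\kappa$, an approximate inverse chain $D_0,A_0,\dots,D_d,A_d$ for $M$ with $d=O(\log\kappa)$ that is sparse: the total number of nonzero entries of $D_1,A_1,\dots,D_d,A_d$ is $O(n\log^3\kappa)$. 2. On input this chain, any $b\in\mathbb{R}^n$ and any $0<\epsilon\le 1/2$, the second algorithm produces an $\epsilon$-approximate solution of $Mx=b$ in work $O((m+n\log^3\kappa)\log(1/\epsilon))$ and depth $O(\log n\,\log\kappa\,\log(1/\epsilon))$. -/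

import Mathlib

/-! ### A work-depth model of computation

A first-order data-parallel language with exact real arithmetic. A program is a finite piece of
syntax, so one program serves inputs of all sizes. The only operations on reals are the four
arithmetic operations, comparison, and the conversion of a natural number to a real; natural
numbers (indices and counters) can be added, subtracted, halved and compared. -/

namespace WorkDepth

/-- Data types: natural numbers, reals, truth values, pairs and arrays. -/
inductive Ty : Type
  | nat : Ty
  | real : Ty
  | bool : Ty
  | prod : Ty → Ty → Ty
  | arr : Ty → Ty

/-- The values of a data type; an array is the list of its entries. -/
@[reducible] def Ty.Val : Ty → Type
  | .nat => ℕ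
  | .real => ℝ
  | .bool => Bool
  | .prod a b => a.Val × b.Val
  | .arr a => List a.Val

/-- The value that is returned when an array is read outside its range. -/
noncomputable def Ty.dflt : (a : Ty) → a.Val
  | .nat => (0 : ℕ)
  | .real => (0 : ℝ)
  | .bool => false
  | .prod a b => (a.dflt, b.dflt)
  | .arr _ => []

/-- The elementary operations, each of unit cost. -/
inductive Prim : Ty → Ty → Type
  | id {a : Ty} : Prim a a
  | fst {a b : Ty} : Prim (.prod a b) a
  | snd {a b : Ty} : Prim (.prod a b) b
  | natLit {a : Ty} (k : ℕ) : Prim a .nat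
  | natAdd : Prim (.prod .nat .nat) .nat
  | natSub : Prim (.prod .nat .nat) .nat
  | natHalf : Prim .nat .nat
  | natLt : Prim (.prod .nat .nat) .bool
  | toReal : Prim .nat .real
  | realAdd : Prim (.prod .real .real) .real
  | realSub : Prim (.prod .real .real) .real
  | realMul : Prim (.prod .real .real) .real
  | realDiv : Prim (.prod .real .real) .real
  | realLt : Prim (.prod .real .real) .bool
  | length {a : Ty} : Prim (.arr a) .nat
  | get {a : Ty} : Prim (.prod (.arr a) .nat) a

/-- The result of an elementary operation. Subtraction of naturals is truncated, and a quotient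
of reals with denominator `0` is `0`. -/
noncomputable def Prim.eval : {a b : Ty} → Prim a b → a.Val → b.Val
  | _, _, .id => fun x => x
  | _, _, .fst => fun x => x.1
  | _, _, .snd => fun x => x.2
  | _, _, .natLit k => fun _ => k
  | _, _, .natAdd => fun x => x.1 + x.2
  | _, _, .natSub => fun x => x.1 - x.2
  | _, _, .natHalf => fun x => x / 2
  | _, _, .natLt => fun x => decide (x.1 < x.2)
  | _, _, .toReal => fun x => (x : ℝ)
  | _, _, .realAdd => fun x => x.1 + x.2
  | _, _, .realSub => fun x => x.1 - x.2
  | _, _, .realMul => fun x => x.1 * x.2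
  | _, _, .realDiv => fun x => x.1 / x.2
  | _, _, .realLt => fun x => decide (x.1 < x.2)
  | _, _, .length => fun x => x.length
  | _, b, .get => fun x => x.1.getD x.2 b.dflt

/-- Programs with input type `a` and output type `b`. -/
inductive Prog : Ty → Ty → Type
  /-- an elementary operation -/
  | prim {a b : Ty} (p : Prim a b) : Prog a b
  /-- first `f`, then `g` on the result of `f` -/
  | comp {a b c : Ty} (f : Prog a b) (g : Prog b c) : Prog a c
  /-- `f` and `g` in parallel on the same input -/
  | pair {a b c : Ty} (f : Prog a b) (g : Prog a c) : Prog a (.prod b c)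
  /-- a case distinction -/
  | ite {a b : Ty} (c : Prog a .bool) (f g : Prog a b) : Prog a b
  /-- on input `(x, n)`, the array of the `n` values of `f` at `(x, 0), …, (x, n - 1)`, which are
  computed in parallel -/
  | tabulate {a b : Ty} (f : Prog (.prod a .nat) b) : Prog (.prod a .nat) (.arr b)
  /-- the loop that applies `f` as long as `c` holds -/
  | loop {a : Ty} (c : Prog a .bool) (f : Prog a a) : Prog a a

/-- `Runs P x y w t`: on input `x` the program `P` halts with output `y`, after `w` operations
in total (its work) and parallel time `t` (its depth). -/
inductive Runs : {a b : Ty} → Prog a b → a.Val → b.Val → ℕ → ℕ → Prop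
  | prim {a b : Ty} (p : Prim a b) (x : a.Val) : Runs (.prim p) x (p.eval x) 1 1
  | comp {a b c : Ty} {f : Prog a b} {g : Prog b c} {x : a.Val} {y : b.Val} {z : c.Val}
      {w₁ t₁ w₂ t₂ : ℕ} (hf : Runs f x y w₁ t₁) (hg : Runs g y z w₂ t₂) :
      Runs (.comp f g) x z (w₁ + w₂) (t₁ + t₂)
  | pair {a b c : Ty} {f : Prog a b} {g : Prog a c} {x : a.Val} {y : b.Val} {z : c.Val}
      {w₁ t₁ w₂ t₂ : ℕ} (hf : Runs f x y w₁ t₁) (hg : Runs g x z w₂ t₂) :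
      Runs (.pair f g) x (y, z) (w₁ + w₂ + 1) (max t₁ t₂ + 1)
  | iteTrue {a b : Ty} {c : Prog a .bool} {f g : Prog a b} {x : a.Val} {y : b.Val}
      {w₁ t₁ w₂ t₂ : ℕ} (hc : Runs c x true w₁ t₁) (hf : Runs f x y w₂ t₂) :
      Runs (.ite c f g) x y (w₁ + w₂ + 1) (t₁ + t₂ + 1)
  | iteFalse {a b : Ty} {c : Prog a .bool} {f g : Prog a b} {x : a.Val} {y : b.Val}
      {w₁ t₁ w₂ t₂ : ℕ} (hc : Runs c x false w₁ t₁) (hg : Runs g x y w₂ t₂) :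
      Runs (.ite c f g) x y (w₁ + w₂ + 1) (t₁ + t₂ + 1)
  | tabulate {a b : Ty} {f : Prog (.prod a .nat) b} {x : a.Val} {n : ℕ} (y : Fin n → b.Val)
      (w t : Fin n → ℕ) (hf : ∀ i : Fin n, Runs f (x, (i : ℕ)) (y i) (w i) (t i)) :
      Runs (.tabulate f) (x, n) (List.ofFn y) (∑ i, w i + 1) (Finset.univ.sup t + 1)
  | loopStop {a : Ty} {c : Prog a .bool} {f : Prog a a} {x : a.Val} {w t : ℕ}
      (hc : Runs c x false w t) : Runs (.loop c f) x x (w + 1) (t + 1)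
  | loopStep {a : Ty} {c : Prog a .bool} {f : Prog a a} {x y z : a.Val}
      {w₁ t₁ w₂ t₂ w₃ t₃ : ℕ} (hc : Runs c x true w₁ t₁) (hf : Runs f x y w₂ t₂)
      (hl : Runs (.loop c f) y z w₃ t₃) :
      Runs (.loop c f) x z (w₁ + w₂ + w₃ + 1) (t₁ + t₂ + t₃ + 1)

/-- Vectors: arrays of reals. -/
abbrev Ty.vec : Ty := .arr .real

/-- Sparse matrices: for each row, the array of its entries as pairs (column, value). -/
abbrev Ty.sparse : Ty := .arr (.arr (.prod .nat .real))

/-- Chains: the array of the pairs of a diagonal, as a vector, and a sparse matrix. -/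
abbrev Ty.chain : Ty := .arr (.prod Ty.vec Ty.sparse)

/-- A vector as input or output of a program. -/
def encodeVec {n : ℕ} (v : Fin n → ℝ) : Ty.vec.Val := List.ofFn v

/-- A matrix as input or output of a program: only the nonzero entries are listed, in the order
of their columns. -/
noncomputable def encodeSparse {n : ℕ} (A : Matrix (Fin n) (Fin n) ℝ) : Ty.sparse.Val :=
  List.ofFn fun i : Fin n =>
    List.map (fun j : Fin n => ((j : ℕ), A i j))
      (List.filter (fun j : Fin n => decide (A i j ≠ 0)) (List.finRange n))

/-- The matrices `D 0, …, D d` (diagonal) and `A 0, …, A d` as input or output of a program. -/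
noncomputable def encodeChain {n d : ℕ} (D A : Fin (d + 1) → Matrix (Fin n) (Fin n) ℝ) :
    Ty.chain.Val :=
  List.ofFn fun i : Fin (d + 1) => (encodeVec (D i).diag, encodeSparse (A i))

end WorkDepth

/-! ### SDDM matrices and approximate inverse chains -/

/-- SDDM matrices: symmetric, diagonally dominant, positive definite matrices with nonpositive
off-diagonal entries. -/
structure IsSDDM {n : ℕ} (M : Matrix (Fin n) (Fin n) ℝ) : Prop where
  symm : M.IsSymm
  dominant : ∀ i, ∑ j ∈ Finset.univ.erase i, |M i j| ≤ M i i
  posDef : M.PosDef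
  offDiag : ∀ i j, i ≠ j → M i j ≤ 0

/-- The number of nonzero entries. -/
noncomputable def nnz {n : ℕ} (M : Matrix (Fin n) (Fin n) ℝ) : ℕ :=
  Set.ncard {p : Fin n × Fin n | M p.1 p.2 ≠ 0}

/-- The ratio of the largest eigenvalue to the smallest one (for symmetric positive definite
matrices). -/
noncomputable def condNumber {n : ℕ} (M : Matrix (Fin n) (Fin n) ℝ) : ℝ :=
  sSup (spectrum ℝ M) / sInf (spectrum ℝ M)

/-- `X ≈_ε Y`: `exp ε • X ≽ Y ≽ exp (-ε) • X` in the positive semidefinite order. -/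
def SpectralApprox {n : ℕ} (ε : ℝ) (X Y : Matrix (Fin n) (Fin n) ℝ) : Prop :=
  (Real.exp ε • X - Y).PosSemidef ∧ (Y - Real.exp (-ε) • X).PosSemidef

/-- `D 0, …, D d` and `A 0, …, A d` form an approximate inverse chain for `M = D 0 - A 0`. -/
structure IsApproxInverseChain {n d : ℕ} (M : Matrix (Fin n) (Fin n) ℝ)
    (D A : Fin (d + 1) → Matrix (Fin n) (Fin n) ℝ) : Prop where
  start : D 0 - A 0 = M
  diag : ∀ i, (D i).IsDiag
  diag_nonneg : ∀ i j, 0 ≤ D i j j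
  symm : ∀ i, (A i).IsSymm
  nonneg : ∀ i j k, 0 ≤ A i j k
  posDef : ∀ i, (D i - A i).PosDef
  approx : ∃ ε : Fin (d + 1) → ℝ, ∑ i, ε i ≤ 2 ∧
    (∀ i : Fin d, SpectralApprox (ε i.castSucc) (D i.succ - A i.succ)
      (D i.castSucc - A i.castSucc * (D i.castSucc)⁻¹ * A i.castSucc)) ∧
    (∀ i : Fin d, SpectralApprox (ε i.castSucc) (D i.succ) (D i.castSucc)) ∧
    SpectralApprox (ε (Fin.last d)) (D (Fin.last d)) (D (Fin.last d) - A (Fin.last d))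

/-- The norm `(xᵀ M x)^(1/2)` of a positive definite matrix `M`. -/
noncomputable def energyNorm {n : ℕ} (M : Matrix (Fin n) (Fin n) ℝ) (x : Fin n → ℝ) : ℝ :=
  Real.sqrt (x ⬝ᵥ M.mulVec x)

/-- `y` is an `ε`-approximate solution of `M x = b`. -/
def IsApproxSolution {n : ℕ} (M : Matrix (Fin n) (Fin n) ℝ) (b : Fin n → ℝ) (ε : ℝ)
    (y : Fin n → ℝ) : Prop :=
  ∃ x : Fin n → ℝ, M.mulVec x = b ∧ energyNorm M (x - y) ≤ ε * energyNorm M x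

/-! Let c be twice the largest diagonal entry of M and write M = c(1 - a₀). Then a₀ has nonnegative
entries and row sums at most 1, and it is positive semidefinite with 1 - a₀ positive definite
(`isLevel_of_isSDDM`). The identity (1 - a)⁻¹ = ½(1 + (1 + a)(1 - a²)⁻¹(1 + a)) (`inv_one_sub_eq`)
reduces a system in 1 - a to one in 1 - a². That matrix is again diagonally dominant but possibly
dense, so it is replaced by a sparse N with N ≼ 1 - a² ≼ (1 + 1/d)N, where d is the length of the
chain. Approximation from below keeps a' = 1 - N in the same class (`IsLevel.next`). A level raises
the lower bound on the spectrum of 1 - a by a factor 9/8 until it is 1/2 (`IsLevel.lowerBound_min`),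
so O(log κ) levels suffice, and the d errors multiply to (1 + 1/d)^d ≤ 3. All diagonal matrices of
the chain equal c·1.

The sparsifier comes from the deterministic barrier method of Batson, Spielman and Srivastava, run
relative to X = 1 - a² itself instead of after a normalisation by X^(-1/2), since square roots are
not available. A symmetric matrix with nonpositive off-diagonal entries and nonnegative row sums is
a nonnegative combination of the matrices bbᵀ with b = e_i or b = e_i - e_j. Averaging over these
(`exists_pair_le`) gives a b that can be added while both barriers move and neither potential
exceeds its bound. Such a b changes at most two off-diagonal entries and preserves dominance. With q
= 4d + 2, nq² steps bring the ratio of the barriers to (d + 1)/d, so a level has O(nd²) entries and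
the chain O(n log³ κ).

The number κ is not part of the input. The length is found by comparing the trace of the 2^n-th
power of (c⁻¹M)⁻¹ with powers of 2^(2^n). The trace loses at most a factor n, which is at most 2
after the 2^n-th root is taken (`exists_certified_bound`). In exact arithmetic n squarings produce
these powers.

Applying the identity level by level gives a symmetric Z with ½(1 - a₀)⁻¹ ≼ Z ≼ 3(1 - a₀)⁻¹
(`precond_bounds`). The Richardson iteration with Z/3 multiplies the squared energy error by at most
5/6 (`richardson_step`), so O(log(1/ε)) iterations suffice. An application of Z is a pass down and a
pass up the levels, with one sparse product per level, each summed along binary trees.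

On the side of programs, the relation `Runs` is replaced by the functions `den`, `work` and `depth`
(`runs_of_halts`). Polynomial time is inferred by the class `PolyTime`; the finer bounds of the
solver use the rules for `Cost`. -/

set_option linter.unusedSectionVars false

/-! ### Denotational semantics, work and depth of programs -/

namespace WorkDepth

/-- The number of passes through a loop with condition `c` and body `f`. -/
noncomputable def stopTime {α : Type} (c : α → Bool) (f : α → α) (x : α) : ℕ :=
  sInf {k | c (f^[k] x) = false}

/-- The function computed by a program. -/
noncomputable def den : {a b : Ty} → Prog a b → a.Val → b.Val
  | _, _, .prim p => p.eval
  | _, _, .comp f g => fun x => den g (den f x)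
  | _, _, .pair f g => fun x => (den f x, den g x)
  | _, _, .ite c f g => fun x => if den c x = true then den f x else den g x
  | _, _, .tabulate f => fun x => List.ofFn fun i : Fin x.2 => den f (x.1, (i : ℕ))
  | _, _, .loop c f => fun x => (den f)^[stopTime (den c) (den f) x] x

/-- The work of a program. -/
noncomputable def work : {a b : Ty} → Prog a b → a.Val → ℕ
  | _, _, .prim _ => fun _ => 1
  | _, _, .comp f g => fun x => work f x + work g (den f x)
  | _, _, .pair f g => fun x => work f x + work g x + 1
  | _, _, .ite c f g => fun x => work c x + (if den c x = true then work f x else work g x) + 1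
  | _, _, .tabulate f => fun x => ∑ i : Fin x.2, work f (x.1, (i : ℕ)) + 1
  | _, _, .loop c f => fun x =>
      ∑ i ∈ Finset.range (stopTime (den c) (den f) x),
        (work c ((den f)^[i] x) + work f ((den f)^[i] x) + 1)
      + (work c ((den f)^[stopTime (den c) (den f) x] x) + 1)

/-- The depth of a program. -/
noncomputable def depth : {a b : Ty} → Prog a b → a.Val → ℕ
  | _, _, .prim _ => fun _ => 1
  | _, _, .comp f g => fun x => depth f x + depth g (den f x)
  | _, _, .pair f g => fun x => max (depth f x) (depth g x) + 1
  | _, _, .ite c f g => fun x => depth c x + (if den c x = true then depth f x else depth g x) + 1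
  | _, _, .tabulate f => fun x => (Finset.univ.sup fun i : Fin x.2 => depth f (x.1, (i : ℕ))) + 1
  | _, _, .loop c f => fun x =>
      ∑ i ∈ Finset.range (stopTime (den c) (den f) x),
        (depth c ((den f)^[i] x) + depth f ((den f)^[i] x) + 1)
      + (depth c ((den f)^[stopTime (den c) (den f) x] x) + 1)

/-- A program halts on an input. -/
def Halts : {a b : Ty} → Prog a b → a.Val → Prop
  | _, _, .prim _ => fun _ => True
  | _, _, .comp f g => fun x => Halts f x ∧ Halts g (den f x)
  | _, _, .pair f g => fun x => Halts f x ∧ Halts g x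
  | _, _, .ite c f g => fun x => Halts c x ∧ (if den c x = true then Halts f x else Halts g x)
  | _, _, .tabulate f => fun x => ∀ i : Fin x.2, Halts f (x.1, (i : ℕ))
  | _, _, .loop c f => fun x => (∃ k, den c ((den f)^[k] x) = false) ∧
      (∀ i < stopTime (den c) (den f) x, Halts c ((den f)^[i] x) ∧ Halts f ((den f)^[i] x)) ∧
      Halts c ((den f)^[stopTime (den c) (den f) x] x)

theorem Runs.cast {a b : Ty} {P : Prog a b} {x : a.Val} {y : b.Val} {w w' t t' : ℕ}
    (h : Runs P x y w t) (hw : w = w') (ht : t = t') : Runs P x y w' t' := by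
  subst hw; subst ht; exact h

/-- Induction on the number of passes. The first pass is split off, because `Runs.loopStep` unfolds
a loop at its front. -/
theorem runs_loop {a : Ty} {c : Prog a .bool} {f : Prog a a}
    (hc : ∀ x, Halts c x → Runs c x (den c x) (work c x) (depth c x))
    (hf : ∀ x, Halts f x → Runs f x (den f x) (work f x) (depth f x)) (k : ℕ) :
    ∀ x : a.Val, (∀ i < k, den c ((den f)^[i] x) = true ∧ Halts c ((den f)^[i] x) ∧
      Halts f ((den f)^[i] x)) → den c ((den f)^[k] x) = false → Halts c ((den f)^[k] x) →
    Runs (.loop c f) x ((den f)^[k] x)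
      (∑ i ∈ Finset.range k, (work c ((den f)^[i] x) + work f ((den f)^[i] x) + 1)
        + (work c ((den f)^[k] x) + 1))
      (∑ i ∈ Finset.range k, (depth c ((den f)^[i] x) + depth f ((den f)^[i] x) + 1)
        + (depth c ((den f)^[k] x) + 1)) := by
  induction k with
  | zero =>
    intro x _ h1 h2
    have := hc x h2
    simp only [Function.iterate_zero, id_eq] at h1 ⊢
    rw [h1] at this
    exact (Runs.loopStop this).cast (by simp) (by simp)
  | succ k ih =>
    intro x h h1 h2
    obtain ⟨h0, h0c, h0f⟩ := h 0 (Nat.succ_pos k)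
    have hi := ih (den f x) (fun i hi => by
      have := h (i + 1) (by omega)
      simpa only [Function.iterate_succ, Function.comp] using this) (by
        simpa only [Function.iterate_succ, Function.comp] using h1) (by
        simpa only [Function.iterate_succ, Function.comp] using h2)
    have hcc := hc x h0c
    simp only [Function.iterate_zero, id_eq] at h0
    rw [h0] at hcc
    refine (Runs.loopStep hcc (hf x h0f) hi).cast ?_ ?_
    · rw [Finset.sum_range_succ']
      simp only [Function.iterate_succ, Function.comp, Function.iterate_zero, id_eq]
      ring
    · rw [Finset.sum_range_succ']
      simp only [Function.iterate_succ, Function.comp, Function.iterate_zero, id_eq]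
      ring

theorem stopTime_spec {α : Type} {c : α → Bool} {f : α → α} {x : α}
    (h : ∃ k, c (f^[k] x) = false) : c (f^[stopTime c f x] x) = false :=
  Nat.sInf_mem (s := {k | c (f^[k] x) = false}) h

theorem stopTime_lt {α : Type} {c : α → Bool} {f : α → α} {x : α} {i : ℕ}
    (h : i < stopTime c f x) : c (f^[i] x) = true := by
  have := Nat.notMem_of_lt_sInf (s := {k | c (f^[k] x) = false}) h
  simpa using this

theorem stopTime_eq {α : Type} {c : α → Bool} {f : α → α} {x : α} {k : ℕ}
    (h : ∀ i < k, c (f^[i] x) = true) (hk : c (f^[k] x) = false) : stopTime c f x = k := by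
  refine le_antisymm (Nat.sInf_le hk) ?_
  by_contra hlt
  have h1 := h _ (not_le.mp hlt)
  rw [stopTime_spec ⟨k, hk⟩] at h1
  exact Bool.noConfusion h1

/-- The bridge to the relation in the statement: from here on only the functions `den`, `work` and
`depth` have to be computed or bounded. -/
theorem runs_of_halts {a b : Ty} (P : Prog a b) :
    ∀ x, Halts P x → Runs P x (den P x) (work P x) (depth P x) := by
  induction P with
  | prim p => intro x _; exact Runs.prim p x
  | comp f g ihf ihg => intro x h; exact Runs.comp (ihf x h.1) (ihg _ h.2)
  | pair f g ihf ihg => intro x h; exact Runs.pair (ihf x h.1) (ihg _ h.2)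
  | ite c f g ihc ihf ihg =>
    intro x h
    obtain ⟨h1, h2⟩ := h
    have hc := ihc x h1
    by_cases hx : den c x = true
    · rw [if_pos hx] at h2
      rw [hx] at hc
      have := Runs.iteTrue (g := g) hc (ihf x h2)
      simpa only [den, work, depth, if_pos hx] using this
    · rw [if_neg hx] at h2
      rw [Bool.eq_false_of_not_eq_true hx] at hc
      have := Runs.iteFalse (f := f) hc (ihg x h2)
      simpa only [den, work, depth, if_neg hx] using this
  | tabulate f ih =>
    rintro ⟨x, n⟩ h
    exact Runs.tabulate _ _ _ fun i => ih _ (h i)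
  | loop c f ihc ihf =>
    intro x h
    obtain ⟨h1, h2, h3⟩ := h
    exact runs_loop ihc ihf _ x (fun i hi => ⟨stopTime_lt hi, h2 i hi⟩) (stopTime_spec h1) h3

/-- `P` halts on `x` after at most `W` operations, in depth at most `T`. -/
def Cost {a b : Ty} (P : Prog a b) (x : a.Val) (W T : ℕ) : Prop :=
  Halts P x ∧ work P x ≤ W ∧ depth P x ≤ T

theorem Cost.runs {a b : Ty} {P : Prog a b} {x : a.Val} {W T : ℕ} (h : Cost P x W T) :
    ∃ w t, Runs P x (den P x) w t ∧ w ≤ W ∧ t ≤ T :=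
  ⟨_, _, runs_of_halts P x h.1, h.2.1, h.2.2⟩

theorem Cost.mono {a b : Ty} {P : Prog a b} {x : a.Val} {W T W' T' : ℕ} (h : Cost P x W T)
    (hW : W ≤ W') (hT : T ≤ T') : Cost P x W' T' :=
  ⟨h.1, h.2.1.trans hW, h.2.2.trans hT⟩

theorem Cost.prim {a b : Ty} {p : Prim a b} {x : a.Val} : Cost (.prim p) x 1 1 :=
  ⟨trivial, le_rfl, le_rfl⟩

theorem Cost.comp {a b c : Ty} {f : Prog a b} {g : Prog b c} {x : a.Val} {W T W' T' : ℕ}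
    (hf : Cost f x W T) (hg : Cost g (den f x) W' T') : Cost (.comp f g) x (W + W') (T + T') :=
  ⟨⟨hf.1, hg.1⟩, Nat.add_le_add hf.2.1 hg.2.1, Nat.add_le_add hf.2.2 hg.2.2⟩

/-- The maximum of the depths is weakened to their sum. Only boundedly many pairs occur in an
expression, and the parallelism that matters comes from `tabulate`. -/
theorem Cost.pair {a b c : Ty} {f : Prog a b} {g : Prog a c} {x : a.Val} {W T W' T' : ℕ}
    (hf : Cost f x W T) (hg : Cost g x W' T') : Cost (.pair f g) x (W + W' + 1) (T + T' + 1) := by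
  refine ⟨⟨hf.1, hg.1⟩, ?_, ?_⟩
  · have := hf.2.1; have := hg.2.1; simp only [work]; omega
  · have := hf.2.2; have := hg.2.2; simp only [depth]; omega

/-- Both branches are charged, which makes the bound independent of the outcome of the test. -/
theorem Cost.ite {a b : Ty} {c : Prog a .bool} {f g : Prog a b} {x : a.Val} {W T W₁ T₁ W₂ T₂ : ℕ}
    (hc : Cost c x W T) (hf : Cost f x W₁ T₁) (hg : Cost g x W₂ T₂) :
    Cost (.ite c f g) x (W + W₁ + W₂ + 1) (T + T₁ + T₂ + 1) := by
  have := hc.2.1; have := hf.2.1; have := hg.2.1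
  have := hc.2.2; have := hf.2.2; have := hg.2.2
  by_cases h : den c x = true
  · refine ⟨⟨hc.1, by rw [if_pos h]; exact hf.1⟩, ?_, ?_⟩
    · simp only [work, if_pos h]; omega
    · simp only [depth, if_pos h]; omega
  · refine ⟨⟨hc.1, by rw [if_neg h]; exact hg.1⟩, ?_, ?_⟩
    · simp only [work, if_neg h]; omega
    · simp only [depth, if_neg h]; omega

theorem Cost.tabulate {a b : Ty} {f : Prog (.prod a .nat) b} {x : a.Val} {n : ℕ} {W : ℕ → ℕ}
    {T : ℕ} (h : ∀ i < n, Cost f (x, i) (W i) T) :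
    Cost (.tabulate f) (x, n) (∑ i ∈ Finset.range n, W i + 1) (T + 1) := by
  refine ⟨fun (i : Fin n) => (h i i.2).1, ?_, ?_⟩
  · simp only [work]
    rw [← Fin.sum_univ_eq_sum_range]
    exact Nat.add_le_add_right (Finset.sum_le_sum fun (i : Fin n) _ => (h i i.2).2.1) 1
  · simp only [depth]
    exact Nat.add_le_add_right (Finset.sup_le fun (i : Fin n) _ => (h i i.2).2.2) 1

theorem Cost.loop {a : Ty} {c : Prog a .bool} {f : Prog a a} {x : a.Val} {k : ℕ} {W T : ℕ → ℕ}
    (hk : ∀ i < k, den c ((den f)^[i] x) = true) (hfin : den c ((den f)^[k] x) = false)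
    {Wc Tc : ℕ} (hc : ∀ i ≤ k, Cost c ((den f)^[i] x) Wc Tc)
    (hf : ∀ i < k, Cost f ((den f)^[i] x) (W i) (T i)) :
    Cost (.loop c f) x (∑ i ∈ Finset.range k, (W i + Wc + 1) + (Wc + 1))
      (∑ i ∈ Finset.range k, (T i + Tc + 1) + (Tc + 1)) := by
  have hs := stopTime_eq hk hfin
  refine ⟨⟨⟨k, hfin⟩, ?_, ?_⟩, ?_, ?_⟩
  · rw [hs]; exact fun i hi => ⟨(hc i hi.le).1, (hf i hi).1⟩
  · rw [hs]; exact (hc k le_rfl).1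
  · simp only [work, hs]
    refine Nat.add_le_add (Finset.sum_le_sum fun i hi => ?_) (Nat.add_le_add_right
      (hc k le_rfl).2.1 1)
    have hi := Finset.mem_range.mp hi
    have := (hc i hi.le).2.1; have := (hf i hi).2.1; omega
  · simp only [depth, hs]
    refine Nat.add_le_add (Finset.sum_le_sum fun i hi => ?_) (Nat.add_le_add_right
      (hc k le_rfl).2.2 1)
    have hi := Finset.mem_range.mp hi
    have := (hc i hi.le).2.2; have := (hf i hi).2.2; omega

end WorkDepth

/-! ### Derived program constructions -/

namespace WorkDepth

variable {Γ a b c : Ty}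

/-- The array of the values of `f` at `0, …, n - 1`. -/
def tabList {α : Type} (n : ℕ) (f : ℕ → α) : List α := List.ofFn fun i : Fin n => f i

theorem getD_tabList {α : Type} (n : ℕ) (f : ℕ → α) (i : ℕ) (d : α) :
    (tabList n f).getD i d = if i < n then f i else d := by
  unfold tabList
  rw [List.getD_eq_getElem?_getD, List.getElem?_ofFn]
  split_ifs <;> rfl

@[simp] theorem length_tabList {α : Type} (n : ℕ) (f : ℕ → α) : (tabList n f).length = n := by
  simp [tabList]

/-- The state after `n` passes of a counting loop. -/
def passes {α : Type} (f : ℕ → α → α) (x : α) : ℕ → α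
  | 0 => x
  | n + 1 => f n (passes f x n)

theorem passes_add {M : Type} [AddCommMonoid M] (g : ℕ → M) (x : M) (n : ℕ) :
    passes (fun i s => s + g i) x n = x + ∑ i ∈ Finset.range n, g i := by
  induction n with
  | zero => simp [passes]
  | succ n ih => rw [passes, ih, Finset.sum_range_succ, add_assoc]

/-- The variable that was bound last. -/
def v0 : Prog (.prod Γ a) a := .prim .snd
/-- Weakening of a program by a further variable. -/
def lift (e : Prog Γ a) : Prog (.prod Γ b) a := .comp (.prim .fst) e
/-- The last variable but one. -/
abbrev v1 : Prog (.prod (.prod Γ a) b) a := lift v0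
/-- The last variable but two. -/
abbrev v2 {a₁ a₂ : Ty} : Prog (.prod (.prod (.prod Γ a) a₁) a₂) a := lift v1
/-- The last variable but three. -/
abbrev v3 {a₁ a₂ a₃ : Ty} : Prog (.prod (.prod (.prod (.prod Γ a) a₁) a₂) a₃) a := lift v2
/-- The last variable but four. -/
abbrev v4 {a₁ a₂ a₃ a₄ : Ty} :
    Prog (.prod (.prod (.prod (.prod (.prod Γ a) a₁) a₂) a₃) a₄) a := lift v3
/-- The last variable but five. -/
abbrev v5 {a₁ a₂ a₃ a₄ a₅ : Ty} :
    Prog (.prod (.prod (.prod (.prod (.prod (.prod Γ a) a₁) a₂) a₃) a₄) a₅) a := lift v4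
/-- The first component of a pair. -/
def fstP (e : Prog Γ (.prod a b)) : Prog Γ a := .comp e (.prim .fst)
/-- The second component of a pair. -/
def sndP (e : Prog Γ (.prod a b)) : Prog Γ b := .comp e (.prim .snd)
/-- A literal. -/
def lit (k : ℕ) : Prog Γ .nat := .prim (.natLit k)
/-- The conversion of a natural number to a real. -/
def toR (e : Prog Γ .nat) : Prog Γ .real := .comp e (.prim .toReal)
/-- Half of a natural number. -/
def half (e : Prog Γ .nat) : Prog Γ .nat := .comp e (.prim .natHalf)
instance : Add (Prog Γ .nat) := ⟨fun e f => .comp (.pair e f) (.prim .natAdd)⟩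
instance : Sub (Prog Γ .nat) := ⟨fun e f => .comp (.pair e f) (.prim .natSub)⟩
instance : Add (Prog Γ .real) := ⟨fun e f => .comp (.pair e f) (.prim .realAdd)⟩
instance : Sub (Prog Γ .real) := ⟨fun e f => .comp (.pair e f) (.prim .realSub)⟩
instance : Mul (Prog Γ .real) := ⟨fun e f => .comp (.pair e f) (.prim .realMul)⟩
instance : Div (Prog Γ .real) := ⟨fun e f => .comp (.pair e f) (.prim .realDiv)⟩
/-- Comparison of natural numbers. -/
def ltN (e f : Prog Γ .nat) : Prog Γ .bool := .comp (.pair e f) (.prim .natLt)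
/-- Comparison of reals. -/
def ltR (e f : Prog Γ .real) : Prog Γ .bool := .comp (.pair e f) (.prim .realLt)
/-- The length of an array. -/
def len (e : Prog Γ (.arr a)) : Prog Γ .nat := .comp e (.prim .length)
/-- An entry of an array. -/
def get (e : Prog Γ (.arr a)) (i : Prog Γ .nat) : Prog Γ a := .comp (.pair e i) (.prim .get)
/-- Binding of a variable. -/
def letP (e : Prog Γ a) (f : Prog (.prod Γ a) b) : Prog Γ b := .comp (.pair (.prim .id) e) f
/-- An array of length `n`, entry by entry. -/
def tab (n : Prog Γ .nat) (f : Prog (.prod Γ .nat) a) : Prog Γ (.arr a) :=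
  .comp (.pair (.prim .id) n) (.tabulate f)
/-- The condition of a counting loop. -/
def forCond : Prog (.prod (.prod Γ .nat) (.prod .nat a)) .bool := ltN (fstP v0) (sndP (.prim .fst))
/-- The body of a counting loop. -/
def forStep (f : Prog (.prod (.prod Γ .nat) a) a) :
    Prog (.prod (.prod Γ .nat) (.prod .nat a)) (.prod (.prod Γ .nat) (.prod .nat a)) :=
  .pair (.prim .fst) (.pair (fstP v0 + lit 1)
    (.comp (.pair (.pair (fstP (.prim .fst)) (fstP v0)) (sndP v0)) f))
/-- The loop that replaces the state `s` by `f (i, s)` for `i = 0, …, n - 1`. -/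
def forP (n : Prog Γ .nat) (s : Prog Γ a) (f : Prog (.prod (.prod Γ .nat) a) a) : Prog Γ a :=
  .comp (.pair (.pair (.prim .id) n) (.pair (lit 0) s)) (.comp (.loop forCond (forStep f)) (sndP v0))
/-- The minimum of two natural numbers. -/
def minN (e f : Prog Γ .nat) : Prog Γ .nat := .ite (ltN e f) e f
/-- The array of an array `e` of length at most `n` followed by an entry `x`. -/
def push (n : Prog Γ .nat) (e : Prog Γ (.arr a)) (x : Prog Γ a) : Prog Γ (.arr a) :=
  letP e (letP (lift x) (tab (minN (len v1) (lift (lift n)) + lit 1)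
    (.ite (ltN v0 (len v2)) (get v2 v0) v1)))
/-- The call of a program that takes a size as its last argument. -/
def call (f : Prog (.prod a .nat) b) (e : Prog Γ a) (n : Prog Γ .nat) : Prog Γ b :=
  .comp (.pair e n) f
/-- The call of a program that takes two sizes as its last arguments. -/
def call₂ (f : Prog (.prod (.prod a .nat) .nat) b) (e : Prog Γ a) (n m : Prog Γ .nat) : Prog Γ b :=
  .comp (.pair (.pair e n) m) f
/-- The sum of `f i` over `i < n`, computed sequentially. -/
def sumP (n : Prog Γ .nat) (f : Prog (.prod Γ .nat) .real) : Prog Γ .real :=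
  forP n (toR (lit 0)) (v0 + lift f)
/-- A case distinction on the equality of natural numbers. -/
def iteEq (e f : Prog Γ .nat) (g h : Prog Γ a) : Prog Γ a :=
  .ite (ltN e f) h (.ite (ltN f e) h g)

/-! ### Values of the derived constructions. -/

section den

variable {x : Γ.Val}

@[simp] theorem den_comp (e : Prog Γ a) (f : Prog a b) : den (.comp e f) x = den f (den e x) := rfl
@[simp] theorem den_pair (e : Prog Γ a) (f : Prog Γ b) :
    den (.pair e f) x = (den e x, den f x) := rfl
@[simp] theorem den_ite (e : Prog Γ .bool) (f g : Prog Γ b) :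
    den (.ite e f g) x = if den e x = true then den f x else den g x := rfl
@[simp] theorem den_id : den (.prim .id) x = x := rfl
@[simp] theorem den_fst (x : (Ty.prod a b).Val) : den (.prim .fst) x = x.1 := rfl
@[simp] theorem den_v0 (x : (Ty.prod Γ a).Val) : den v0 x = x.2 := rfl
@[simp] theorem den_lift (e : Prog Γ a) (x : (Ty.prod Γ b).Val) : den (lift e) x = den e x.1 := rfl
@[simp] theorem den_fstP (e : Prog Γ (.prod a b)) : den (fstP e) x = (den e x).1 := rfl
@[simp] theorem den_sndP (e : Prog Γ (.prod a b)) : den (sndP e) x = (den e x).2 := rfl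
@[simp] theorem den_lit (k : ℕ) : den (lit k) x = (k : ℕ) := rfl
@[simp] theorem den_toR (e : Prog Γ .nat) : den (toR e) x = ((show ℕ from den e x : ℕ) : ℝ) := rfl
@[simp] theorem den_addN (e f : Prog Γ .nat) :
    den (e + f) x = @HAdd.hAdd ℕ ℕ ℕ _ (den e x) (den f x) := rfl
@[simp] theorem den_subN (e f : Prog Γ .nat) :
    den (e - f) x = @HSub.hSub ℕ ℕ ℕ _ (den e x) (den f x) := rfl
@[simp] theorem den_addR (e f : Prog Γ .real) :
    den (e + f) x = @HAdd.hAdd ℝ ℝ ℝ _ (den e x) (den f x) := rfl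
@[simp] theorem den_subR (e f : Prog Γ .real) :
    den (e - f) x = @HSub.hSub ℝ ℝ ℝ _ (den e x) (den f x) := rfl
@[simp] theorem den_mulR (e f : Prog Γ .real) :
    den (e * f) x = @HMul.hMul ℝ ℝ ℝ _ (den e x) (den f x) := rfl
@[simp] theorem den_divR (e f : Prog Γ .real) :
    den (e / f) x = @HDiv.hDiv ℝ ℝ ℝ _ (den e x) (den f x) := rfl
@[simp] theorem den_ltN (e f : Prog Γ .nat) :
    den (ltN e f) x = decide (@LT.lt ℕ _ (den e x) (den f x)) := rfl
@[simp] theorem den_ltR (e f : Prog Γ .real) :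
    den (ltR e f) x = decide (@LT.lt ℝ _ (den e x) (den f x)) := rfl
@[simp] theorem den_len (e : Prog Γ (.arr a)) :
    den (len e) x = @List.length a.Val (den e x) := rfl
@[simp] theorem den_get (e : Prog Γ (.arr a)) (i : Prog Γ .nat) :
    den (get e i) x = @List.getD a.Val (den e x) (den i x) a.dflt := rfl
@[simp] theorem den_letP (e : Prog Γ a) (f : Prog (.prod Γ a) b) :
    den (letP e f) x = den f (x, den e x) := rfl
@[simp] theorem den_tab (n : Prog Γ .nat) (f : Prog (.prod Γ .nat) a) :
    den (tab n f) x = tabList (den n x) fun i => den f (x, i) := rfl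

theorem den_loop (c : Prog a .bool) (f : Prog a a) (x : a.Val) :
    den (.loop c f) x = (den f)^[stopTime (den c) (den f) x] x := rfl

theorem forStep_iterate (f : Prog (.prod (.prod Γ .nat) a) a) (n : ℕ) (s : a.Val) (k : ℕ) :
    (den (forStep f))^[k] ((x, n), ((0 : ℕ), s)) =
      ((x, n), (k, passes (fun i s => den f ((x, i), s)) s k)) := by
  induction k with
  | zero => rfl
  | succ k ih => rw [Function.iterate_succ', Function.comp, ih]; rfl

theorem stopTime_forP (f : Prog (.prod (.prod Γ .nat) a) a) (n : ℕ) (s : a.Val) :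
    stopTime (den forCond) (den (forStep f)) ((x, n), ((0 : ℕ), s)) = n := by
  refine stopTime_eq (fun i hi => ?_) ?_ <;> rw [forStep_iterate]
  · exact decide_eq_true hi
  · simp [forCond]

@[simp] theorem den_forP (n : Prog Γ .nat) (s : Prog Γ a) (f : Prog (.prod (.prod Γ .nat) a) a) :
    den (forP n s f) x = passes (fun i s => den f ((x, i), s)) (den s x) (den n x) := by
  simp only [forP, den_comp, den_loop, den_pair, den_lit, den_id]
  rw [stopTime_forP, forStep_iterate]
  rfl

@[simp] theorem den_minN (e f : Prog Γ .nat) :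
    den (minN e f) x = @min ℕ _ (den e x) (den f x) := by
  simp only [minN, den_ite, den_ltN, decide_eq_true_eq]
  by_cases h : @LT.lt ℕ _ (den e x) (den f x)
  · rw [if_pos h]; exact (min_eq_left (le_of_lt h)).symm
  · rw [if_neg h]; exact (min_eq_right (not_lt.mp h)).symm

/-- `push` truncates at length n so that its work is bounded without any knowledge of the array; the
hypothesis says that the truncation does not take effect. -/
theorem den_push (n : Prog Γ .nat) (e : Prog Γ (.arr a)) (y : Prog Γ a)
    (h : @List.length a.Val (den e x) ≤ den n x) :
    den (push n e y) x = @HAppend.hAppend (List a.Val) (List a.Val) (List a.Val) _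
      (den e x) [den y x] := by
  simp only [push, den_letP, den_tab, den_lift, den_ite, den_ltN, den_v0, den_get,
    den_len, den_addN, den_lit, den_minN]
  rw [min_eq_left h]
  clear h
  generalize (den e x : List a.Val) = l
  generalize (den y x : a.Val) = z
  refine List.ext_getElem (by simp) fun i h1 h2 => ?_
  simp only [length_tabList] at h1
  simp only [tabList, List.getElem_ofFn]
  by_cases h : i < l.length
  · simp [h, List.getElem_append_left]
  · have : i = l.length := by omega
    subst this
    simp

@[simp] theorem den_call (f : Prog (.prod a .nat) b) (e : Prog Γ a) (n : Prog Γ .nat) :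
    den (call f e n) x = den f (den e x, den n x) := rfl

@[simp] theorem den_call₂ (f : Prog (.prod (.prod a .nat) .nat) b) (e : Prog Γ a)
    (n m : Prog Γ .nat) : den (call₂ f e n m) x = den f ((den e x, den n x), den m x) := rfl

@[simp] theorem den_sumP (n : Prog Γ .nat) (f : Prog (.prod Γ .nat) .real) :
    den (sumP n f) x = ∑ i ∈ Finset.range (den n x), (den f (x, i) : ℝ) := by
  simp only [sumP, den_forP, den_addR, den_v0, den_lift, den_toR, den_lit]
  rw [passes_add]
  simp

@[simp] theorem den_iteEq (e f : Prog Γ .nat) (g h : Prog Γ a) :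
    den (iteEq e f g h) x = if (den e x : ℕ) = den f x then den g x else den h x := by
  simp only [iteEq, den_ite, den_ltN, decide_eq_true_eq]
  rcases lt_trichotomy (den e x : ℕ) (den f x) with h | h | h
  · rw [if_pos h, if_neg (ne_of_lt h)]
  · rw [if_pos h, if_neg (not_lt.mpr (le_of_eq h.symm)), if_neg (not_lt.mpr (le_of_eq h))]
  · rw [if_neg (lt_asymm h), if_pos h, if_neg (ne_of_gt h)]

end den

/-! ### Costs of the derived constructions -/

section cost

variable {x : Γ.Val} {W T W' T' : ℕ}

theorem Cost.v0 {x : (Ty.prod Γ a).Val} : Cost v0 x 1 1 := Cost.prim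
theorem Cost.lift {e : Prog Γ a} {x : (Ty.prod Γ b).Val} (h : Cost e x.1 W T) :
    Cost (lift e) x (1 + W) (1 + T) := Cost.prim.comp h
theorem Cost.fstP {e : Prog Γ (.prod a b)} (h : Cost e x W T) : Cost (fstP e) x (W + 1) (T + 1) :=
  h.comp Cost.prim
theorem Cost.sndP {e : Prog Γ (.prod a b)} (h : Cost e x W T) : Cost (sndP e) x (W + 1) (T + 1) :=
  h.comp Cost.prim
theorem Cost.lit {k : ℕ} : Cost (lit k) x 1 1 := Cost.prim
theorem Cost.toR {e : Prog Γ .nat} (h : Cost e x W T) : Cost (toR e) x (W + 1) (T + 1) :=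
  h.comp Cost.prim
theorem Cost.half {e : Prog Γ .nat} (h : Cost e x W T) : Cost (half e) x (W + 1) (T + 1) :=
  h.comp Cost.prim
theorem Cost.addN {e f : Prog Γ .nat} (h : Cost e x W T) (h' : Cost f x W' T') :
    Cost (e + f) x (W + W' + 1 + 1) (T + T' + 1 + 1) := (h.pair h').comp Cost.prim
theorem Cost.subN {e f : Prog Γ .nat} (h : Cost e x W T) (h' : Cost f x W' T') :
    Cost (e - f) x (W + W' + 1 + 1) (T + T' + 1 + 1) := (h.pair h').comp Cost.prim
theorem Cost.addR {e f : Prog Γ .real} (h : Cost e x W T) (h' : Cost f x W' T') :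
    Cost (e + f) x (W + W' + 1 + 1) (T + T' + 1 + 1) := (h.pair h').comp Cost.prim
theorem Cost.subR {e f : Prog Γ .real} (h : Cost e x W T) (h' : Cost f x W' T') :
    Cost (e - f) x (W + W' + 1 + 1) (T + T' + 1 + 1) := (h.pair h').comp Cost.prim
theorem Cost.mulR {e f : Prog Γ .real} (h : Cost e x W T) (h' : Cost f x W' T') :
    Cost (e * f) x (W + W' + 1 + 1) (T + T' + 1 + 1) := (h.pair h').comp Cost.prim
theorem Cost.divR {e f : Prog Γ .real} (h : Cost e x W T) (h' : Cost f x W' T') :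
    Cost (e / f) x (W + W' + 1 + 1) (T + T' + 1 + 1) := (h.pair h').comp Cost.prim
theorem Cost.ltN {e f : Prog Γ .nat} (h : Cost e x W T) (h' : Cost f x W' T') :
    Cost (ltN e f) x (W + W' + 1 + 1) (T + T' + 1 + 1) := (h.pair h').comp Cost.prim
theorem Cost.ltR {e f : Prog Γ .real} (h : Cost e x W T) (h' : Cost f x W' T') :
    Cost (ltR e f) x (W + W' + 1 + 1) (T + T' + 1 + 1) := (h.pair h').comp Cost.prim
theorem Cost.len {e : Prog Γ (.arr a)} (h : Cost e x W T) : Cost (len e) x (W + 1) (T + 1) :=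
  h.comp Cost.prim
theorem Cost.get {e : Prog Γ (.arr a)} {i : Prog Γ .nat} (h : Cost e x W T)
    (h' : Cost i x W' T') : Cost (get e i) x (W + W' + 1 + 1) (T + T' + 1 + 1) :=
  (h.pair h').comp Cost.prim
theorem Cost.letP {e : Prog Γ a} {f : Prog (.prod Γ a) b} (h : Cost e x W T)
    (h' : Cost f (x, den e x) W' T') : Cost (letP e f) x (1 + W + 1 + W') (1 + T + 1 + T') :=
  (Cost.prim.pair h).comp h'
theorem Cost.minN {e f : Prog Γ .nat} (h : Cost e x W T) (h' : Cost f x W' T') :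
    Cost (minN e f) x ((W + W' + 1 + 1) + W + W' + 1) ((T + T' + 1 + 1) + T + T' + 1) :=
  (h.ltN h').ite h h'

theorem Cost.tab {n : Prog Γ .nat} {f : Prog (.prod Γ .nat) a} {Wf : ℕ → ℕ} {Tf : ℕ}
    (hn : Cost n x W T) (hf : ∀ i < (den n x : ℕ), Cost f (x, i) (Wf i) Tf) :
    Cost (tab n f) x (1 + W + 1 + (∑ i ∈ Finset.range (den n x), Wf i + 1))
      (1 + T + 1 + (Tf + 1)) :=
  (Cost.prim.pair hn).comp (Cost.tabulate hf)

theorem Cost.forP {n : Prog Γ .nat} {s : Prog Γ a} {f : Prog (.prod (.prod Γ .nat) a) a}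
    {Wf Tf : ℕ → ℕ} (hn : Cost n x W T) (hs : Cost s x W' T')
    (hf : ∀ i < (den n x : ℕ), Cost f ((x, i), passes (fun i s => den f ((x, i), s)) (den s x) i)
      (Wf i) (Tf i)) :
    Cost (forP n s f) x (W + W' + ∑ i ∈ Finset.range (den n x), (Wf i + 30) + 30)
      (T + T' + ∑ i ∈ Finset.range (den n x), (Tf i + 30) + 30) := by
  have hl : Cost (.loop forCond (forStep f)) ((x, (den n x : ℕ)), ((0 : ℕ), den s x))
      (∑ i ∈ Finset.range (den n x), (Wf i + 19 + 6 + 1) + (6 + 1))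
      (∑ i ∈ Finset.range (den n x), (Tf i + 19 + 6 + 1) + (6 + 1)) := by
    refine Cost.loop (W := fun i => Wf i + 19) (T := fun i => Tf i + 19) (Wc := 6) (Tc := 6)
      (fun i hi => ?_) ?_ (fun i hi => ?_) (fun i hi => ?_)
    · rw [forStep_iterate]; exact decide_eq_true hi
    · rw [forStep_iterate]; simp [forCond]
    · exact (Cost.ltN Cost.v0.fstP Cost.prim.sndP)
    · rw [forStep_iterate]
      refine (Cost.prim.pair ((Cost.v0.fstP.addN Cost.lit).pair
        (((Cost.prim.fstP.pair Cost.v0.fstP).pair Cost.v0.sndP).comp (hf i hi)))).mono ?_ ?_ <;>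
      omega
  refine (((Cost.prim.pair hn).pair (Cost.lit.pair hs)).comp (hl.comp Cost.v0.sndP)).mono ?_ ?_ <;>
  · simp only [Finset.sum_add_distrib, Finset.sum_const, Finset.card_range, smul_eq_mul]
    omega

theorem Cost.push {n : Prog Γ .nat} {e : Prog Γ (.arr a)} {y : Prog Γ a} {W'' T'' : ℕ}
    (hn : Cost n x W T) (he : Cost e x W' T') (hy : Cost y x W'' T'') :
    Cost (push n e y) x (2 * W + W' + W'' + 30 * den n x + 100) (2 * T + T' + T'' + 100) := by
  refine ((he.letP (hy.lift.letP (((Cost.v0.lift.len.minN hn.lift.lift).addN Cost.lit).tab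
    fun i _ => (Cost.ite (Cost.v0.ltN Cost.v0.lift.lift.len)
      (Cost.v0.lift.lift.get Cost.v0) Cost.v0.lift))))).mono ?_ ?_
  · simp only [Finset.sum_const, Finset.card_range, smul_eq_mul, den_addN, den_minN, den_lit,
      den_lift]
    have : min (den (WorkDepth.len (WorkDepth.lift WorkDepth.v0)) ((x, den e x), den y x))
        (den n x) ≤ (den n x : ℕ) :=
      min_le_right _ _
    simp only [den_len, den_lift, den_v0] at this ⊢
    have key : ∀ z m : ℕ, z ≤ m → 1 + W' + 1 + (1 + (1 + W'') + 1 + (1 + (1 + 1 + 1 + (1 + (1 + W)) +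
        1 + 1 + (1 + 1 + 1) + (1 + (1 + W)) + 1 + 1 + 1 + 1) + 1 + ((z + 1) * (1 + (1 + (1 + 1) + 1) +
        1 + 1 + (1 + (1 + 1) + 1 + 1 + 1) + (1 + 1) + 1) + 1))) ≤
        2 * W + W' + W'' + 30 * m + 100 := fun z m h => by omega
    exact key _ _ this
  · omega

end cost

end WorkDepth

/-! ### Polynomial time -/

namespace WorkDepth

variable {Γ a b c : Ty}

/-- `f` is bounded by a polynomial in `N`. -/
def PolyBdd {α : Type} (N f : α → ℕ) : Prop := ∃ c k, ∀ x, f x ≤ c * (N x + 1) ^ k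

theorem PolyBdd.mono {α : Type} {N f g : α → ℕ} (h : PolyBdd N g) (hfg : ∀ x, f x ≤ g x) :
    PolyBdd N f := by
  obtain ⟨c, k, h⟩ := h
  exact ⟨c, k, fun x => (hfg x).trans (h x)⟩

theorem PolyBdd.const {α : Type} {N : α → ℕ} (c : ℕ) : PolyBdd N fun _ => c :=
  ⟨c, 0, fun x => by simp⟩

theorem PolyBdd.add {α : Type} {N f g : α → ℕ} (hf : PolyBdd N f) (hg : PolyBdd N g) :
    PolyBdd N fun x => f x + g x := by
  obtain ⟨c, k, hf⟩ := hf
  obtain ⟨c', k', hg⟩ := hg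
  refine ⟨c + c', max k k', fun x => ?_⟩
  have h1 : (N x + 1) ^ k ≤ (N x + 1) ^ max k k' :=
    Nat.pow_le_pow_right (Nat.succ_pos _) (le_max_left _ _)
  have h2 : (N x + 1) ^ k' ≤ (N x + 1) ^ max k k' :=
    Nat.pow_le_pow_right (Nat.succ_pos _) (le_max_right _ _)
  rw [add_mul]
  exact Nat.add_le_add ((hf x).trans (Nat.mul_le_mul_left _ h1))
    ((hg x).trans (Nat.mul_le_mul_left _ h2))

theorem PolyBdd.mul {α : Type} {N f g : α → ℕ} (hf : PolyBdd N f) (hg : PolyBdd N g) :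
    PolyBdd N fun x => f x * g x := by
  obtain ⟨c, k, hf⟩ := hf
  obtain ⟨c', k', hg⟩ := hg
  refine ⟨c * c', k + k', fun x => ?_⟩
  calc f x * g x ≤ (c * (N x + 1) ^ k) * (c' * (N x + 1) ^ k') := Nat.mul_le_mul (hf x) (hg x)
    _ = _ := by ring

theorem PolyBdd.trans {α β : Type} {N : α → ℕ} {N' f : β → ℕ} {e : α → β} (hf : PolyBdd N' f)
    (he : PolyBdd N fun x => N' (e x)) : PolyBdd N fun x => f (e x) := by
  obtain ⟨c, k, hf⟩ := hf
  obtain ⟨c', k', he⟩ := he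
  refine ⟨c * (c' + 1) ^ k, k' * k, fun x => (hf _).trans ?_⟩
  have h1 : N' (e x) + 1 ≤ (c' + 1) * (N x + 1) ^ k' := by
    have := he x
    have h2 : 1 ≤ (N x + 1) ^ k' := Nat.one_le_pow _ _ (Nat.succ_pos _)
    nlinarith
  calc c * (N' (e x) + 1) ^ k ≤ c * ((c' + 1) * (N x + 1) ^ k') ^ k :=
        Nat.mul_le_mul_left _ (Nat.pow_le_pow_left h1 k)
    _ = _ := by rw [mul_pow, ← pow_mul, mul_assoc]

/-- The size of the environment, after a further variable is bound. -/
def up (N : Γ.Val → ℕ) : (Ty.prod Γ a).Val → ℕ := fun x => N x.1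
/-- The size of an input that ends with a natural number. -/
def size : (Ty.prod Γ .nat).Val → ℕ := fun x => x.2
/-- The size of an input that ends with two natural numbers. -/
def size₂ : (Ty.prod (.prod Γ .nat) .nat).Val → ℕ := fun x => (x.1.2 + x.2 : ℕ)

/-- `P` always halts, after a number of operations polynomial in `N`. -/
class PolyTime (N : Γ.Val → ℕ) (P : Prog Γ a) : Prop where
  halts : ∀ x, Halts P x
  bdd : PolyBdd N (work P)

/-- The value of `P` is polynomial in `N`. -/
class PolyVal (N : Γ.Val → ℕ) (P : Prog Γ .nat) : Prop where
  bdd : PolyBdd N (fun x => (den P x : ℕ))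

theorem PolyTime.of_cost {N : Γ.Val → ℕ} {P : Prog Γ a} (W : Γ.Val → ℕ) (hW : PolyBdd N W)
    (h : ∀ x, ∃ T, Cost P x (W x) T) : PolyTime N P :=
  ⟨fun x => (h x).choose_spec.1, hW.mono fun x => (h x).choose_spec.2.1⟩

theorem PolyTime.cost {N : Γ.Val → ℕ} {P : Prog Γ a} (h : PolyTime N P) (x : Γ.Val) :
    Cost P x (work P x) (depth P x) := ⟨h.halts x, le_rfl, le_rfl⟩

variable {N : Γ.Val → ℕ}

theorem PolyBdd.up {f : Γ.Val → ℕ} (h : PolyBdd N f) :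
    PolyBdd (up N : (Ty.prod Γ a).Val → ℕ) fun x => f x.1 := by
  obtain ⟨c, k, h⟩ := h
  exact ⟨c, k, fun x => h x.1⟩

/-- The size `up N` ignores the variable bound last, so one bound serves all entries of a table and
all values of a bound variable. -/
theorem PolyTime.work_le {P : Prog (.prod Γ a) b}
    (h : PolyTime (up N) P) : ∃ W : Γ.Val → ℕ, PolyBdd N W ∧ ∀ x y, work P (x, y) ≤ W x := by
  obtain ⟨c, k, h⟩ := h.bdd
  exact ⟨fun x => c * (N x + 1) ^ k, ⟨c, k, fun _ => le_rfl⟩, fun x y => h (x, y)⟩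

instance PolyVal.size : PolyVal (size (Γ := Γ)) v0 := ⟨⟨1, 1, fun x => by simp [WorkDepth.size]⟩⟩
instance PolyVal.size₂_left : PolyVal (size₂ (Γ := Γ)) v1 :=
  ⟨⟨1, 1, fun x => by simp [WorkDepth.size₂]; omega⟩⟩
instance PolyVal.size₂_right : PolyVal (size₂ (Γ := Γ)) v0 :=
  ⟨⟨1, 1, fun x => by simp [WorkDepth.size₂]; omega⟩⟩
instance PolyVal.lift {e : Prog Γ .nat} [h : PolyVal N e] :
    PolyVal (up N : (Ty.prod Γ a).Val → ℕ) (lift e) := ⟨h.bdd.up⟩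
instance PolyVal.lit {k : ℕ} : PolyVal N (lit k) := ⟨PolyBdd.const k⟩
instance PolyVal.addN {e f : Prog Γ .nat} [he : PolyVal N e] [hf : PolyVal N f] :
    PolyVal N (e + f) := ⟨he.bdd.add hf.bdd⟩

instance PolyTime.v0 {N : (Ty.prod Γ a).Val → ℕ} : PolyTime N v0 :=
  .of_cost _ (.const 1) fun _ => ⟨_, Cost.v0⟩
instance PolyTime.prim {p : Prim Γ a} : PolyTime N (.prim p) :=
  .of_cost _ (.const 1) fun _ => ⟨_, Cost.prim⟩
instance PolyTime.lit {k : ℕ} : PolyTime N (lit k) := .of_cost _ (.const 1) fun _ => ⟨_, Cost.lit⟩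
instance PolyTime.lift_up {e : Prog Γ a} [h : PolyTime N e] :
    PolyTime (up N : (Ty.prod Γ b).Val → ℕ) (lift e) :=
  .of_cost _ ((PolyBdd.const 1).add h.bdd.up) fun x => ⟨_, (h.cost x.1).lift⟩
-- Complements `PolyTime.lift_up` for sizes such as `size₂`, which are not of the form `up`.
instance PolyTime.lift_v0 {N : (Ty.prod (.prod Γ a) b).Val → ℕ} : PolyTime N (WorkDepth.lift WorkDepth.v0) :=
  .of_cost _ (.const _) fun _ => ⟨_, Cost.v0.lift⟩
instance PolyTime.pair {e : Prog Γ a} {f : Prog Γ b} [he : PolyTime N e] [hf : PolyTime N f] :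
    PolyTime N (.pair e f) :=
  .of_cost _ ((he.bdd.add hf.bdd).add (.const 1)) fun x => ⟨_, (he.cost x).pair (hf.cost x)⟩
instance PolyTime.ite {d : Prog Γ .bool} {e f : Prog Γ b} [hd : PolyTime N d] [he : PolyTime N e]
    [hf : PolyTime N f] : PolyTime N (.ite d e f) :=
  .of_cost _ (((hd.bdd.add he.bdd).add hf.bdd).add (.const 1)) fun x =>
    ⟨_, (hd.cost x).ite (he.cost x) (hf.cost x)⟩
instance PolyTime.fstP {e : Prog Γ (.prod a b)} [he : PolyTime N e] : PolyTime N (fstP e) :=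
  .of_cost _ (he.bdd.add (.const _)) fun x => ⟨_, (he.cost x).fstP⟩
instance PolyTime.sndP {e : Prog Γ (.prod a b)} [he : PolyTime N e] : PolyTime N (sndP e) :=
  .of_cost _ (he.bdd.add (.const _)) fun x => ⟨_, (he.cost x).sndP⟩
instance PolyTime.toR {e : Prog Γ .nat} [he : PolyTime N e] : PolyTime N (toR e) :=
  .of_cost _ (he.bdd.add (.const _)) fun x => ⟨_, (he.cost x).toR⟩
instance PolyTime.addN {e f : Prog Γ .nat} [he : PolyTime N e] [hf : PolyTime N f] :
    PolyTime N (e + f) :=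
  .of_cost _ (((he.bdd.add hf.bdd).add (.const 1)).add (.const 1)) fun x =>
    ⟨_, (he.cost x).addN (hf.cost x)⟩
instance PolyTime.addR {e f : Prog Γ .real} [he : PolyTime N e] [hf : PolyTime N f] :
    PolyTime N (e + f) :=
  .of_cost _ (((he.bdd.add hf.bdd).add (.const 1)).add (.const 1)) fun x =>
    ⟨_, (he.cost x).addR (hf.cost x)⟩
instance PolyTime.subR {e f : Prog Γ .real} [he : PolyTime N e] [hf : PolyTime N f] :
    PolyTime N (e - f) :=
  .of_cost _ (((he.bdd.add hf.bdd).add (.const 1)).add (.const 1)) fun x =>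
    ⟨_, (he.cost x).subR (hf.cost x)⟩
instance PolyTime.mulR {e f : Prog Γ .real} [he : PolyTime N e] [hf : PolyTime N f] :
    PolyTime N (e * f) :=
  .of_cost _ (((he.bdd.add hf.bdd).add (.const 1)).add (.const 1)) fun x =>
    ⟨_, (he.cost x).mulR (hf.cost x)⟩
instance PolyTime.divR {e f : Prog Γ .real} [he : PolyTime N e] [hf : PolyTime N f] :
    PolyTime N (e / f) :=
  .of_cost _ (((he.bdd.add hf.bdd).add (.const 1)).add (.const 1)) fun x =>
    ⟨_, (he.cost x).divR (hf.cost x)⟩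
instance PolyTime.ltN {e f : Prog Γ .nat} [he : PolyTime N e] [hf : PolyTime N f] :
    PolyTime N (ltN e f) :=
  .of_cost _ (((he.bdd.add hf.bdd).add (.const 1)).add (.const 1)) fun x =>
    ⟨_, (he.cost x).ltN (hf.cost x)⟩
instance PolyTime.ltR {e f : Prog Γ .real} [he : PolyTime N e] [hf : PolyTime N f] :
    PolyTime N (ltR e f) :=
  .of_cost _ (((he.bdd.add hf.bdd).add (.const 1)).add (.const 1)) fun x =>
    ⟨_, (he.cost x).ltR (hf.cost x)⟩
instance PolyTime.get {e : Prog Γ (.arr a)} {i : Prog Γ .nat} [he : PolyTime N e]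
    [hi : PolyTime N i] : PolyTime N (get e i) :=
  .of_cost _ (((he.bdd.add hi.bdd).add (.const 1)).add (.const 1)) fun x =>
    ⟨_, (he.cost x).get (hi.cost x)⟩

instance PolyTime.letP {e : Prog Γ a} {f : Prog (.prod Γ a) b} [he : PolyTime N e]
    [hf : PolyTime (up N) f] : PolyTime N (letP e f) := by
  obtain ⟨W, hW, hfW⟩ := hf.work_le
  exact .of_cost _ ((((PolyBdd.const 1).add he.bdd).add (.const 1)).add hW) fun x =>
    ⟨_, (he.cost x).letP ((hf.cost _).mono (hfW _ _) le_rfl)⟩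

instance PolyTime.tab {n : Prog Γ .nat} {f : Prog (.prod Γ .nat) a} [hn : PolyTime N n]
    [hv : PolyVal N n] [hf : PolyTime (up N) f] : PolyTime N (tab n f) := by
  obtain ⟨W, hW, hfW⟩ := hf.work_le
  refine .of_cost (fun x => 1 + work n x + 1 + (den n x * W x + 1)) ?_ fun x => ?_
  · exact (((PolyBdd.const 1).add hn.bdd).add (.const 1)).add ((hv.bdd.mul hW).add (.const 1))
  -- Only the work is of interest here; the supremum serves as some bound on the depth.
  · refine ⟨_, ((hn.cost x).tab (Wf := fun _ => W x)
      (Tf := (Finset.range (den n x)).sup fun i => depth f (x, i)) fun i hi =>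
        (hf.cost _).mono (hfW _ _) (Finset.le_sup (f := fun i => depth f (x, i))
          (Finset.mem_range.mpr hi))).mono (le_of_eq ?_) le_rfl⟩
    rw [Finset.sum_const, Finset.card_range, smul_eq_mul]

/-- The bound on the body is uniform in the counter and in the state, since arithmetic has unit cost
and inner loop counts depend on the environment only. Hence no loop invariant is needed for the
running time. -/
instance PolyTime.forP {n : Prog Γ .nat} {s : Prog Γ a} {f : Prog (.prod (.prod Γ .nat) a) a}
    [hn : PolyTime N n] [hv : PolyVal N n] [hs : PolyTime N s] [hf : PolyTime (up (up N)) f] :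
    PolyTime N (forP n s f) := by
  obtain ⟨c, k, hb⟩ := hf.bdd
  refine .of_cost (fun x => work n x + work s x + den n x * (c * (N x + 1) ^ k + 30) + 30) ?_
    fun x => ⟨_, ((hn.cost x).forP (hs.cost x) (Wf := fun _ => c * (N x + 1) ^ k)
      fun i _ => (hf.cost _).mono (hb _) le_rfl).mono (le_of_eq ?_) le_rfl⟩
  · exact ((hn.bdd.add hs.bdd).add (hv.bdd.mul
      (PolyBdd.add (f := fun x => c * (N x + 1) ^ k) ⟨c, k, fun _ => le_rfl⟩ (.const 30)))).add
      (.const 30)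
  · rw [Finset.sum_const, Finset.card_range, smul_eq_mul]

instance PolyTime.sumP {n : Prog Γ .nat} {f : Prog (.prod Γ .nat) .real} [hn : PolyTime N n]
    [hv : PolyVal N n] [hf : PolyTime (up N) f] : PolyTime N (sumP n f) := by
  unfold WorkDepth.sumP; infer_instance
instance PolyTime.iteEq {e f : Prog Γ .nat} {g h : Prog Γ a} [he : PolyTime N e]
    [hf : PolyTime N f] [hg : PolyTime N g] [hh : PolyTime N h] : PolyTime N (iteEq e f g h) := by
  unfold WorkDepth.iteEq; infer_instance
instance PolyTime.push {n : Prog Γ .nat} {e : Prog Γ (.arr a)} {y : Prog Γ a}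
    [hn : PolyTime N n] [hv : PolyVal N n] [he : PolyTime N e] [hy : PolyTime N y] :
    PolyTime N (push n e y) :=
  .of_cost _ ((((((PolyBdd.const 2).mul hn.bdd).add he.bdd).add hy.bdd).add
    ((PolyBdd.const 30).mul hv.bdd)).add (.const 100)) fun x =>
    ⟨_, (hn.cost x).push (he.cost x) (hy.cost x)⟩

instance PolyTime.call {f : Prog (.prod a .nat) b} {e : Prog Γ a} {n : Prog Γ .nat}
    [hf : PolyTime size f] [he : PolyTime N e] [hn : PolyTime N n] [hv : PolyVal N n] :
    PolyTime N (call f e n) :=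
  .of_cost _ (((he.bdd.add hn.bdd).add (.const 1)).add
    (hf.bdd.trans (e := fun x => (den e x, (den n x : ℕ))) hv.bdd)) fun x =>
    ⟨_, ((he.cost x).pair (hn.cost x)).comp (hf.cost _)⟩

instance PolyTime.call₂ {f : Prog (.prod (.prod a .nat) .nat) b} {e : Prog Γ a}
    {n m : Prog Γ .nat} [hf : PolyTime size₂ f] [he : PolyTime N e] [hn : PolyTime N n]
    [hv : PolyVal N n] [hm : PolyTime N m] [hu : PolyVal N m] : PolyTime N (call₂ f e n m) :=
  .of_cost _ (((((he.bdd.add hn.bdd).add (.const 1)).add hm.bdd).add (.const 1)).add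
    (hf.bdd.trans (e := fun x => ((den e x, (den n x : ℕ)), (den m x : ℕ)))
      (hv.bdd.add hu.bdd))) fun x =>
    ⟨_, (((he.cost x).pair (hn.cost x)).pair (hm.cost x)).comp (hf.cost _)⟩

end WorkDepth

/-! ### Positive semidefinite real matrices -/

namespace RealMatrix

open Matrix

variable {ι : Type*} [Fintype ι]

/-- The bilinear form of a matrix. -/
def form (A : Matrix ι ι ℝ) (x y : ι → ℝ) : ℝ := x ⬝ᵥ A *ᵥ y

theorem form_add (A B : Matrix ι ι ℝ) (x y : ι → ℝ) : form (A + B) x y = form A x y + form B x y := by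
  simp [form, add_mulVec, dotProduct_add]
theorem form_sub (A B : Matrix ι ι ℝ) (x y : ι → ℝ) : form (A - B) x y = form A x y - form B x y := by
  simp [form, sub_mulVec, dotProduct_sub]
theorem form_smul (c : ℝ) (A : Matrix ι ι ℝ) (x y : ι → ℝ) : form (c • A) x y = c * form A x y := by
  simp [form, smul_mulVec, dotProduct_smul]
theorem form_one [DecidableEq ι] (x y : ι → ℝ) : form 1 x y = x ⬝ᵥ y := by simp [form]
theorem form_vecMulVec (v w x y : ι → ℝ) : form (vecMulVec v w) x y = (x ⬝ᵥ v) * (w ⬝ᵥ y) := by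
  simp [form, vecMulVec_mulVec, dotProduct_smul, mul_comm]
theorem form_add_left (A : Matrix ι ι ℝ) (x y z : ι → ℝ) :
    form A (x + y) z = form A x z + form A y z := by simp [form, add_dotProduct]
theorem form_add_right (A : Matrix ι ι ℝ) (x y z : ι → ℝ) :
    form A x (y + z) = form A x y + form A x z := by simp [form, mulVec_add, dotProduct_add]
theorem form_sub_left (A : Matrix ι ι ℝ) (x y z : ι → ℝ) :
    form A (x - y) z = form A x z - form A y z := by simp [form, sub_dotProduct]
theorem form_sub_right (A : Matrix ι ι ℝ) (x y z : ι → ℝ) :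
    form A x (y - z) = form A x y - form A x z := by simp [form, mulVec_sub, dotProduct_sub]
theorem form_smul_left (A : Matrix ι ι ℝ) (c : ℝ) (x y : ι → ℝ) :
    form A (c • x) y = c * form A x y := by simp [form]
theorem form_smul_right (A : Matrix ι ι ℝ) (c : ℝ) (x y : ι → ℝ) :
    form A x (c • y) = c * form A x y := by simp [form, mulVec_smul]
theorem form_mul (A B : Matrix ι ι ℝ) (x y : ι → ℝ) : form (A * B) x y = form A x (B *ᵥ y) := by
  simp [form]
theorem form_transpose (A : Matrix ι ι ℝ) (x y : ι → ℝ) : form Aᵀ x y = form A y x := by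
  rw [form, form, mulVec_transpose, dotProduct_mulVec, dotProduct_comm]
theorem form_comm {A : Matrix ι ι ℝ} (hA : A.IsSymm) (x y : ι → ℝ) : form A x y = form A y x := by
  rw [← form_transpose, hA.eq]

theorem isHermitian_iff {A : Matrix ι ι ℝ} : A.IsHermitian ↔ A.IsSymm := by
  rw [Matrix.IsHermitian, Matrix.IsSymm, conjTranspose_eq_transpose_of_trivial]

theorem posSemidef_iff {A : Matrix ι ι ℝ} : A.PosSemidef ↔ A.IsSymm ∧ ∀ x, 0 ≤ form A x x := by
  rw [posSemidef_iff_dotProduct_mulVec, isHermitian_iff]; rfl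

theorem posDef_iff {A : Matrix ι ι ℝ} : A.PosDef ↔ A.IsSymm ∧ ∀ x, x ≠ 0 → 0 < form A x x := by
  rw [posDef_iff_dotProduct_mulVec, isHermitian_iff]; rfl

theorem _root_.Matrix.PosSemidef.isSymm {A : Matrix ι ι ℝ} (h : A.PosSemidef) : A.IsSymm :=
  (posSemidef_iff.mp h).1
theorem _root_.Matrix.PosSemidef.form_nonneg {A : Matrix ι ι ℝ} (h : A.PosSemidef) (x : ι → ℝ) :
    0 ≤ form A x x := (posSemidef_iff.mp h).2 x
theorem _root_.Matrix.PosDef.isSymm {A : Matrix ι ι ℝ} (h : A.PosDef) : A.IsSymm :=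
  (posDef_iff.mp h).1
theorem _root_.Matrix.PosDef.form_pos {A : Matrix ι ι ℝ} (h : A.PosDef) {x : ι → ℝ} (hx : x ≠ 0) :
    0 < form A x x := (posDef_iff.mp h).2 x hx

/-- The quadratic polynomial t ↦ `form A (x + t • y) (x + t • y)` is nonnegative, so its
discriminant is not positive. -/
theorem cauchy_schwarz {A : Matrix ι ι ℝ} (hA : A.PosSemidef) (x y : ι → ℝ) :
    form A x y ^ 2 ≤ form A x x * form A y y := by
  have h : ∀ t : ℝ, 0 ≤ form A y y * (t * t) + 2 * form A x y * t + form A x x := fun t => by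
    have := hA.form_nonneg (x + t • y)
    simp only [form_add_left, form_add_right, form_smul_left, form_smul_right,
      form_comm hA.isSymm y x] at this
    linarith
  have := discrim_le_zero h
  rw [discrim] at this
  nlinarith

variable [DecidableEq ι]

theorem mul_inv_posDef {W : Matrix ι ι ℝ} (hW : W.PosDef) : W * W⁻¹ = 1 :=
  mul_nonsing_inv _ ((isUnit_iff_isUnit_det _).mp hW.isUnit)
theorem inv_mul_posDef {W : Matrix ι ι ℝ} (hW : W.PosDef) : W⁻¹ * W = 1 :=
  nonsing_inv_mul _ ((isUnit_iff_isUnit_det _).mp hW.isUnit)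

/-- Cauchy–Schwarz for W at x and W⁻¹y. It says that xxᵀ is at most `form W x x` times W⁻¹ and
replaces a passage to W^(1/2). -/
theorem dotProduct_sq_le {W : Matrix ι ι ℝ} (hW : W.PosDef) (x y : ι → ℝ) :
    (x ⬝ᵥ y) ^ 2 ≤ form W x x * form W⁻¹ y y := by
  have h := cauchy_schwarz hW.posSemidef x (W⁻¹ *ᵥ y)
  rw [← form_mul, mul_inv_posDef hW, form_one] at h
  have h2 : form W (W⁻¹ *ᵥ y) (W⁻¹ *ᵥ y) = form W⁻¹ y y := by
    rw [← form_mul, mul_inv_posDef hW, form_one, form, dotProduct_comm]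
  rwa [h2] at h

/-- With s = `form B⁻¹ x x`, `dotProduct_sq_le` at B⁻¹x gives s² ≤ (c s) · `form A⁻¹ x x`, and s
cancels. -/
theorem form_inv_le {A B : Matrix ι ι ℝ} (hA : A.PosDef) (hB : B.PosDef) {c : ℝ}
    (h : ∀ x, form A x x ≤ c * form B x x) (x : ι → ℝ) :
    form B⁻¹ x x ≤ c * form A⁻¹ x x := by
  have h1 := dotProduct_sq_le hA (B⁻¹ *ᵥ x) x
  have h2 : (B⁻¹ *ᵥ x) ⬝ᵥ x = form B⁻¹ x x := by rw [form, dotProduct_comm]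
  have h3 : form B (B⁻¹ *ᵥ x) (B⁻¹ *ᵥ x) = form B⁻¹ x x := by
    rw [← form_mul, mul_inv_posDef hB, form_one, h2]
  have h4 := h (B⁻¹ *ᵥ x)
  rw [h2] at h1
  rw [h3] at h4
  have h5 : 0 ≤ form A⁻¹ x x := hA.inv.posSemidef.form_nonneg x
  by_cases hx : x = 0
  · subst hx; simp [form]
  have h6 : 0 < form B⁻¹ x x := hB.inv.form_pos hx
  by_contra hlt
  push Not at hlt
  nlinarith [mul_le_mul_of_nonneg_right h4 h5, mul_lt_mul_of_pos_right hlt h6]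

theorem posSemidef_factor {A : Matrix ι ι ℝ} (hA : A.PosSemidef) : ∃ C : Matrix ι ι ℝ, A = Cᵀ * C := by
  open scoped MatrixOrder in
  obtain ⟨C, hC⟩ := CStarAlgebra.nonneg_iff_eq_star_mul_self.mp hA.nonneg
  exact ⟨C, by rw [hC, star_eq_conjTranspose, conjTranspose_eq_transpose_of_trivial]⟩

theorem posSemidef_conj {A : Matrix ι ι ℝ} (hA : A.PosSemidef) (C : Matrix ι ι ℝ) :
    (C * A * Cᵀ).PosSemidef := by
  have := hA.mul_mul_conjTranspose_same C
  rwa [conjTranspose_eq_transpose_of_trivial] at this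

theorem posSemidef_conj_symm {A C : Matrix ι ι ℝ} (hA : A.PosSemidef) (hC : C.IsSymm) :
    (C * A * C).PosSemidef := by
  have := posSemidef_conj hA C
  rwa [hC.eq] at this

theorem posDef_conj_symm {A C : Matrix ι ι ℝ} (hA : A.PosDef) (hC : C.PosDef) :
    (C * A * C).PosDef := by
  rw [posDef_iff]
  refine ⟨(posSemidef_conj_symm hA.posSemidef hC.isSymm).isSymm, fun x hx => ?_⟩
  have h1 : C *ᵥ x ≠ 0 := fun h => by
    have : form C x x = 0 := by rw [form, h, dotProduct_zero]
    exact (hC.form_pos hx).ne' this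
  have h2 : form (C * A * C) x x = form A (C *ᵥ x) (C *ᵥ x) := by
    rw [mul_assoc, form_mul, form_comm hC.isSymm, form, dotProduct_comm]
    rw [← form_mul, form, dotProduct_comm, ← mulVec_mulVec]
  rw [h2]; exact hA.form_pos h1

/-- Writing B = CᵀC turns the trace of AB into that of CACᵀ. -/
theorem trace_mul_nonneg {A B : Matrix ι ι ℝ} (hA : A.PosSemidef) (hB : B.PosSemidef) :
    0 ≤ (A * B).trace := by
  obtain ⟨C, rfl⟩ := posSemidef_factor hB
  rw [← mul_assoc, trace_mul_comm, ← mul_assoc]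
  exact (posSemidef_conj hA C).trace_nonneg

/-- Pair the semidefinite inequality xxᵀ ≼ `form W x x` W⁻¹ with X under the trace. This is how a
potential controls the distance to a barrier. -/
theorem form_le_trace {W X : Matrix ι ι ℝ} (hW : W.PosDef) (hX : X.PosSemidef) (x : ι → ℝ) :
    form X x x ≤ (X * W⁻¹).trace * form W x x := by
  have h : (form W x x • W⁻¹ - vecMulVec x x).PosSemidef := by
    rw [posSemidef_iff]
    refine ⟨?_, fun y => ?_⟩
    · refine (IsSymm.smul hW.inv.isSymm _).sub ?_
      ext i j; simp [vecMulVec_apply, mul_comm]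
    · rw [form_sub, form_smul, form_vecMulVec]
      have := dotProduct_sq_le hW x y
      rw [dotProduct_comm y x]
      nlinarith
  have h2 := trace_mul_nonneg hX h
  rw [mul_sub, trace_sub, mul_smul_comm, trace_smul, mul_vecMulVec, trace_vecMulVec,
    dotProduct_comm, smul_eq_mul] at h2
  rw [form]; linarith

theorem trace_mul_pos [Nonempty ι] {A B : Matrix ι ι ℝ} (hA : A.PosDef) (hB : B.PosDef) :
    0 < (A * B).trace := by
  obtain ⟨i⟩ := ‹Nonempty ι›
  have h := form_le_trace hB.inv hA.posSemidef (Pi.single i 1)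
  have h0 : (Pi.single i 1 : ι → ℝ) ≠ 0 := by simp
  rw [nonsing_inv_nonsing_inv _ ((isUnit_iff_isUnit_det _).mp hB.isUnit)] at h
  have h1 := hA.form_pos h0
  have h2 := hB.inv.form_pos h0
  by_contra hn
  push Not at hn
  nlinarith

/-! ### Rank-one updates -/

theorem isSymm_vecMulVec (b : ι → ℝ) : (vecMulVec b b).IsSymm := by
  ext i j; simp [vecMulVec_apply, mul_comm]

/-- The Sherman–Morrison formula. The sign of s is free, since the update decreases the matrix at
the upper barrier and increases it at the lower one. -/
theorem inv_add_rankOne {B : Matrix ι ι ℝ} (hB : B.PosDef) (b : ι → ℝ) {s : ℝ}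
    (hs : 1 + s * form B⁻¹ b b ≠ 0) :
    (B + s • vecMulVec b b)⁻¹ =
      B⁻¹ - (s / (1 + s * form B⁻¹ b b)) • (B⁻¹ * vecMulVec b b * B⁻¹) := by
  apply inv_eq_right_inv
  have h1 : vecMulVec b b * B⁻¹ * vecMulVec b b = form B⁻¹ b b • vecMulVec b b := by
    rw [vecMulVec_mul, vecMulVec_mul_vecMulVec, form, dotProduct_mulVec]
    ext i j; simp [vecMulVec_apply]; ring
  have h2 : vecMulVec b b * (B⁻¹ * vecMulVec b b * B⁻¹) =
      form B⁻¹ b b • (vecMulVec b b * B⁻¹) := by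
    rw [← mul_assoc, ← mul_assoc, h1, smul_mul_assoc]
  have h3 : B * (B⁻¹ * vecMulVec b b * B⁻¹) = vecMulVec b b * B⁻¹ := by
    rw [← mul_assoc, ← mul_assoc, mul_inv_posDef hB, one_mul]
  rw [add_mul, mul_sub, mul_sub, mul_inv_posDef hB, mul_smul_comm, smul_mul_assoc,
    smul_mul_assoc, mul_smul_comm, h2, h3]
  rw [smul_smul, smul_smul, sub_add, ← sub_smul, ← sub_smul]
  have : s / (1 + s * form B⁻¹ b b) - (s - s * (s / (1 + s * form B⁻¹ b b)) * form B⁻¹ b b) = 0 := by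
    field_simp; ring
  rw [this, zero_smul, sub_zero]

theorem trace_inv_add_rankOne {B : Matrix ι ι ℝ} (hB : B.PosDef) (X : Matrix ι ι ℝ) (b : ι → ℝ)
    {s : ℝ} (hs : 1 + s * form B⁻¹ b b ≠ 0) :
    (X * (B + s • vecMulVec b b)⁻¹).trace = (X * B⁻¹).trace -
      s * form (B⁻¹ * X * B⁻¹) b b / (1 + s * form B⁻¹ b b) := by
  rw [inv_add_rankOne hB b hs, mul_sub, trace_sub, mul_smul_comm, trace_smul]
  have : (X * (B⁻¹ * vecMulVec b b * B⁻¹)).trace = form (B⁻¹ * X * B⁻¹) b b := by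
    rw [mul_assoc, ← mul_assoc X, trace_mul_comm, mul_assoc, ← mul_assoc B⁻¹ X, vecMulVec_mul,
      trace_vecMulVec, dotProduct_comm, ← dotProduct_mulVec, form]
  rw [this, smul_eq_mul]
  ring

theorem posDef_sub_rankOne {B : Matrix ι ι ℝ} (hB : B.PosDef) (b : ι → ℝ) {s : ℝ} (hs : 0 ≤ s)
    (h : s * form B⁻¹ b b < 1) : (B - s • vecMulVec b b).PosDef := by
  rw [posDef_iff]
  refine ⟨hB.isSymm.sub (IsSymm.smul (isSymm_vecMulVec b) s), fun x hx => ?_⟩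
  rw [form_sub, form_smul, form_vecMulVec, dotProduct_comm b x]
  have h1 := dotProduct_sq_le hB x b
  have h2 := hB.form_pos hx
  nlinarith [mul_le_mul_of_nonneg_left h1 hs, mul_lt_mul_of_pos_right h h2]

end RealMatrix

/-! ### The barrier method for spectral sparsification -/

namespace RealMatrix

open Matrix

variable {ι : Type*} [Fintype ι] [DecidableEq ι]

/-- `l X < Y < u X`, with potentials at most `φ` at both barriers. -/
structure Barrier (X Y : Matrix ι ι ℝ) (l u φ : ℝ) : Prop where
  lower : (Y - l • X).PosDef
  upper : (u • X - Y).PosDef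
  lower_pot : (X * (Y - l • X)⁻¹).trace ≤ φ
  upper_pot : (X * (u • X - Y)⁻¹).trace ≤ φ

/-- The matrix of the quadratic form that bounds the increase of the upper potential, when the
upper barrier moves by `δ` to `u`. -/
noncomputable def upperGain (X Y : Matrix ι ι ℝ) (u δ : ℝ) : Matrix ι ι ℝ :=
  (δ * (X * ((u • X - Y)⁻¹ * X * (u • X - Y)⁻¹)).trace)⁻¹ •
    ((u • X - Y)⁻¹ * X * (u • X - Y)⁻¹) + (u • X - Y)⁻¹

/-- The matrix of the quadratic form that bounds the decrease of the lower potential, when the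
lower barrier moves from `l` to `l + 1`. -/
noncomputable def lowerGain (X Y : Matrix ι ι ℝ) (l : ℝ) : Matrix ι ι ℝ :=
  ((X * (Y - (l + 1) • X)⁻¹).trace - (X * (Y - l • X)⁻¹).trace)⁻¹ •
    ((Y - (l + 1) • X)⁻¹ * X * (Y - (l + 1) • X)⁻¹) - (Y - (l + 1) • X)⁻¹

/-! ### The upper barrier. -/

section upper

variable {X Y : Matrix ι ι ℝ} {u δ : ℝ}

theorem posDef_upper_shift (hX : X.PosDef) (hu : (u • X - Y).PosDef) (hδ : 0 < δ) :
    ((u + δ) • X - Y).PosDef := by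
  have : (u + δ) • X - Y = (u • X - Y) + δ • X := by rw [add_smul]; abel
  rw [this]; exact hu.add (hX.smul hδ)

theorem upperGain_posDef (hX : X.PosDef) (hu : (u • X - Y).PosDef) (hδ : 0 < δ) :
    (upperGain X Y u δ).PosDef := by
  have h1 := (posDef_conj_symm hX hu.inv).posSemidef
  refine PosDef.posSemidef_add (h1.smul ?_) hu.inv
  exact inv_nonneg.mpr (mul_nonneg hδ.le (trace_mul_nonneg hX.posSemidef h1))

/-- Quantitative convexity of the potential. With U and B the inverses after and before the shift,
the resolvent identity B - U = δUXB, substituted into itself, leaves δ tr(XUXU) and the nonnegative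
term δ² tr(XUXUXB). -/
theorem upper_pot_shift (hX : X.PosDef) (hu : (u • X - Y).PosDef) (hδ : 0 < δ) :
    (X * ((u + δ) • X - Y)⁻¹).trace +
      δ * (X * (((u + δ) • X - Y)⁻¹ * X * ((u + δ) • X - Y)⁻¹)).trace ≤
      (X * (u • X - Y)⁻¹).trace := by
  have hu' := posDef_upper_shift hX hu hδ
  set U := ((u + δ) • X - Y)⁻¹ with hU
  set B := (u • X - Y)⁻¹ with hB
  have e1 : ((u + δ) • X - Y) = (u • X - Y) + δ • X := by rw [add_smul]; abel
  have h1 : B - U = δ • (U * X * B) := by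
    have a1 : U * ((u + δ) • X - Y) * B = B := by rw [inv_mul_posDef hu', one_mul]
    have a2 : U * (u • X - Y) * B = U := by rw [mul_assoc, mul_inv_posDef hu, mul_one]
    rw [e1, mul_add, add_mul, a2, mul_smul_comm, smul_mul_assoc] at a1
    rw [sub_eq_iff_eq_add, add_comm]; exact a1.symm
  have h2 : (X * B).trace - (X * U).trace = δ * (X * (U * X * B)).trace := by
    rw [← trace_sub, ← mul_sub, h1, mul_smul_comm, trace_smul, smul_eq_mul]
  have h3 : B = U + δ • (U * X * B) := by rw [← h1]; abel
  have h4 : (X * (U * X * B)).trace =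
      (X * (U * X * U)).trace + δ * ((X * U * X * U * X) * B).trace := by
    conv_lhs => rw [h3]
    rw [mul_add, mul_add, trace_add, mul_smul_comm, mul_smul_comm, trace_smul, smul_eq_mul]
    simp only [mul_assoc]
  have h5 : 0 ≤ ((X * U * X * U * X) * B).trace := by
    refine trace_mul_nonneg ?_ hu.inv.posSemidef
    have := posSemidef_conj_symm (posSemidef_conj_symm hX.posSemidef hu'.inv.isSymm) hX.isSymm
    simpa only [mul_assoc] using this
  have h6 : 0 ≤ δ * (δ * ((X * U * X * U * X) * B).trace) := by positivity
  rw [h4, mul_add] at h2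
  linarith

/-- The normalisation of the first summand of `upperGain` is chosen so that it contributes exactly
1/δ. -/
theorem trace_mul_upperGain [Nonempty ι] (hX : X.PosDef) (hu : (u • X - Y).PosDef) (hδ : 0 < δ) :
    (X * upperGain X Y u δ).trace = 1 / δ + (X * (u • X - Y)⁻¹).trace := by
  have h := trace_mul_pos hX (posDef_conj_symm hX hu.inv)
  rw [upperGain, mul_add, trace_add, mul_smul_comm, trace_smul, smul_eq_mul]
  congr 1
  field_simp

/-- By Sherman–Morrison the update raises the potential by w/(ℓ - z). The hypothesis is the
statement that this is at most δρ, which is what the shift of the barrier has gained by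
`upper_pot_shift`. -/
theorem upper_step [Nonempty ι] {φ ℓ : ℝ} (hX : X.PosDef) (hu : (u • X - Y).PosDef) (hδ : 0 < δ)
    (hφ : (X * (u • X - Y)⁻¹).trace ≤ φ) {b : ι → ℝ} (hℓ : 0 < ℓ) (hb : b ≠ 0)
    (h : form (upperGain X Y (u + δ) δ) b b ≤ ℓ) :
    ((u + δ) • X - (Y + ℓ⁻¹ • vecMulVec b b)).PosDef ∧
      (X * ((u + δ) • X - (Y + ℓ⁻¹ • vecMulVec b b))⁻¹).trace ≤ φ := by
  have hu' := posDef_upper_shift hX hu hδ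
  have hs := upper_pot_shift hX hu hδ
  have hρ := trace_mul_pos hX (posDef_conj_symm hX hu'.inv)
  rw [upperGain, form_add, form_smul] at h
  have hQ := (posDef_conj_symm hX hu'.inv).form_pos hb
  set U := ((u + δ) • X - Y)⁻¹ with hU
  set ρ := (X * (U * X * U)).trace
  set w := form (U * X * U) b b
  set z := form U b b
  have hw : 0 < (δ * ρ)⁻¹ * w := by positivity
  have hz : z < ℓ := by linarith
  rw [← sub_sub]
  refine ⟨posDef_sub_rankOne hu' b (inv_nonneg.mpr hℓ.le) ?_, ?_⟩
  · rw [inv_mul_lt_iff₀ hℓ, mul_one]; exact hz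
  · have hne : 1 + -ℓ⁻¹ * z ≠ 0 := by
      have : ℓ⁻¹ * z < 1 := by rw [inv_mul_lt_iff₀ hℓ, mul_one]; exact hz
      linarith
    have := trace_inv_add_rankOne hu' X b hne
    rw [neg_smul, ← sub_eq_add_neg] at this
    rw [this]
    have e : -ℓ⁻¹ * w / (1 + -ℓ⁻¹ * z) = - (w / (ℓ - z)) := by
      have h9 : ℓ - z ≠ 0 := by linarith
      have h10 : 1 + -ℓ⁻¹ * z = (ℓ - z) / ℓ := by field_simp; ring
      rw [h10]
      field_simp
    have h3 : w / (ℓ - z) ≤ δ * ρ := by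
      rw [div_le_iff₀ (by linarith)]
      have : w = δ * ρ * ((δ * ρ)⁻¹ * w) := by field_simp
      rw [this]
      exact mul_le_mul_of_nonneg_left (by linarith) (by positivity)
    change (X * U).trace - -ℓ⁻¹ * w / (1 + -ℓ⁻¹ * z) ≤ φ
    rw [e]
    linarith

end upper

/-! ### The lower barrier. -/

section lower

variable {X Y : Matrix ι ι ℝ} {l φ : ℝ}

/-- A potential below 1 forces X ≺ Y - lX by `form_le_trace`, so there is room for a shift by one
unit. -/
theorem posDef_lower_shift (hX : X.PosDef) (hl : (Y - l • X).PosDef)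
    (hφ : (X * (Y - l • X)⁻¹).trace ≤ φ) (hφ1 : φ < 1) : (Y - (l + 1) • X).PosDef := by
  have e : Y - (l + 1) • X = (Y - l • X) - X := by rw [add_smul, one_smul]; abel
  rw [e, posDef_iff]
  refine ⟨hl.isSymm.sub hX.isSymm, fun x hx => ?_⟩
  rw [form_sub]
  have h1 := form_le_trace hl hX.posSemidef x
  have h2 := hl.form_pos hx
  nlinarith

theorem lower_inv_sub (hl : (Y - l • X).PosDef) (hl' : (Y - (l + 1) • X).PosDef) :
    (Y - (l + 1) • X)⁻¹ - (Y - l • X)⁻¹ = (Y - (l + 1) • X)⁻¹ * X * (Y - l • X)⁻¹ ∧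
    (Y - (l + 1) • X)⁻¹ - (Y - l • X)⁻¹ = (Y - l • X)⁻¹ * X * (Y - (l + 1) • X)⁻¹ := by
  set P := (Y - l • X)⁻¹ with hP
  set R := (Y - (l + 1) • X)⁻¹ with hR
  have e : X = (Y - l • X) - (Y - (l + 1) • X) := by rw [add_smul, one_smul]; abel
  constructor
  · conv_rhs => rw [e]
    rw [mul_sub, inv_mul_posDef hl', sub_mul, one_mul, mul_assoc, mul_inv_posDef hl, mul_one]
  · conv_rhs => rw [e]
    rw [mul_sub, inv_mul_posDef hl, sub_mul, one_mul, mul_assoc, mul_inv_posDef hl', mul_one]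

/-- With P and R the inverses before and after the shift, R - P = PXP + PXRXP is positive definite.
The strict inequality makes the divisor in `lowerGain` positive. -/
theorem lower_pot_lt [Nonempty ι] (hX : X.PosDef) (hl : (Y - l • X).PosDef)
    (hl' : (Y - (l + 1) • X).PosDef) :
    (X * (Y - l • X)⁻¹).trace < (X * (Y - (l + 1) • X)⁻¹).trace := by
  obtain ⟨h1, h2⟩ := lower_inv_sub hl hl'
  have hP := hl.inv
  have hR := hl'.inv
  set P := (Y - l • X)⁻¹ with hPdef
  set R := (Y - (l + 1) • X)⁻¹ with hRdef
  have h3 : R - P = P * X * P + (P * X) * R * (X * P) := by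
    have : R = P + R * X * P := by rw [← h1]; abel
    calc R - P = P * X * R := h2
      _ = P * X * (P + R * X * P) := by rw [← this]
      _ = _ := by rw [mul_add]; simp only [mul_assoc]
  have h4 : (R - P).PosDef := by
    rw [h3]
    refine (posDef_conj_symm hX hP).add_posSemidef ?_
    have := posSemidef_conj hR.posSemidef (P * X)
    rwa [transpose_mul, hX.isSymm.eq, hP.isSymm.eq] at this
  have h5 := trace_mul_pos hX h4
  rw [mul_sub, trace_sub] at h5
  linarith

/-- With s the increase of the potential, the trace equals 1 + τ/s - s - tr(XP), where τ =
tr(XRXPXR). So it suffices that τ ≥ s², which follows from a Cauchy–Schwarz argument for the trace.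
-/
theorem trace_mul_lowerGain [Nonempty ι] (hX : X.PosDef) (hl : (Y - l • X).PosDef)
    (hφ : (X * (Y - l • X)⁻¹).trace ≤ φ) (hφ1 : φ < 1) :
    1 - φ ≤ (X * lowerGain X Y l).trace := by
  have hl' := posDef_lower_shift hX hl hφ hφ1
  have hlt := lower_pot_lt hX hl hl'
  obtain ⟨h1, h2⟩ := lower_inv_sub hl hl'
  have hP := hl.inv
  have hR := hl'.inv
  rw [lowerGain, mul_sub, trace_sub, mul_smul_comm, trace_smul, smul_eq_mul]
  set P := (Y - l • X)⁻¹ with hPdef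
  set R := (Y - (l + 1) • X)⁻¹ with hRdef
  set s := (X * R).trace - (X * P).trace with hs
  have hs0 : 0 < s := by linarith
  have hs1 : s = (X * (P * X * R)).trace := by rw [hs, ← trace_sub, ← mul_sub, h2]
  have hs2 : s = (X * (R * X * P)).trace := by rw [hs, ← trace_sub, ← mul_sub, h1]
  set τ := (X * (R * X * P * X * R)).trace with hτ
  have hR' : R = P + P * X * R := by rw [← h2]; abel
  have hρ : (X * (R * X * R)).trace = s + τ := by
    calc (X * (R * X * R)).trace = (X * (R * X * (P + P * X * R))).trace := by rw [← hR']
      _ = (X * (R * X * P)).trace + τ := by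
        rw [mul_add, mul_add, trace_add, hτ]; simp only [mul_assoc]
      _ = s + τ := by rw [← hs2]
  have hq : ∀ c : ℝ, 0 ≤ (X * P).trace + 2 * c * s + c ^ 2 * τ := fun c => by
    have h := trace_mul_nonneg hX.posSemidef
      (posSemidef_conj hP.posSemidef (1 + c • (R * X)))
    rw [transpose_add, transpose_one, transpose_smul, transpose_mul, hX.isSymm.eq, hR.isSymm.eq] at h
    have e : X * ((1 + c • (R * X)) * P * (1 + c • (X * R))) =
        X * P + c • (X * (P * X * R)) + c • (X * (R * X * P)) +
          (c ^ 2) • (X * (R * X * P * X * R)) := by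
      simp only [add_mul, mul_add, one_mul, mul_one, smul_mul_assoc, mul_smul_comm, smul_smul,
        smul_add, mul_assoc, pow_two]
      abel
    rw [e, trace_add, trace_add, trace_add, trace_smul, trace_smul, trace_smul, ← hs1, ← hs2,
      smul_eq_mul, smul_eq_mul] at h
    linarith
  have hτ2 : s ^ 2 ≤ τ := by
    -- At this c the inequality reads tr(XP) - 2 + τ/s² ≥ 0, and tr(XP) ≤ φ < 1.
    have h := hq (-s⁻¹)
    have e : (-s⁻¹) ^ 2 * τ = τ / s ^ 2 := by field_simp
    have e2 : 2 * (-s⁻¹) * s = -2 := by field_simp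
    rw [e, e2] at h
    have : 1 ≤ τ / s ^ 2 := by linarith
    rwa [le_div_iff₀ (by positivity), one_mul] at this
  rw [hρ]
  have h6 : s⁻¹ * (s + τ) = 1 + τ / s := by field_simp
  have h7 : s ≤ τ / s := by rw [le_div_iff₀ hs0]; nlinarith
  rw [h6]
  linarith

/-- The weight 1/ℓ satisfies ℓ + z = w/s, so the decrease of the potential by the update is exactly
its increase s by the shift. -/
theorem lower_step [Nonempty ι] (hX : X.PosDef) (hl : (Y - l • X).PosDef)
    (hφ : (X * (Y - l • X)⁻¹).trace ≤ φ) (hφ1 : φ < 1) {b : ι → ℝ}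
    (hb : 0 < form (lowerGain X Y l) b b) :
    (Y + (form (lowerGain X Y l) b b)⁻¹ • vecMulVec b b - (l + 1) • X).PosDef ∧
      (X * (Y + (form (lowerGain X Y l) b b)⁻¹ • vecMulVec b b - (l + 1) • X)⁻¹).trace ≤ φ := by
  have hl' := posDef_lower_shift hX hl hφ hφ1
  have hlt := lower_pot_lt hX hl hl'
  set ℓ := form (lowerGain X Y l) b b with hℓ
  have hb0 : b ≠ 0 := by rintro rfl; simp [hℓ, form] at hb
  have e : Y + ℓ⁻¹ • vecMulVec b b - (l + 1) • X =
      (Y - (l + 1) • X) + ℓ⁻¹ • vecMulVec b b := by abel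
  rw [e]
  have hv : (vecMulVec b b).PosSemidef := by
    simpa using posSemidef_vecMulVec_self_star b
  refine ⟨hl'.add_posSemidef (hv.smul (inv_nonneg.mpr hb.le)), ?_⟩
  have hz := hl'.inv.form_pos hb0
  have hne : 1 + ℓ⁻¹ * form (Y - (l + 1) • X)⁻¹ b b ≠ 0 := by positivity
  rw [trace_inv_add_rankOne hl' X b hne]
  rw [lowerGain, form_sub, form_smul] at hℓ
  have hw := (posDef_conj_symm hX hl'.inv).form_pos hb0
  set R := (Y - (l + 1) • X)⁻¹
  set w := form (R * X * R) b b
  set z := form R b b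
  set s := (X * R).trace - (X * (Y - l • X)⁻¹).trace with hs
  have hs0 : 0 < s := by linarith
  have h1 : ℓ + z = w / s := by rw [hℓ]; field_simp; ring
  have h2 : ℓ⁻¹ * w / (1 + ℓ⁻¹ * z) = w / (ℓ + z) := by field_simp
  rw [h2, h1]
  have h3 : w / (w / s) = s := by field_simp
  rw [h3]; linarith

end lower

/-- One step of the barrier method. -/
theorem Barrier.step [Nonempty ι] {X Y : Matrix ι ι ℝ} {l u φ δ : ℝ} (h : Barrier X Y l u φ)
    (hX : X.PosDef) (hδ : 0 < δ) (hφ1 : φ < 1) {b : ι → ℝ}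
    (hb : 0 < form (lowerGain X Y l) b b)
    (hb' : form (upperGain X Y (u + δ) δ) b b ≤ form (lowerGain X Y l) b b) :
    Barrier X (Y + (form (lowerGain X Y l) b b)⁻¹ • vecMulVec b b) (l + 1) (u + δ) φ := by
  have hb0 : b ≠ 0 := by rintro rfl; simp [form] at hb
  obtain ⟨h1, h2⟩ := lower_step hX h.lower h.lower_pot hφ1 hb
  obtain ⟨h3, h4⟩ := upper_step hX h.upper hδ h.upper_pot hb hb0 hb'
  exact ⟨h1, h3, h2, h4⟩

/-- The two traces are separated by 1/δ + φ on the upper side and 1 - φ on the lower side. This is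
the averaged form of the condition on a single vector. -/
theorem Barrier.trace_le [Nonempty ι] {X Y : Matrix ι ι ℝ} {l u φ δ : ℝ} (h : Barrier X Y l u φ)
    (hX : X.PosDef) (hδ : 0 < δ) (hφ1 : φ < 1) (hbal : 1 / δ + φ ≤ 1 - φ) :
    (X * upperGain X Y (u + δ) δ).trace ≤ (X * lowerGain X Y l).trace := by
  have hu' := posDef_upper_shift hX h.upper hδ
  have h1 := trace_mul_upperGain hX hu' hδ
  have h2 := trace_mul_lowerGain hX h.lower h.lower_pot hφ1
  have h3 := upper_pot_shift hX h.upper hδ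
  have h4 := trace_mul_pos hX (posDef_conj_symm hX hu'.inv)
  have h5 := h.upper_pot
  have : 0 < δ * (X * (((u + δ) • X - Y)⁻¹ * X * ((u + δ) • X - Y)⁻¹)).trace := by positivity
  linarith

end RealMatrix

/-! ### Sparsification of diagonally dominant matrices -/

namespace RealMatrix

open Matrix

variable {ι : Type*} [Fintype ι] [DecidableEq ι]

/-- Symmetric matrices with nonpositive off-diagonal entries and nonnegative row sums. -/
structure DiagDom (X : Matrix ι ι ℝ) : Prop where
  symm : X.IsSymm
  offDiag : ∀ i j, i ≠ j → X i j ≤ 0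
  rowSum : ∀ i, 0 ≤ ∑ j, X i j

/-- The vector `e_i - e_j`, or `e_i` if `i = j`. -/
def pairVec (i j : ι) : ι → ℝ :=
  if i = j then Pi.single i 1 else Pi.single i 1 - Pi.single j 1

/-- The value of the quadratic form of `G` at `pairVec i j`. -/
def pairForm (G : Matrix ι ι ℝ) (i j : ι) : ℝ :=
  if i = j then G i i else G i i + G j j - G i j - G j i

theorem form_single (G : Matrix ι ι ℝ) (i j : ι) :
    form G (Pi.single i 1) (Pi.single j 1) = G i j := by
  simp [form]

theorem form_pairVec (G : Matrix ι ι ℝ) (i j : ι) :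
    form G (pairVec i j) (pairVec i j) = pairForm G i j := by
  unfold pairVec pairForm
  split_ifs with h
  · exact form_single G i i
  · simp only [form_sub_left, form_sub_right, form_single]; ring

/-- Pairing G with the decomposition of X into the matrices of e_i, weighted by row sums, and of e_i
- e_j, weighted by -X_ij. The half appears because the sum runs over ordered pairs. -/
theorem trace_mul_eq_sum_pairForm {X : Matrix ι ι ℝ} (hX : X.IsSymm) (G : Matrix ι ι ℝ) :
    (X * G).trace =
      ∑ i, ∑ j, (if i = j then ∑ k, X i k else -X i j / 2) * pairForm G i j := by
  have h1 : ∀ i j, (if i = j then ∑ k, X i k else -X i j / 2) * pairForm G i j =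
      (if i = j then (∑ k, X i k) * G i i else 0) +
        -X i j / 2 * (G i i + G j j - G i j - G j i) := fun i j => by
    unfold pairForm
    split_ifs with h
    · subst h; ring
    · ring
  simp_rw [h1, Finset.sum_add_distrib, Finset.sum_ite_eq, Finset.mem_univ, if_true]
  have h2 : ∑ i, ∑ j, X i j * G j j = ∑ i, (∑ k, X i k) * G i i := by
    rw [Finset.sum_comm]
    refine Finset.sum_congr rfl fun i _ => ?_
    rw [Finset.sum_mul]
    exact Finset.sum_congr rfl fun k _ => by rw [hX.apply]
  have h3 : ∑ i, ∑ j, X i j * G i i = ∑ i, (∑ k, X i k) * G i i :=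
    Finset.sum_congr rfl fun i _ => by rw [Finset.sum_mul]
  have h4 : ∑ i, ∑ j, X i j * G j i = (X * G).trace := by
    simp [trace, Matrix.mul_apply]
  have h5 : ∑ i, ∑ j, X i j * G i j = (X * G).trace := by
    rw [← h4, Finset.sum_comm]
    exact Finset.sum_congr rfl fun i _ => Finset.sum_congr rfl fun j _ => by rw [hX.apply]
  have h6 : ∑ i, ∑ j, -X i j / 2 * (G i i + G j j - G i j - G j i) =
      -(1 / 2) * (∑ i, ∑ j, X i j * G i i) - (1 / 2) * (∑ i, ∑ j, X i j * G j j)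
        + (1 / 2) * (∑ i, ∑ j, X i j * G i j) + (1 / 2) * (∑ i, ∑ j, X i j * G j i) := by
    simp only [Finset.mul_sum, ← Finset.sum_add_distrib, ← Finset.sum_sub_distrib]
    exact Finset.sum_congr rfl fun i _ => Finset.sum_congr rfl fun j _ => by ring
  rw [h6, h2, h3, h4, h5]
  ring

/-- Averaging with the nonnegative weights of X. If no pair qualified, H would be at most G at every
pair, so each weighted difference would vanish. At a pair of positive weight both values would then
be zero, which contradicts the positive trace of XG. -/
theorem exists_pair_le {X G H : Matrix ι ι ℝ} (hX : DiagDom X) (hG : G.PosSemidef)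
    (hpos : 0 < (X * G).trace) (hle : (X * G).trace ≤ (X * H).trace) :
    ∃ i j, 0 < pairForm H i j ∧ pairForm G i j ≤ pairForm H i j := by
  by_contra hcon
  push Not at hcon
  set w : ι → ι → ℝ := fun i j => if i = j then ∑ k, X i k else -X i j / 2 with hw
  have hw0 : ∀ i j, 0 ≤ w i j := fun i j => by
    simp only [hw]
    split_ifs with h
    · exact hX.rowSum i
    · have := hX.offDiag i j h; linarith
  have hG0 : ∀ i j, 0 ≤ pairForm G i j := fun i j => by
    rw [← form_pairVec]; exact hG.form_nonneg _
  have h1 : ∀ i j, pairForm H i j ≤ pairForm G i j := fun i j => by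
    by_cases h : 0 < pairForm H i j
    · exact (hcon i j h).le
    · exact (not_lt.mp h).trans (hG0 i j)
  have h2 : ∑ i, ∑ j, w i j * (pairForm G i j - pairForm H i j) ≤ 0 := by
    simp only [mul_sub, Finset.sum_sub_distrib]
    rw [trace_mul_eq_sum_pairForm hX.symm, trace_mul_eq_sum_pairForm hX.symm] at hle
    linarith
  have h3 : ∀ i j, 0 ≤ w i j * (pairForm G i j - pairForm H i j) := fun i j =>
    mul_nonneg (hw0 i j) (sub_nonneg.mpr (h1 i j))
  have h4 : ∀ i j, w i j * (pairForm G i j - pairForm H i j) = 0 := fun i j => by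
    have e := le_antisymm h2 (Finset.sum_nonneg fun i _ => Finset.sum_nonneg fun j _ => h3 i j)
    have e2 := (Finset.sum_eq_zero_iff_of_nonneg fun i _ =>
      Finset.sum_nonneg fun j _ => h3 i j).mp e i (Finset.mem_univ i)
    exact (Finset.sum_eq_zero_iff_of_nonneg fun j _ => h3 i j).mp e2 j (Finset.mem_univ j)
  have h5 : (X * G).trace = 0 := by
    rw [trace_mul_eq_sum_pairForm hX.symm]
    refine Finset.sum_eq_zero fun i _ => Finset.sum_eq_zero fun j _ => ?_
    rcases mul_eq_zero.mp (h4 i j) with h | h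
    · exact mul_eq_zero_of_left h _
    · have : ¬ 0 < pairForm H i j := fun hp => by have := hcon i j hp; linarith
      have h0 := hG0 i j
      have : pairForm G i j = 0 := by linarith
      rw [this, mul_zero]
  linarith

/-- The number of nonzero off-diagonal entries. -/
noncomputable def offNnz (Y : Matrix ι ι ℝ) : ℕ :=
  (Finset.univ.filter fun p : ι × ι => p.1 ≠ p.2 ∧ Y p.1 p.2 ≠ 0).card

/-- The entries of `pairVec i j * pairVec i jᵀ`. -/
theorem vecMulVec_pairVec (i j k l : ι) : vecMulVec (pairVec i j) (pairVec i j) k l =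
    if i = j then (if k = i ∧ l = i then 1 else 0) else
      (if k = l ∧ (k = i ∨ k = j) then 1 else 0) -
        (if (k = i ∧ l = j) ∨ (k = j ∧ l = i) then 1 else 0) := by
  rw [vecMulVec_apply, pairVec]
  by_cases h : i = j
  · subst h
    simp only [if_true, Pi.single_apply]
    by_cases h1 : k = i <;> by_cases h2 : l = i <;> simp [h1, h2]
  · simp only [if_neg h, Pi.sub_apply, Pi.single_apply]
    by_cases h1 : k = i
    · subst h1
      by_cases h3 : l = k
      · subst h3; simp [h]
      · by_cases h4 : l = j
        · subst h4; simp [h]; exact h3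
        · simp [h, h3, h4, Ne.symm h3]
    · by_cases h2 : k = j
      · subst h2
        by_cases h3 : l = i
        · subst h3; simp [h1]; exact h
        · by_cases h4 : l = k
          · subst h4; simp [h1]
          · simp [h1, h3, h4, Ne.symm h4]
      · simp [h1, h2]

theorem sum_pairVec_mul (i j k : ι) : 0 ≤ ∑ l, vecMulVec (pairVec i j) (pairVec i j) k l := by
  simp_rw [vecMulVec_apply, ← Finset.mul_sum]
  unfold pairVec
  split_ifs with h
  · simp only [Pi.single_apply]
    split_ifs <;> norm_num
  · simp

theorem DiagDom.add_pair {Y : Matrix ι ι ℝ} (hY : DiagDom Y) (i j : ι) {s : ℝ} (hs : 0 ≤ s) :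
    DiagDom (Y + s • vecMulVec (pairVec i j) (pairVec i j)) where
  symm := hY.symm.add (IsSymm.smul (isSymm_vecMulVec _) s)
  offDiag k l hkl := by
    have h1 := hY.offDiag k l hkl
    have h2 : vecMulVec (pairVec i j) (pairVec i j) k l ≤ 0 := by
      rw [vecMulVec_pairVec]
      by_cases h : i = j
      · rw [if_pos h, if_neg]; rintro ⟨rfl, rfl⟩; exact hkl rfl
      · rw [if_neg h, if_neg (fun h' => hkl h'.1)]
        split_ifs <;> norm_num
    have := mul_nonpos_of_nonneg_of_nonpos hs h2
    simp only [Matrix.add_apply, Matrix.smul_apply, smul_eq_mul]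
    linarith
  rowSum k := by
    have h1 := hY.rowSum k
    have h2 := mul_nonneg hs (sum_pairVec_mul i j k)
    simp only [Matrix.add_apply, Matrix.smul_apply, smul_eq_mul, Finset.sum_add_distrib,
      ← Finset.mul_sum]
    linarith

theorem offNnz_add_pair (Y : Matrix ι ι ℝ) (i j : ι) (s : ℝ) :
    offNnz (Y + s • vecMulVec (pairVec i j) (pairVec i j)) ≤ offNnz Y + 2 := by
  unfold offNnz
  refine (Finset.card_le_card (t := (Finset.univ.filter fun p : ι × ι =>
    p.1 ≠ p.2 ∧ Y p.1 p.2 ≠ 0) ∪ {(i, j), (j, i)}) ?_).trans ?_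
  · rintro ⟨k, l⟩ hp
    obtain ⟨-, hkl, hne⟩ := Finset.mem_filter.mp hp
    simp only [Matrix.add_apply, Matrix.smul_apply, smul_eq_mul] at hkl hne
    simp only [Finset.mem_union, Finset.mem_filter, Finset.mem_univ, true_and, Finset.mem_insert,
      Finset.mem_singleton, Prod.mk.injEq]
    by_contra hcon
    push Not at hcon
    obtain ⟨h1, h2, h3⟩ := hcon
    have hY := h1 hkl
    rw [hY, vecMulVec_pairVec] at hne
    by_cases h : i = j
    · rw [if_pos h, if_neg] at hne
      · simp at hne
      · rintro ⟨rfl, rfl⟩; exact hkl rfl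
    · rw [if_neg h, if_neg (fun h' => hkl h'.1), if_neg] at hne
      · simp at hne
      · rintro (⟨a, b⟩ | ⟨a, b⟩)
        · exact h2 a b
        · exact h3 a b
  · refine (Finset.card_union_le _ _).trans (Nat.add_le_add_left ?_ _)
    exact Finset.card_le_two

/-- In a step of the barrier method there is a vector that respects both potentials. -/
theorem Barrier.exists_pair [Nonempty ι] {X Y : Matrix ι ι ℝ} {l u φ δ : ℝ}
    (h : Barrier X Y l u φ) (hX : X.PosDef) (hdd : DiagDom X) (hδ : 0 < δ) (hφ1 : φ < 1)
    (hbal : 1 / δ + φ ≤ 1 - φ) :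
    ∃ i j, 0 < pairForm (lowerGain X Y l) i j ∧
      pairForm (upperGain X Y (u + δ) δ) i j ≤ pairForm (lowerGain X Y l) i j := by
  have hG := upperGain_posDef hX (posDef_upper_shift hX h.upper hδ) hδ
  exact exists_pair_le hdd hG.posSemidef (trace_mul_pos hX hG) (h.trace_le hX hδ hφ1 hbal)

/-- The state of the barrier method after `k` steps: barriers, sparsity and dominance. -/
structure BarrierState (X Y : Matrix ι ι ℝ) (l u φ : ℝ) (k : ℕ) : Prop where
  barrier : Barrier X Y l u φ
  dom : DiagDom Y
  sparse : offNnz Y ≤ 2 * k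

theorem BarrierState.step [Nonempty ι] {X Y : Matrix ι ι ℝ} {l u φ δ : ℝ} {k : ℕ}
    (h : BarrierState X Y l u φ k) (hX : X.PosDef) (hδ : 0 < δ) (hφ1 : φ < 1) {i j : ι}
    (hp : 0 < pairForm (lowerGain X Y l) i j)
    (hp' : pairForm (upperGain X Y (u + δ) δ) i j ≤ pairForm (lowerGain X Y l) i j) :
    BarrierState X (Y + (pairForm (lowerGain X Y l) i j)⁻¹ •
      vecMulVec (pairVec i j) (pairVec i j)) (l + 1) (u + δ) φ (k + 1) where
  barrier := by
    rw [← form_pairVec] at hp hp' ⊢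
    rw [← form_pairVec] at hp'
    exact h.barrier.step hX hδ hφ1 hp hp'
  dom := h.dom.add_pair i j (inv_nonneg.mpr hp.le)
  sparse := (offNnz_add_pair _ i j _).trans (by have := h.sparse; omega)

/-- At Y = 0 the barriers ∓nq put the matrix nqX on both sides, and tr(X(nqX)⁻¹) = 1/q. -/
theorem BarrierState.init [Nonempty ι] {X : Matrix ι ι ℝ} (hX : X.PosDef) {q : ℝ} (hq : 0 < q) :
    BarrierState X 0 (-(Fintype.card ι * q)) (Fintype.card ι * q) (1 / q) 0 := by
  have hn : (0 : ℝ) < Fintype.card ι := by exact_mod_cast Fintype.card_pos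
  have hnq : 0 < Fintype.card ι * q := mul_pos hn hq
  have e : (0 : Matrix ι ι ℝ) - (-(Fintype.card ι * q)) • X = (Fintype.card ι * q) • X := by simp
  have hp : (X * ((Fintype.card ι * q) • X)⁻¹).trace = 1 / q := by
    have h1 : ((Fintype.card ι * q) • X)⁻¹ = (Fintype.card ι * q)⁻¹ • X⁻¹ := by
      apply inv_eq_right_inv
      rw [smul_mul_assoc, mul_smul_comm, smul_smul, mul_inv_cancel₀ hnq.ne', one_smul,
        mul_inv_posDef hX]
    rw [h1, mul_smul_comm, mul_inv_posDef hX, trace_smul, trace_one, smul_eq_mul]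
    field_simp
  refine ⟨⟨?_, ?_, ?_, ?_⟩, ⟨?_, ?_, ?_⟩, ?_⟩
  · rw [e]; exact hX.smul hnq
  · rw [sub_zero]; exact hX.smul hnq
  · rw [e, hp]
  · rw [sub_zero, hp]
  · simp
  · simp
  · simp
  · simp [offNnz]

/-- `N` is a sparse diagonally dominant approximation of `X` from below. -/
structure IsSparsifier (X N : Matrix ι ι ℝ) (d k : ℕ) : Prop where
  le : ∀ x, form N x x ≤ form X x x
  ge : ∀ x, d * form X x x ≤ (d + 1) * form N x x
  posDef : N.PosDef
  dom : DiagDom N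
  sparse : offNnz N ≤ k

theorem DiagDom.smul {X : Matrix ι ι ℝ} (h : DiagDom X) {c : ℝ} (hc : 0 ≤ c) : DiagDom (c • X) where
  symm := IsSymm.smul h.symm c
  offDiag i j hij := mul_nonpos_of_nonneg_of_nonpos hc (h.offDiag i j hij)
  rowSum i := by
    simp only [Matrix.smul_apply, smul_eq_mul, ← Finset.mul_sum]
    exact mul_nonneg hc (h.rowSum i)

/-- Division by u moves the upper barrier to X; the ratio of the barriers becomes the factor (d +
1)/d. -/
theorem BarrierState.isSparsifier {X Y : Matrix ι ι ℝ} {l u φ : ℝ} {k d : ℕ}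
    (h : BarrierState X Y l u φ k) (hX : X.PosDef) (hl : 0 < l) (hu : 0 < u)
    (hd : (d + 1) * l = d * u) :
    IsSparsifier X (u⁻¹ • Y) d (2 * k) := by
  have hup : ∀ x, form Y x x ≤ u * form X x x := fun x => by
    have := h.barrier.upper.posSemidef.form_nonneg x
    rw [form_sub, form_smul] at this; linarith
  have hlo : ∀ x, l * form X x x ≤ form Y x x := fun x => by
    have := h.barrier.lower.posSemidef.form_nonneg x
    rw [form_sub, form_smul] at this; linarith
  refine ⟨fun x => ?_, fun x => ?_, ?_, h.dom.smul (inv_nonneg.mpr hu.le), ?_⟩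
  · rw [form_smul, inv_mul_le_iff₀ hu]; exact hup x
  · rw [form_smul, mul_left_comm, le_inv_mul_iff₀ hu]
    calc u * (d * form X x x) = (d + 1) * (l * form X x x) := by
          rw [← mul_assoc, ← mul_assoc, hd]; ring
      _ ≤ _ := mul_le_mul_of_nonneg_left (hlo x) (by positivity)
  · have e : Y = (Y - l • X) + l • X := by abel
    have : Y.PosDef := by rw [e]; exact h.barrier.lower.add (hX.smul hl)
    exact this.smul (inv_pos.mpr hu)
  · refine le_trans (Finset.card_le_card fun p hp => ?_) h.sparse
    simp only [Finset.mem_filter, Matrix.smul_apply, smul_eq_mul] at hp ⊢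
    exact ⟨hp.1, hp.2.1, fun h0 => hp.2.2 (by rw [h0, mul_zero])⟩

end RealMatrix

/-! ### Squaring and sparsification of levels -/

namespace RealMatrix

open Matrix

variable {ι : Type*} [Fintype ι] [DecidableEq ι]

/-- The matrices `a` for which `1 - a` can be squared and sparsified. -/
structure IsLevel (a : Matrix ι ι ℝ) : Prop where
  nonneg : ∀ i j, 0 ≤ a i j
  rowSum : ∀ i, ∑ j, a i j ≤ 1
  posSemidef : a.PosSemidef
  posDef : (1 - a).PosDef

theorem form_sq {a : Matrix ι ι ℝ} (ha : a.IsSymm) (x : ι → ℝ) :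
    form (a * a) x x = (a *ᵥ x) ⬝ᵥ (a *ᵥ x) := by
  rw [form_mul, form_comm ha]; rfl

/-- From a ≼ μ to a² ≼ μa without diagonalisation: for y = ax, Cauchy–Schwarz for a at y and x gives
|y|⁴ ≤ μ|y|² · `form a x x`. -/
theorem form_sq_le {a : Matrix ι ι ℝ} (ha : a.PosSemidef) {μ : ℝ}
    (h : ∀ x, form a x x ≤ μ * (x ⬝ᵥ x)) (x : ι → ℝ) : form (a * a) x x ≤ μ * form a x x := by
  rw [form_sq ha.isSymm]
  set y := a *ᵥ x with hy
  have h1 := cauchy_schwarz ha y x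
  have h2 : form a y x = y ⬝ᵥ y := rfl
  rw [h2] at h1
  have h3 := h y
  have h4 := ha.form_nonneg x
  have h5 : 0 ≤ y ⬝ᵥ y := by simpa using dotProduct_star_self_nonneg y
  rcases h5.eq_or_lt with h0 | h0
  · have hy0 : y = 0 := by simpa using dotProduct_self_eq_zero.mp h0.symm
    have h6 : form a x x = 0 := by
      rw [form, ← hy, hy0, dotProduct_zero]
    rw [h6, ← h0]; simp
  · by_contra hlt
    push Not at hlt
    nlinarith [mul_le_mul_of_nonneg_right h3 h4, mul_lt_mul_of_pos_right hlt h0]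

/-! ### Squaring a level and returning to the same class. -/

section level

variable {a N : Matrix ι ι ℝ} {d k : ℕ}

theorem IsLevel.form_le (h : IsLevel a) (x : ι → ℝ) : form a x x ≤ 1 * (x ⬝ᵥ x) := by
  have := h.posDef.posSemidef.form_nonneg x
  rw [form_sub, form_one] at this; linarith

theorem IsLevel.posDef_sq (h : IsLevel a) : (1 - a * a).PosDef := by
  rw [posDef_iff]
  have hs : (a * a).IsSymm := by
    rw [IsSymm, transpose_mul, h.posSemidef.isSymm.eq]
  refine ⟨isSymm_one.sub hs, fun x hx => ?_⟩
  have h1 := form_sq_le h.posSemidef h.form_le x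
  have h2 := h.posDef.form_pos hx
  rw [form_sub, form_one] at h2 ⊢
  linarith

/-- The entries of a² are nonnegative, and since the row sums of a are at most 1, those of a² do not
exceed those of a. -/
theorem IsLevel.diagDom_sq (h : IsLevel a) : DiagDom (1 - a * a) where
  symm := h.posDef_sq.isSymm
  offDiag i j hij := by
    rw [Matrix.sub_apply, one_apply_ne hij, zero_sub, neg_nonpos, Matrix.mul_apply]
    exact Finset.sum_nonneg fun k _ => mul_nonneg (h.nonneg i k) (h.nonneg k j)
  rowSum i := by
    simp only [Matrix.sub_apply, Finset.sum_sub_distrib, Matrix.mul_apply]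
    rw [Finset.sum_comm]
    simp only [← Finset.mul_sum]
    have h1 : ∑ j, (1 : Matrix ι ι ℝ) i j = 1 := by simp [one_apply]
    have h2 : ∑ j, a i j * ∑ l, a j l ≤ ∑ j, a i j := Finset.sum_le_sum fun j _ =>
      mul_le_of_le_one_right (h.nonneg i j) (h.rowSum j)
    have := h.rowSum i
    linarith

/-- Approximation from below is essential: N ≼ 1 - a² yields 1 - N ≽ a² ≽ 0 and nonnegative diagonal
entries of 1 - N. The other entries and the row sums are handled by the dominance of N. -/
theorem IsLevel.next (h : IsLevel a) (hN : IsSparsifier (1 - a * a) N d k) : IsLevel (1 - N) where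
  nonneg i j := by
    by_cases hij : i = j
    · subst hij
      have h1 := hN.le (Pi.single i 1)
      rw [form_single, form_single, Matrix.sub_apply, one_apply_eq, Matrix.mul_apply] at h1
      have h2 : 0 ≤ ∑ j, a i j * a j i :=
        Finset.sum_nonneg fun k _ => mul_nonneg (h.nonneg i k) (h.nonneg k i)
      rw [Matrix.sub_apply, one_apply_eq]; linarith
    · rw [Matrix.sub_apply, one_apply_ne hij]
      have := hN.dom.offDiag i j hij; linarith
  rowSum i := by
    simp only [Matrix.sub_apply, Finset.sum_sub_distrib]
    have h1 : ∑ j, (1 : Matrix ι ι ℝ) i j = 1 := by simp [one_apply]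
    have := hN.dom.rowSum i; linarith
  posSemidef := by
    rw [posSemidef_iff]
    refine ⟨isSymm_one.sub hN.posDef.isSymm, fun x => ?_⟩
    have h1 := hN.le x
    rw [form_sub] at h1 ⊢
    have h2 : 0 ≤ form (a * a) x x := by
      rw [form_sq h.posSemidef.isSymm]; simpa using dotProduct_star_self_nonneg (a *ᵥ x)
    linarith
  posDef := by rw [sub_sub_cancel]; exact hN.posDef

/-- Squaring turns the bound μ into 1 - (1 - μ)² = 2μ - μ² ≥ (3/2)μ for μ ≤ 1/2, and sparsification
loses at most d/(d + 1) ≥ 3/4. The product of the factors is 9/8. -/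
theorem IsLevel.lowerBound_next (h : IsLevel a) (hN : IsSparsifier (1 - a * a) N d k)
    (hd : 3 ≤ d) {μ : ℝ} (hμ0 : 0 ≤ μ) (hμ1 : μ ≤ 1 / 2)
    (hμ : ∀ x, μ * (x ⬝ᵥ x) ≤ form (1 - a) x x) (x : ι → ℝ) :
    9 / 8 * μ * (x ⬝ᵥ x) ≤ form N x x := by
  have h1 : ∀ x, form a x x ≤ (1 - μ) * (x ⬝ᵥ x) := fun x => by
    have := hμ x; rw [form_sub, form_one] at this; linarith
  have h2 := form_sq_le h.posSemidef h1 x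
  have h3 := h1 x
  have h4 := hN.ge x
  have hxx : 0 ≤ x ⬝ᵥ x := by simpa using dotProduct_star_self_nonneg x
  rw [form_sub, form_one] at h4
  have h5 : form (a * a) x x ≤ (1 - μ) * ((1 - μ) * (x ⬝ᵥ x)) :=
    h2.trans (mul_le_mul_of_nonneg_left h3 (by linarith))
  have h6 : 3 / 2 * μ * (x ⬝ᵥ x) ≤ x ⬝ᵥ x - form (a * a) x x := by
    nlinarith [mul_nonneg (mul_nonneg hμ0 (by linarith : (0 : ℝ) ≤ 1 / 2 - μ)) hxx]
  have hd' : (3 : ℝ) ≤ d := by exact_mod_cast hd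
  have h7 : d * (3 / 2 * μ * (x ⬝ᵥ x)) ≤ (d + 1) * form N x x :=
    (mul_le_mul_of_nonneg_left h6 (by positivity)).trans h4
  have h8 : (d + 1) * (9 / 8 * μ * (x ⬝ᵥ x)) ≤ d * (3 / 2 * μ * (x ⬝ᵥ x)) := by
    nlinarith [mul_nonneg hμ0 hxx]
  exact le_of_mul_le_mul_left (h8.trans h7) (by positivity)

/-- Truncation at 1/2 lets the induction continue after the target has been reached. -/
theorem IsLevel.lowerBound_min (h : IsLevel a) (hN : IsSparsifier (1 - a * a) N d k)
    (hd : 3 ≤ d) {μ : ℝ} (hμ0 : 0 ≤ μ)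
    (hμ : ∀ x, min (1 / 2) μ * (x ⬝ᵥ x) ≤ form (1 - a) x x) (x : ι → ℝ) :
    min (1 / 2) (9 / 8 * μ) * (x ⬝ᵥ x) ≤ form N x x := by
  have h1 := h.lowerBound_next hN hd (le_min (by norm_num) hμ0) (min_le_left _ _) hμ x
  refine le_trans (mul_le_mul_of_nonneg_right ?_ (by simpa using dotProduct_star_self_nonneg x)) h1
  rcases le_total (1 / 2) μ with h | h
  · rw [min_eq_left h]; exact (min_le_left _ _).trans (by norm_num)
  · rw [min_eq_right h]; exact min_le_right _ _

end level

/-! ### The preconditioner of a chain -/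

/-- The preconditioner that the levels `i, …, i + r` of a chain define. -/
noncomputable def precond (a : ℕ → Matrix ι ι ℝ) : ℕ → ℕ → Matrix ι ι ℝ
  | 0, _ => 1
  | r + 1, i => (1 / 2 : ℝ) • (1 + (1 + a i) * precond a r (i + 1) * (1 + a i))

/-- Since (1 - a)(1 + a) = 1 - a², multiplication of the right side by 1 - a gives ½((1 - a) + (1 +
a)) = 1. This form of the inverse is symmetric, so it survives an approximation of (1 - a²)⁻¹ in the
semidefinite order. -/
theorem inv_one_sub_eq {a : Matrix ι ι ℝ} (h : IsLevel a) :
    (1 - a)⁻¹ = (1 / 2 : ℝ) • (1 + (1 + a) * (1 - a * a)⁻¹ * (1 + a)) := by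
  have hsq := h.posDef_sq
  have e : (1 - a) * (1 + a) = 1 - a * a := by noncomm_ring
  have e' : (1 + a) * (1 - a) = 1 - a * a := by noncomm_ring
  have h1 : (1 - a) * ((1 + a) * (1 - a * a)⁻¹) = 1 := by
    rw [← mul_assoc, e, mul_inv_posDef hsq]
  apply inv_eq_right_inv
  rw [mul_smul_comm, mul_add, mul_one, ← mul_assoc, h1, one_mul]
  have : (1 - a) + (1 + a) = (2 : ℝ) • (1 : Matrix ι ι ℝ) := by rw [two_smul]; abel
  rw [this, smul_smul]; norm_num

theorem form_conj {C : Matrix ι ι ℝ} (hC : C.IsSymm) (Z : Matrix ι ι ℝ) (x : ι → ℝ) :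
    form (C * Z * C) x x = form Z (C *ᵥ x) (C *ᵥ x) := by
  rw [form_mul, form, form, ← mulVec_mulVec, dotProduct_mulVec, ← mulVec_transpose, hC.eq]

theorem precond_isSymm {a : ℕ → Matrix ι ι ℝ} (ha : ∀ i, (a i).IsSymm) (r : ℕ) :
    ∀ i, (precond a r i).IsSymm := by
  induction r with
  | zero => intro i; exact isSymm_one
  | succ r ih =>
    intro i
    refine IsSymm.smul (isSymm_one.add ?_) _
    rw [IsSymm, transpose_mul, transpose_mul, (ih _).eq, (isSymm_one.add (ha i)).eq, mul_assoc]

/-- The chain condition on consecutive levels. -/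
structure IsNext (a b : Matrix ι ι ℝ) (d : ℕ) : Prop where
  le : ∀ x, form (1 - b) x x ≤ form (1 - a * a) x x
  ge : ∀ x, d * form (1 - a * a) x x ≤ (d + 1) * form (1 - b) x x

/-- Induction from the last level to the first; conjugation by 1 + a preserves the order. The lower
factor 1/2 does not deteriorate, because 1 - b ≼ 1 - a² reverses under inversion in the favourable
direction. The upper factor grows by 1 + 1/d per level. -/
theorem precond_bounds {a : ℕ → Matrix ι ι ℝ} {d D : ℕ} (hd : 0 < d) (ha : ∀ i ≤ D, IsLevel (a i))
    (hn : ∀ i < D, IsNext (a i) (a (i + 1)) d)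
    (hlast : ∀ x, 1 / 2 * (x ⬝ᵥ x) ≤ form (1 - a D) x x) (r : ℕ) : ∀ i, i + r = D → ∀ x,
    1 / 2 * form (1 - a i)⁻¹ x x ≤ form (precond a r i) x x ∧
    form (precond a r i) x x ≤ (1 + 1 / d : ℝ) ^ r * form (1 - a i)⁻¹ x x := by
  induction r with
  | zero =>
    intro i hi x
    obtain rfl : i = D := by omega
    have hL := ha i le_rfl
    simp only [precond, pow_zero, one_mul]
    have h1 := form_inv_le (A := (1 : Matrix ι ι ℝ)) PosDef.one hL.posDef (c := 2) (fun x => by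
      have := hlast x; rw [form_one]; linarith) x
    have h2 := form_inv_le hL.posDef (B := (1 : Matrix ι ι ℝ)) PosDef.one (c := 1) (fun x => by
      have := hL.posSemidef.form_nonneg x; rw [form_sub]; linarith) x
    rw [inv_one] at h1 h2
    constructor <;> linarith
  | succ r ih =>
    intro i hi x
    have hL := ha i (by omega)
    have hL' := ha (i + 1) (by omega)
    have hN := hn i (by omega)
    have hd' : (0 : ℝ) < d := by exact_mod_cast hd
    have hC : (1 + a i).IsSymm := isSymm_one.add hL.posSemidef.isSymm
    set y := (1 + a i) *ᵥ x with hy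
    obtain ⟨h1, h2⟩ := ih (i + 1) (by omega) y
    have h3 := form_inv_le hL'.posDef hL.posDef_sq (c := 1) (fun x => by
      have := hN.le x; linarith) y
    have h4 := form_inv_le hL.posDef_sq hL'.posDef (c := 1 + 1 / d) (fun x => by
      have := hN.ge x
      have e : (1 + 1 / d : ℝ) = (d + 1) / d := by field_simp
      rw [e, div_mul_eq_mul_div, le_div_iff₀ hd']; linarith) y
    have hxx : 0 ≤ x ⬝ᵥ x := by simpa using dotProduct_star_self_nonneg x
    rw [inv_one_sub_eq hL, precond, form_smul, form_smul, form_add, form_add, form_conj hC,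
      form_conj hC, form_one, ← hy]
    have hp : 1 ≤ (1 + 1 / d : ℝ) ^ r := one_le_pow₀ (by
      have : (0 : ℝ) < 1 / d := by positivity
      linarith)
    have hp1 : 1 ≤ (1 + 1 / d : ℝ) ^ (r + 1) := one_le_pow₀ (by
      have : (0 : ℝ) < 1 / d := by positivity
      linarith)
    constructor
    · linarith
    · have h5 := mul_le_mul_of_nonneg_left h4 (by linarith : (0 : ℝ) ≤ (1 + 1 / d : ℝ) ^ r)
      rw [← mul_assoc, ← pow_succ] at h5
      nlinarith [mul_le_mul_of_nonneg_right hp1 hxx]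

theorem one_add_inv_pow_le (d : ℕ) (hd : 0 < d) : (1 + 1 / d : ℝ) ^ d ≤ 3 := by
  have hd' : (0 : ℝ) < d := by exact_mod_cast hd
  have h1 : (1 + 1 / d : ℝ) ≤ Real.exp (1 / d) := by
    have := Real.add_one_le_exp (1 / d : ℝ); linarith
  calc (1 + 1 / d : ℝ) ^ d ≤ Real.exp (1 / d) ^ d := pow_le_pow_left₀ (by positivity) h1 d
    _ = Real.exp 1 := by rw [← Real.exp_nat_mul]; congr 1; field_simp
    _ ≤ 3 := by have := Real.exp_one_lt_d9; linarith

theorem inv_mulVec_cancel {N : Matrix ι ι ℝ} (hN : N.PosDef) (u : ι → ℝ) :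
    N⁻¹ *ᵥ (N *ᵥ u) = u := by
  rw [mulVec_mulVec, inv_mul_posDef hN, one_mulVec]

/-- One step of the preconditioned Richardson iteration contracts the error. -/
theorem richardson_step {N Z : Matrix ι ι ℝ} (hN : N.PosDef) (hZ : Z.IsSymm)
    (hlo : ∀ x, 1 / 2 * form N⁻¹ x x ≤ form Z x x) (hhi : ∀ x, form Z x x ≤ 3 * form N⁻¹ x x)
    (e : ι → ℝ) :
    form N (e - (1 / 3 : ℝ) • Z *ᵥ (N *ᵥ e)) (e - (1 / 3 : ℝ) • Z *ᵥ (N *ᵥ e)) ≤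
      5 / 6 * form N e e := by
  have hZp : Z.PosSemidef := posSemidef_iff.mpr ⟨hZ, fun x => by
    have := hN.inv.posSemidef.form_nonneg x; linarith [hlo x]⟩
  set g := N *ᵥ e with hg
  set u := Z *ᵥ g with hu
  have hinv : form N⁻¹ g g = form N e e := by
    rw [form, hg, mulVec_mulVec, inv_mul_posDef hN, one_mulVec, form, dotProduct_comm]
  have h1 : form N e u = form Z g g := by
    rw [form_comm hN.isSymm, form, dotProduct_comm]; rfl
  have h1' : form N u e = form Z g g := by rw [form_comm hN.isSymm, h1]
  -- This is ZNZ ≼ 3Z. It follows from Z ≼ 3N⁻¹ at Nu and Cauchy–Schwarz for Z at Nu and g.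
  have h2 : form N u u ≤ 3 * form Z g g := by
    have c := cauchy_schwarz hZp (N *ᵥ u) g
    have e1 : form Z (N *ᵥ u) g = form N u u := by
      change (N *ᵥ u) ⬝ᵥ u = _
      rw [dotProduct_comm]; rfl
    have e2 : form N⁻¹ (N *ᵥ u) (N *ᵥ u) = form N u u := by
      rw [form, inv_mulVec_cancel hN, dotProduct_comm]; rfl
    have e3 := hhi (N *ᵥ u)
    rw [e2] at e3
    rw [e1] at c
    have p0 := hZp.form_nonneg g
    have p1 := hN.posSemidef.form_nonneg u
    rcases p1.eq_or_lt with h0 | h0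
    · rw [← h0]; positivity
    · by_contra hlt
      push Not at hlt
      nlinarith [mul_le_mul_of_nonneg_right e3 p0, mul_lt_mul_of_pos_right hlt h0]
  have h3 := hlo g
  rw [hinv] at h3
  -- With E the squared error and z = `form Z g g`, the new value is E - (2/3)z + (1/9) `form N u u`
  -- ≤ E - z/3, and z ≥ E/2.
  simp only [form_sub_left, form_sub_right, form_smul_left, form_smul_right, h1, h1']
  linarith

/-! ### Bounds on the spectrum -/

/-- Square roots are taken one squaring at a time: for P = Q^(2^j), Cauchy–Schwarz bounds the square
of x·Px by |x|²|Px|². -/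
theorem form_le_of_pow {Q : Matrix ι ι ℝ} (hQ : Q.PosSemidef) {t : ℝ} (ht : 0 ≤ t) (j : ℕ) :
    (∀ x, form (Q ^ 2 ^ j) x x ≤ t ^ 2 ^ j * (x ⬝ᵥ x)) → ∀ x, form Q x x ≤ t * (x ⬝ᵥ x) := by
  induction j with
  | zero => intro h; simpa using h
  | succ j ih =>
    intro h
    refine ih fun x => ?_
    have hP : (Q ^ 2 ^ j).PosSemidef := hQ.pow _
    have h1 := h x
    rw [pow_succ, pow_mul, pow_mul, pow_two (Q ^ 2 ^ j), form_sq hP.isSymm] at h1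
    set y := Q ^ 2 ^ j *ᵥ x with hy
    set s := t ^ 2 ^ j
    have hs : 0 ≤ s := pow_nonneg ht _
    have hxx : 0 ≤ x ⬝ᵥ x := by simpa using dotProduct_star_self_nonneg x
    have h2 : (x ⬝ᵥ y) ^ 2 ≤ (x ⬝ᵥ x) * (y ⬝ᵥ y) := by
      have := cauchy_schwarz (PosSemidef.one : (1 : Matrix ι ι ℝ).PosSemidef) x y
      simpa only [form_one] using this
    have h3 : (x ⬝ᵥ y) ^ 2 ≤ (s * (x ⬝ᵥ x)) ^ 2 := by nlinarith
    exact (le_abs_self _).trans (abs_le_of_sq_le_sq h3 (by positivity))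

/-- A positive semidefinite matrix is at most its trace. This is the soundness of the certificate
for the smallest eigenvalue; `trace_pow_le` is its completeness up to a factor n. -/
theorem form_le_of_trace_pow {Q : Matrix ι ι ℝ} (hQ : Q.PosSemidef) {t : ℝ} (ht : 0 ≤ t) (j : ℕ)
    (h : (Q ^ 2 ^ j).trace ≤ t ^ 2 ^ j) (x : ι → ℝ) : form Q x x ≤ t * (x ⬝ᵥ x) := by
  refine form_le_of_pow hQ ht j (fun x => ?_) x
  have h1 := form_le_trace PosDef.one (hQ.pow (2 ^ j)) x
  rw [inv_one, mul_one, form_one] at h1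
  exact h1.trans (mul_le_mul_of_nonneg_right h (by simpa using dotProduct_star_self_nonneg x))

theorem form_pow_le {Q : Matrix ι ι ℝ} (hQ : Q.PosSemidef) {t : ℝ} (ht : 0 ≤ t)
    (h : ∀ x, form Q x x ≤ t * (x ⬝ᵥ x)) (j : ℕ) :
    ∀ x, form (Q ^ 2 ^ j) x x ≤ t ^ 2 ^ j * (x ⬝ᵥ x) := by
  induction j with
  | zero => simpa using h
  | succ j ih =>
    intro x
    rw [pow_succ, pow_mul, pow_mul, pow_two (Q ^ 2 ^ j), pow_two (t ^ 2 ^ j), mul_assoc]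
    exact (form_sq_le (hQ.pow _) ih x).trans
      (mul_le_mul_of_nonneg_left (ih x) (pow_nonneg ht _))

theorem trace_pow_le {Q : Matrix ι ι ℝ} (hQ : Q.PosSemidef) {t : ℝ} (ht : 0 ≤ t)
    (h : ∀ x, form Q x x ≤ t * (x ⬝ᵥ x)) (j : ℕ) :
    (Q ^ 2 ^ j).trace ≤ Fintype.card ι * t ^ 2 ^ j := by
  rw [trace]
  calc ∑ i, (Q ^ 2 ^ j).diag i ≤ ∑ _i : ι, t ^ 2 ^ j := Finset.sum_le_sum fun i _ => by
        have := form_pow_le hQ ht h j (Pi.single i 1)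
        rw [form_single] at this
        simpa using this
    _ = _ := by simp

end RealMatrix

/-! ### Inversion by pivoting -/

namespace RealMatrix

open Matrix

/-- The exchange of the `k`-th argument and the `k`-th value of a linear map. -/
noncomputable def sweep {ι : Type*} [DecidableEq ι] (k : ι) (B : Matrix ι ι ℝ) : Matrix ι ι ℝ :=
  fun i j => if i = k then (if j = k then 1 / B k k else 0 - B k j / B k k)
    else (if j = k then B i k / B k k else B i j - B i k * B k j / B k k)

variable {n : ℕ}

theorem mulVec_apply_erase {ι : Type*} [Fintype ι] [DecidableEq ι] (B : Matrix ι ι ℝ) (z : ι → ℝ)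
    (k i : ι) : (B *ᵥ z) i = B i k * z k + ∑ j ∈ Finset.univ.erase k, B i j * z j := by
  rw [mulVec, dotProduct, Finset.add_sum_erase _ (fun j => B i j * z j) (Finset.mem_univ k)]

/-- The k-th equation is solved for z k and substituted into the others; a nonzero pivot makes this
reversible. -/
theorem sweep_mulVec {ι : Type*} [Fintype ι] [DecidableEq ι] {B : Matrix ι ι ℝ} {k : ι}
    (hk : B k k ≠ 0) (z o : ι → ℝ) :
    o = B *ᵥ z ↔ Function.update o k (z k) = sweep k B *ᵥ Function.update z k (o k) := by
  have hs : ∀ i, ∑ j ∈ Finset.univ.erase k, sweep k B i j * Function.update z k (o k) j =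
      if i = k then -(∑ j ∈ Finset.univ.erase k, B k j * z j) / B k k else
      ∑ j ∈ Finset.univ.erase k, B i j * z j -
        B i k * (∑ j ∈ Finset.univ.erase k, B k j * z j) / B k k := fun i => by
    have h1 : ∀ j ∈ Finset.univ.erase k, sweep k B i j * Function.update z k (o k) j =
        if i = k then -(B k j * z j) / B k k else
          B i j * z j - B i k * (B k j * z j) / B k k := fun j hj => by
      have hj := Finset.ne_of_mem_erase hj
      rw [Function.update_of_ne hj, sweep, if_neg hj, if_neg hj]
      split_ifs <;> ring
    rw [Finset.sum_congr rfl h1]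
    split_ifs
    · rw [← Finset.sum_div, Finset.sum_neg_distrib]
    · rw [Finset.sum_sub_distrib, Finset.mul_sum, Finset.sum_div]
  have hkk : sweep k B k k = 1 / B k k := by simp [sweep]
  have hik : ∀ i, i ≠ k → sweep k B i k = B i k / B k k := fun i hi => by simp [sweep, hi]
  constructor
  · intro h
    have h0 := congrFun h k
    rw [mulVec_apply_erase B z k] at h0
    funext i
    rw [mulVec_apply_erase _ _ k, hs, Function.update_self]
    by_cases hi : i = k
    · subst hi
      rw [if_pos rfl, Function.update_self, hkk]
      rw [h0]; field_simp; ring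
    · rw [if_neg hi, Function.update_of_ne hi, hik i hi]
      have h1 := congrFun h i
      rw [mulVec_apply_erase B z k] at h1
      rw [h1, h0]; field_simp; ring
  · intro h
    have h0 := congrFun h k
    rw [mulVec_apply_erase _ _ k, hs, Function.update_self, Function.update_self, if_pos rfl,
      hkk] at h0
    have h0' : o k = B k k * z k + ∑ j ∈ Finset.univ.erase k, B k j * z j := by
      rw [h0]; field_simp; ring
    funext i
    rw [mulVec_apply_erase _ _ k]
    by_cases hi : i = k
    · subst hi; exact h0'
    · have h1 := congrFun h i
      rw [mulVec_apply_erase _ _ k, hs, Function.update_self, Function.update_of_ne hi, if_neg hi,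
        hik i hi] at h1
      rw [h1, h0']; field_simp; ring

/-- The first `k` arguments and values of `A` are exchanged. -/
noncomputable def sweeps (A : Matrix (Fin n) (Fin n) ℝ) : ℕ → Matrix (Fin n) (Fin n) ℝ
  | 0 => A
  | k + 1 => if h : k < n then sweep ⟨k, h⟩ (sweeps A k) else sweeps A k

theorem sweeps_spec {A : Matrix (Fin n) (Fin n) ℝ} (hA : A.PosDef) (k : ℕ) (hk : k ≤ n) :
    ∀ x y : Fin n → ℝ, y = A *ᵥ x ↔
      (fun i : Fin n => if (i : ℕ) < k then x i else y i) =
        sweeps A k *ᵥ (fun i : Fin n => if (i : ℕ) < k then y i else x i) := by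
  induction k with
  | zero => intro x y; simp [sweeps]
  | succ k ih =>
    have ih := ih (by omega)
    set K : Fin n := ⟨k, hk⟩ with hK
    -- The pivot is a value of the form of A. Feed e_K to the exchanged map and undo the exchange:
    -- the resulting y = Ax satisfies x·y = o·e_K, and this is the pivot. Moreover x ≠ 0, since its
    -- K-th coordinate is 1.
    have hp : sweeps A k K K ≠ 0 := by
      set z : Fin n → ℝ := Pi.single K 1 with hz
      set o := sweeps A k *ᵥ z with ho
      set x : Fin n → ℝ := fun i => if (i : ℕ) < k then o i else z i with hx
      set y : Fin n → ℝ := fun i => if (i : ℕ) < k then z i else o i with hy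
      have h1 : y = A *ᵥ x := by
        rw [ih x y]
        have e1 : (fun i : Fin n => if (i : ℕ) < k then x i else y i) = o := by
          funext i; simp only [hx, hy]; split_ifs <;> rfl
        have e2 : (fun i : Fin n => if (i : ℕ) < k then y i else x i) = z := by
          funext i; simp only [hx, hy]; split_ifs <;> rfl
        rw [e1, e2]
      have h2 : x ≠ 0 := fun h => by
        have := congrFun h K
        simp [hx, hz, hK] at this
      have h3 : form A x x = o K := by
        rw [form, ← h1]
        have : x ⬝ᵥ y = o ⬝ᵥ z := by
          refine Finset.sum_congr rfl fun i _ => ?_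
          simp only [hx, hy]; split_ifs
          · rfl
          · exact mul_comm _ _
        rw [this, hz]; simp
      have h4 : o K = sweeps A k K K := by rw [ho, hz]; simp
      rw [← h4, ← h3]
      exact (hA.form_pos h2).ne'
    intro x y
    rw [ih x y, sweep_mulVec hp, sweeps, dif_pos (show k < n from hk)]
    have e1 : Function.update (fun i : Fin n => if (i : ℕ) < k then x i else y i) K
        (if (K : ℕ) < k then y K else x K) = fun i : Fin n => if (i : ℕ) < k + 1 then x i else y i := by
      funext i
      by_cases hi : i = K
      · subst hi; simp [hK]
      · rw [Function.update_of_ne hi]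
        have : (i : ℕ) ≠ k := fun h => hi (Fin.ext h)
        by_cases h : (i : ℕ) < k
        · rw [if_pos h, if_pos (by omega)]
        · rw [if_neg h, if_neg (by omega)]
    have e2 : Function.update (fun i : Fin n => if (i : ℕ) < k then y i else x i) K
        (if (K : ℕ) < k then x K else y K) = fun i : Fin n => if (i : ℕ) < k + 1 then y i else x i := by
      funext i
      by_cases hi : i = K
      · subst hi; simp [hK]
      · rw [Function.update_of_ne hi]
        have : (i : ℕ) ≠ k := fun h => hi (Fin.ext h)
        by_cases h : (i : ℕ) < k
        · rw [if_pos h, if_pos (by omega)]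
        · rw [if_neg h, if_neg (by omega)]
    rw [e1, e2]

/-- After all n exchanges the relation y = Ax reads x = `sweeps A n` y. -/
theorem sweeps_eq_inv {A : Matrix (Fin n) (Fin n) ℝ} (hA : A.PosDef) : sweeps A n = A⁻¹ := by
  symm
  apply inv_eq_right_inv
  refine Matrix.ext_of_mulVec_single fun j => ?_
  rw [one_mulVec, ← mulVec_mulVec]
  have h := (sweeps_spec hA n le_rfl (sweeps A n *ᵥ Pi.single j 1) (Pi.single j 1)).mpr (by
    simp; rfl)
  exact h.symm

/-! ### Condition numbers -/

theorem posSemidef_of_spectrum {A : Matrix (Fin n) (Fin n) ℝ} (hA : A.IsSymm)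
    (h : ∀ μ ∈ spectrum ℝ A, 0 ≤ μ) : A.PosSemidef := by
  have hH := isHermitian_iff.mpr hA
  refine hH.posSemidef_iff_eigenvalues_nonneg.mpr fun i => h _ ?_
  rw [hH.spectrum_real_eq_range_eigenvalues]
  exact ⟨i, rfl⟩

/-- The spectrum is finite and nonempty, so its infimum is an eigenvalue and positive. Shifting M by
a scalar shifts its spectrum, which turns both extremes into semidefinite bounds. -/
theorem exists_bounds_of_condNumber_le (hn : 0 < n) {M : Matrix (Fin n) (Fin n) ℝ} (hM : M.PosDef)
    {κ : ℝ} (hκ : condNumber M ≤ κ) :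
    ∃ l u : ℝ, 0 < l ∧ u ≤ κ * l ∧ (∀ x, l * (x ⬝ᵥ x) ≤ form M x x) ∧
      ∀ x, form M x x ≤ u * (x ⬝ᵥ x) := by
  have hfin : (spectrum ℝ M).Finite := by
    rw [hM.isHermitian.spectrum_real_eq_range_eigenvalues]; exact Set.finite_range _
  have hne : (spectrum ℝ M).Nonempty := by
    rw [hM.isHermitian.spectrum_real_eq_range_eigenvalues]
    have : Nonempty (Fin n) := ⟨⟨0, hn⟩⟩
    exact Set.range_nonempty _
  have hpos : ∀ μ ∈ spectrum ℝ M, 0 < μ := fun μ hμ => by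
    rw [hM.isHermitian.spectrum_real_eq_range_eigenvalues] at hμ
    obtain ⟨i, rfl⟩ := hμ
    exact hM.eigenvalues_pos i
  have hl : sInf (spectrum ℝ M) ∈ spectrum ℝ M := hne.csInf_mem hfin
  refine ⟨sInf (spectrum ℝ M), sSup (spectrum ℝ M), hpos _ hl, ?_, fun x => ?_, fun x => ?_⟩
  · rwa [condNumber, div_le_iff₀ (hpos _ hl)] at hκ
  · have h1 : (M - sInf (spectrum ℝ M) • (1 : Matrix (Fin n) (Fin n) ℝ)).PosSemidef := by
      refine posSemidef_of_spectrum (hM.isSymm.sub (IsSymm.smul isSymm_one _)) fun μ hμ => ?_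
      rw [← Algebra.algebraMap_eq_smul_one, ← spectrum.sub_singleton_eq, Set.sub_singleton] at hμ
      obtain ⟨ν, hν, rfl⟩ := hμ
      exact sub_nonneg.mpr (csInf_le hfin.bddBelow hν)
    have := h1.form_nonneg x
    rw [form_sub, form_smul, form_one] at this; linarith
  · have h1 : (sSup (spectrum ℝ M) • (1 : Matrix (Fin n) (Fin n) ℝ) - M).PosSemidef := by
      refine posSemidef_of_spectrum ((IsSymm.smul isSymm_one _).sub hM.isSymm) fun μ hμ => ?_
      rw [← Algebra.algebraMap_eq_smul_one, ← spectrum.singleton_sub_eq, Set.singleton_sub] at hμ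
      obtain ⟨ν, hν, rfl⟩ := hμ
      exact sub_nonneg.mpr (le_csSup hfin.bddAbove hν)
    have := h1.form_nonneg x
    rw [form_sub, form_smul, form_one] at this; linarith

end RealMatrix

/-! ### Programs for dense matrices -/

namespace WorkDepth

open RealMatrix

/-- Dense matrices: arrays of rows. -/
abbrev Ty.mat : Ty := .arr .vec

/-- A dense matrix as data. -/
def encMat {n : ℕ} (A : Matrix (Fin n) (Fin n) ℝ) : Ty.mat.Val :=
  List.ofFn fun i => List.ofFn fun j => A i j

variable {Γ : Ty} {n : ℕ}

set_option synthInstance.maxHeartbeats 200000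
set_option synthInstance.maxSize 2000

theorem getD_ofFn {α : Type} (f : Fin n → α) (i : Fin n) (d : α) : (List.ofFn f).getD i d = f i := by
  rw [List.getD_eq_getElem?_getD, List.getElem?_ofFn]
  simp

/-- An entry of a matrix. -/
def ent (A : Prog Γ .mat) (i j : Prog Γ .nat) : Prog Γ .real := get (get A i) j

instance PolyTime.ent {N : Γ.Val → ℕ} {A : Prog Γ .mat} {i j : Prog Γ .nat} [PolyTime N A]
    [PolyTime N i] [PolyTime N j] : PolyTime N (ent A i j) := by unfold WorkDepth.ent; infer_instance

/-- The entries of the data that represents a matrix. -/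
noncomputable def entry (L : Ty.mat.Val) (i j : ℕ) : ℝ := (List.getD L i []).getD j 0

@[simp] theorem den_ent (A : Prog Γ .mat) (i j : Prog Γ .nat) (x : Γ.Val) :
    den (ent A i j) x = entry (den A x) (den i x) (den j x) := rfl

@[simp] theorem entry_encMat (A : Matrix (Fin n) (Fin n) ℝ) (i j : Fin n) :
    entry (encMat A) i j = A i j := by
  rw [entry, encMat, getD_ofFn, getD_ofFn]

theorem tabList_eq_encMat {F : ℕ → ℕ → ℝ} {C : Matrix (Fin n) (Fin n) ℝ}
    (h : ∀ i j : Fin n, F i j = C i j) : tabList n (fun i => tabList n fun j => F i j) = encMat C := by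
  unfold tabList encMat
  simp_rw [h]

/-- The real number `1`. -/
def oneR : Prog Γ .real := toR (lit 1)
/-- The real number `0`. -/
def zeroR : Prog Γ .real := toR (lit 0)
@[simp] theorem den_oneR (x : Γ.Val) : den oneR x = (1 : ℝ) := by simp [oneR]
@[simp] theorem den_zeroR (x : Γ.Val) : den zeroR x = (0 : ℝ) := by simp [zeroR]
instance {N : Γ.Val → ℕ} : PolyTime N (oneR : Prog Γ _) := by unfold oneR; infer_instance
instance {N : Γ.Val → ℕ} : PolyTime N (zeroR : Prog Γ _) := by unfold zeroR; infer_instance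

/-- The input of a program other than its size. -/
def arg {a : Ty} : Prog (.prod a .nat) a := .prim .fst
@[simp] theorem den_arg {a : Ty} (x : (Ty.prod a .nat).Val) : den arg x = x.1 := rfl
instance {a : Ty} {N : (Ty.prod a .nat).Val → ℕ} : PolyTime N (arg : Prog (.prod a .nat) a) := by
  unfold arg; infer_instance

/-- Matrix multiplication. -/
def mulP : Prog (.prod (.prod .mat .mat) .nat) .mat :=
  tab v0 (tab v1 (sumP v2
    (ent (fstP (lift (lift (lift arg)))) v2 v0 * ent (sndP (lift (lift (lift arg)))) v0 v1)))

instance : PolyTime size mulP := by unfold mulP; infer_instance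

@[simp] theorem den_mulP (A B : Matrix (Fin n) (Fin n) ℝ) :
    den mulP (no_index ((encMat A, encMat B), n)) = encMat (A * B) := by
  simp only [mulP, den_tab, den_v0, den_lift, den_sumP, den_mulR, den_ent, den_fstP, den_sndP,
    den_arg]
  refine tabList_eq_encMat fun i j => ?_
  rw [Finset.sum_range, Matrix.mul_apply]
  simp

/-- The linear combination `c A + d B`. -/
def combP : Prog (.prod (.prod (.prod .real .mat) (.prod .real .mat)) .nat) .mat :=
  tab v0 (tab v1 (fstP (fstP (lift (lift arg))) * ent (sndP (fstP (lift (lift arg)))) v1 v0 +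
    fstP (sndP (lift (lift arg))) * ent (sndP (sndP (lift (lift arg)))) v1 v0))

instance : PolyTime size combP := by unfold combP; infer_instance

@[simp] theorem den_combP (A B : Matrix (Fin n) (Fin n) ℝ) (c d : ℝ) :
    den combP (no_index (((c, encMat A), (d, encMat B)), n)) = encMat (c • A + d • B) := by
  simp only [combP, den_tab, den_v0, den_lift, den_addR, den_mulR, den_ent, den_fstP, den_sndP,
    den_arg]
  refine tabList_eq_encMat fun i j => ?_
  simp

/-- The trace. -/
def traceP : Prog (.prod .mat .nat) .real := sumP v0 (ent (lift arg) v0 v0)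

instance : PolyTime size traceP := by unfold traceP; infer_instance

@[simp] theorem den_traceP (A : Matrix (Fin n) (Fin n) ℝ) :
    den traceP (no_index (encMat A, n)) = A.trace := by
  simp only [traceP, den_sumP, den_v0, den_lift, den_ent, den_arg]
  rw [Finset.sum_range]
  simp [Matrix.trace]

/-- The identity matrix. -/
def idP : Prog (.prod .nat .nat) .mat := tab v0 (tab v1 (iteEq v1 v0 oneR zeroR))

instance : PolyTime size idP := by unfold idP; infer_instance

@[simp] theorem den_idP (k : ℕ) : den idP (no_index (k, n)) = encMat (1 : Matrix (Fin n) (Fin n) ℝ) := by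
  simp only [idP, den_tab, den_v0, den_lift, den_iteEq]
  refine tabList_eq_encMat fun i j => ?_
  simp [Matrix.one_apply, Fin.ext_iff]

/-- Inversion of positive definite matrices. -/
def invP : Prog (.prod .mat .nat) .mat :=
  forP v0 arg (tab v2 (tab v3
    (iteEq v1 v3
      (iteEq v0 v3 (oneR / ent v2 v3 v3) (zeroR - ent v2 v3 v0 / ent v2 v3 v3))
      (iteEq v0 v3 (ent v2 v1 v3 / ent v2 v3 v3)
        (ent v2 v1 v0 - ent v2 v1 v3 * ent v2 v3 v0 / ent v2 v3 v3)))))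

instance : PolyTime size invP := by unfold invP; infer_instance

theorem den_invP {A : Matrix (Fin n) (Fin n) ℝ} (hA : A.PosDef) :
    den invP (no_index (encMat A, n)) = encMat A⁻¹ := by
  have h : ∀ k ≤ n, passes (fun i s => den (tab v2 (tab v3
    (iteEq v1 v3
      (iteEq v0 v3 (oneR / ent v2 v3 v3) (zeroR - ent v2 v3 v0 / ent v2 v3 v3))
      (iteEq v0 v3 (ent v2 v1 v3 / ent v2 v3 v3)
        (ent v2 v1 v0 - ent v2 v1 v3 * ent v2 v3 v0 / ent v2 v3 v3)))) :
        Prog (.prod (.prod (.prod .mat .nat) .nat) .mat) .mat) (((encMat A, n), i), s))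
        (encMat A) k = encMat (sweeps A k) := fun k => by
    induction k with
    | zero => intro _; rfl
    | succ k ih =>
      intro hk
      rw [passes, ih (by omega), sweeps, dif_pos (show k < n from hk)]
      simp only [den_tab, den_v0, den_lift, den_iteEq, den_divR, den_subR, den_mulR, den_ent,
        den_oneR, den_zeroR]
      refine tabList_eq_encMat fun i j => ?_
      have e1 := entry_encMat (sweeps A k) ⟨k, hk⟩ ⟨k, hk⟩
      have e2 := entry_encMat (sweeps A k) ⟨k, hk⟩ j
      have e3 := entry_encMat (sweeps A k) i ⟨k, hk⟩
      simp only at e1 e2 e3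
      rw [e1, e2, e3, entry_encMat, sweep]
      by_cases hi : (i : ℕ) = k <;> by_cases hj : (j : ℕ) = k <;>
        simp only [Fin.ext_iff, hi, hj, if_true, if_false]
  rw [← sweeps_eq_inv hA, ← h n le_rfl]
  simp only [invP, den_forP, den_v0, den_arg]

/-! ### Programs for the barrier method -/

/-- The product `R X R`. -/
def conjP : Prog (.prod (.prod .mat .mat) .nat) .mat :=
  call mulP (.pair (call mulP arg v0) (fstP arg)) v0

instance : PolyTime size conjP := by unfold conjP; infer_instance

@[simp] theorem den_conjP (R X : Matrix (Fin n) (Fin n) ℝ) :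
    den conjP (no_index ((encMat R, encMat X), n)) = encMat (R * X * R) := by
  simp [conjP]

/-- `upperGain`, from `((X, Y), (u, δ))`. -/
def upperGainP : Prog (.prod (.prod (.prod .mat .mat) (.prod .real .real)) .nat) .mat :=
  letP (call invP (call combP (.pair (.pair (fstP (sndP arg)) (fstP (fstP arg)))
      (.pair (zeroR - oneR) (sndP (fstP arg)))) v0) v0)
    (letP (call conjP (.pair v0 (fstP (fstP (lift arg)))) v1)
      (call combP (.pair (.pair (oneR / (sndP (sndP (lift (lift arg))) *
        call traceP (call mulP (.pair (fstP (fstP (lift (lift arg)))) v0) v2) v2)) v0)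
        (.pair oneR v1)) v2))

instance : PolyTime size upperGainP := by unfold upperGainP; infer_instance

theorem den_upperGainP {X Y : Matrix (Fin n) (Fin n) ℝ} {u δ : ℝ} (h : (u • X - Y).PosDef) :
    den upperGainP (no_index (((encMat X, encMat Y), (u, δ)), n)) = encMat (upperGain X Y u δ) := by
  have e : u • X + (0 - 1 : ℝ) • Y = u • X - Y := by simp [sub_eq_add_neg]
  simp only [upperGainP, den_letP, den_call, den_pair, den_fstP, den_sndP, den_arg, den_subR,
    den_zeroR, den_oneR, den_combP, e, den_v0, den_lift, den_divR, den_mulR, den_invP h, den_conjP,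
    den_mulP, den_traceP, upperGain]
  rw [one_smul, one_div]

/-- `lowerGain`, from `((X, Y), l)`. -/
def lowerGainP : Prog (.prod (.prod (.prod .mat .mat) .real) .nat) .mat :=
  letP (call invP (call combP (.pair (.pair oneR (sndP (fstP arg)))
      (.pair (zeroR - sndP arg) (fstP (fstP arg)))) v0) v0)
    (letP (call invP (call combP (.pair (.pair oneR (sndP (fstP (lift arg))))
      (.pair (zeroR - (sndP (lift arg) + oneR)) (fstP (fstP (lift arg))))) v1) v1)
      (call combP (.pair (.pair (oneR /
          (call traceP (call mulP (.pair (fstP (fstP (lift (lift arg)))) v0) v2) v2 -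
            call traceP (call mulP (.pair (fstP (fstP (lift (lift arg)))) v1) v2) v2))
          (call conjP (.pair v0 (fstP (fstP (lift (lift arg))))) v2))
        (.pair (zeroR - oneR) v0)) v2))

instance : PolyTime size lowerGainP := by unfold lowerGainP; infer_instance

theorem den_lowerGainP {X Y : Matrix (Fin n) (Fin n) ℝ} {l : ℝ} (h : (Y - l • X).PosDef)
    (h' : (Y - (l + 1) • X).PosDef) :
    den lowerGainP (no_index (((encMat X, encMat Y), l), n)) = encMat (lowerGain X Y l) := by
  have e : (1 : ℝ) • Y + (0 - l) • X = Y - l • X := by simp [sub_eq_add_neg]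
  have e' : (1 : ℝ) • Y + (0 - (l + 1)) • X = Y - (l + 1) • X := by
    rw [one_smul, zero_sub, neg_smul, sub_eq_add_neg]
  simp only [lowerGainP, den_letP, den_call, den_pair, den_fstP, den_sndP, den_arg, den_subR,
    den_addR, den_zeroR, den_oneR, den_combP, e, e', den_v0, den_lift, den_divR, den_invP h,
    den_invP h', den_conjP, den_mulP, den_traceP, lowerGain]
  rw [one_div, zero_sub, neg_smul, one_smul, sub_eq_add_neg _ (Y - (l + 1) • X)⁻¹]

end WorkDepth

/-! ### The search for an admissible pair and the iteration of the barrier method. -/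

namespace WorkDepth

open RealMatrix

variable {Γ : Ty} {n : ℕ}

set_option synthInstance.maxHeartbeats 200000
set_option synthInstance.maxSize 2000

/-- The value of `pairForm`. -/
def pairFormP (G : Prog Γ .mat) (i j : Prog Γ .nat) : Prog Γ .real :=
  iteEq i j (ent G i i) (ent G i i + ent G j j - ent G i j - ent G j i)

instance {N : Γ.Val → ℕ} {G : Prog Γ .mat} {i j : Prog Γ .nat} [PolyTime N G] [PolyTime N i]
    [PolyTime N j] : PolyTime N (pairFormP G i j) := by unfold pairFormP; infer_instance

/-- `pairForm` on the data that represents a matrix. -/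
noncomputable def pairEntry (L : Ty.mat.Val) (i j : ℕ) : ℝ :=
  if i = j then entry L i i else entry L i i + entry L j j - entry L i j - entry L j i

@[simp] theorem den_pairFormP (G : Prog Γ .mat) (i j : Prog Γ .nat) (x : Γ.Val) :
    den (pairFormP G i j) x = pairEntry (den G x) (den i x) (den j x) := by
  simp only [pairFormP, den_iteEq, den_ent, den_addR, den_subR]
  rfl

theorem pairEntry_encMat (A : Matrix (Fin n) (Fin n) ℝ) (i j : Fin n) :
    pairEntry (encMat A) i j = pairForm A i j := by
  simp only [pairEntry, pairForm, entry_encMat, Fin.ext_iff]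

/-- An entry of `pairVec`. -/
def pairVecP (i j k : Prog Γ .nat) : Prog Γ .real :=
  iteEq i j (iteEq k i oneR zeroR) (iteEq k i oneR zeroR - iteEq k j oneR zeroR)

instance {N : Γ.Val → ℕ} {i j k : Prog Γ .nat} [PolyTime N i] [PolyTime N j]
    [PolyTime N k] : PolyTime N (pairVecP i j k) := by unfold pairVecP; infer_instance

theorem den_pairVecP (i j k : Prog Γ .nat) (x : Γ.Val) {i' j' k' : Fin n}
    (hi : den i x = (i' : ℕ)) (hj : den j x = (j' : ℕ)) (hk : den k x = (k' : ℕ)) :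
    den (pairVecP i j k) x = pairVec i' j' k' := by
  simp only [pairVecP, den_iteEq, den_subR, den_oneR, den_zeroR, hi, hj, hk, pairVec]
  by_cases h1 : (i' : ℕ) = j'
  · rw [if_pos h1, if_pos (Fin.ext h1), Pi.single_apply]
    simp only [Fin.ext_iff]
  · rw [if_neg h1, if_neg (fun h => h1 (congrArg _ h)), Pi.sub_apply, Pi.single_apply,
      Pi.single_apply]
    simp only [Fin.ext_iff]

/-- The state is overwritten at every hit, so the last hit survives. Once the state is a hit it
remains one, whence the starting state is irrelevant. -/
theorem passes_search (P : ℕ → ℕ → Prop) [∀ i j, Decidable (P i j)] (n : ℕ) (s : ℕ × ℕ)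
    (h : ∃ i < n, ∃ j < n, P i j) :
    ∃ i j : Fin n, P i j ∧
      passes (fun i s => passes (fun j s => if P i j then (i, j) else s) s n) s n =
        ((i : ℕ), (j : ℕ)) := by
  let Good : ℕ × ℕ → Prop := fun s => P s.1 s.2 ∧ s.1 < n ∧ s.2 < n
  have inner : ∀ i < n, ∀ m ≤ n, ∀ s : ℕ × ℕ, (Good s ∨ ∃ j < m, P i j) →
      Good (passes (fun j s => if P i j then (i, j) else s) s m) := by
    intro i hi m
    induction m with
    | zero =>
      rintro _ s (h | ⟨j, hj, _⟩)
      · exact h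
      · omega
    | succ m ih =>
      intro hm s h
      rw [passes]
      by_cases hP : P i m
      · rw [if_pos hP]; exact ⟨hP, hi, hm⟩
      · rw [if_neg hP]
        refine ih (by omega) s ?_
        rcases h with h | ⟨j, hj, h⟩
        · exact Or.inl h
        · refine Or.inr ⟨j, ?_, h⟩
          have : j ≠ m := fun e => hP (e ▸ h)
          omega
  have outer : ∀ m ≤ n, (∃ i < m, ∃ j < n, P i j) →
      Good (passes (fun i s => passes (fun j s => if P i j then (i, j) else s) s n) s m) := by
    intro m
    induction m with
    | zero => rintro _ ⟨i, hi, _⟩; omega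
    | succ m ih =>
      rintro hm ⟨i, hi, j, hj, h⟩
      rw [passes]
      by_cases e : i = m
      · exact inner m hm n le_rfl _ (Or.inr ⟨j, hj, e ▸ h⟩)
      · exact inner m hm n le_rfl _ (Or.inl (ih (by omega) ⟨i, by omega, j, hj, h⟩))
  obtain ⟨h1, h2, h3⟩ := outer n le_rfl h
  exact ⟨⟨_, h2⟩, ⟨_, h3⟩, h1, rfl⟩

/-- The search for a pair that respects both potentials, given the two gains. -/
def searchP : Prog (.prod (.prod .mat .mat) .nat) (.prod .nat .nat) :=
  forP v0 (.pair (lit 0) (lit 0)) (forP v2 v0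
    (.ite (ltR zeroR (pairFormP (sndP (lift (lift (lift (lift arg))))) v3 v1))
      (.ite (ltR (pairFormP (sndP (lift (lift (lift (lift arg))))) v3 v1)
          (pairFormP (fstP (lift (lift (lift (lift arg))))) v3 v1))
        v0 (.pair v3 v1))
      v0))

instance : PolyTime size searchP := by unfold searchP; infer_instance

theorem den_searchP {G H : Matrix (Fin n) (Fin n) ℝ}
    (h : ∃ i j, 0 < pairForm H i j ∧ pairForm G i j ≤ pairForm H i j) :
    ∃ i j : Fin n, den searchP ((encMat G, encMat H), n) = ((i : ℕ), (j : ℕ)) ∧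
      0 < pairForm H i j ∧ pairForm G i j ≤ pairForm H i j := by
  classical
  obtain ⟨i, j, hij, he⟩ := passes_search (fun i j => 0 < pairEntry (encMat H) i j ∧
    pairEntry (encMat G) i j ≤ pairEntry (encMat H) i j) n (0, 0) (by
      obtain ⟨i, j, h1, h2⟩ := h
      refine ⟨i, i.2, j, j.2, ?_⟩
      simpa only [pairEntry_encMat] using ⟨h1, h2⟩)
  simp only [pairEntry_encMat] at hij
  refine ⟨i, j, ?_, hij⟩
  rw [← he]
  simp only [searchP, den_forP, den_v0, den_pair, den_lit, den_lift, den_ite, den_ltR, den_zeroR,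
    den_pairFormP, den_sndP, den_fstP, den_arg, decide_eq_true_eq]
  congr 1
  funext i s
  congr 1
  funext j s
  by_cases h1 : 0 < pairEntry (encMat H) i j
  · by_cases h2 : pairEntry (encMat H) i j < pairEntry (encMat G) i j
    · rw [if_pos h1, if_pos h2, if_neg (fun h => not_lt.mpr h.2 h2)]
    · rw [if_pos h1, if_neg h2, if_pos ⟨h1, not_lt.mp h2⟩]
  · rw [if_neg h1, if_neg (fun h => h1 h.1)]

/-- One step of the barrier method, from `((X, δ), (Y, (l, u)))`. -/
def stepP : Prog (.prod (.prod (.prod .mat .real) (.prod .mat (.prod .real .real))) .nat)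
    (.prod .mat (.prod .real .real)) :=
  letP (call upperGainP (.pair (.pair (fstP (fstP arg)) (fstP (sndP arg)))
      (.pair (sndP (sndP (sndP arg)) + sndP (fstP arg)) (sndP (fstP arg)))) v0)
    (letP (call lowerGainP (.pair (.pair (fstP (fstP (lift arg))) (fstP (sndP (lift arg))))
        (fstP (sndP (sndP (lift arg))))) v1)
      (letP (call searchP (.pair v1 v0) v2)
        (letP (oneR / pairFormP v1 (fstP v0) (sndP v0))
          (.pair (tab v4 (tab v5
              (ent (fstP (sndP (lift (lift (lift (lift (lift (lift arg)))))))) v1 v0 +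
                v2 * (pairVecP (fstP v3) (sndP v3) v1 * pairVecP (fstP v3) (sndP v3) v0))))
            (.pair (fstP (sndP (sndP (lift (lift (lift (lift arg)))))) + oneR)
              (sndP (sndP (sndP (lift (lift (lift (lift arg)))))) +
                sndP (fstP (lift (lift (lift (lift arg)))))))))))

instance : PolyTime size stepP := by unfold stepP; infer_instance

theorem den_stepP [Nonempty (Fin n)] {X Y : Matrix (Fin n) (Fin n) ℝ} {l u φ δ : ℝ} {k : ℕ}
    (h : BarrierState X Y l u φ k) (hX : X.PosDef) (hdd : DiagDom X) (hδ : 0 < δ) (hφ1 : φ < 1)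
    (hbal : 1 / δ + φ ≤ 1 - φ) :
    ∃ Y', den stepP (((encMat X, δ), (encMat Y, (l, u))), n) = (encMat Y', (l + 1, u + δ)) ∧
      BarrierState X Y' (l + 1) (u + δ) φ (k + 1) := by
  obtain ⟨i, j, hs, hp, hp'⟩ := den_searchP (h.barrier.exists_pair hX hdd hδ hφ1 hbal)
  refine ⟨_, ?_, h.step hX hδ hφ1 hp hp'⟩
  have h1 := den_upperGainP (δ := δ) (posDef_upper_shift hX h.barrier.upper hδ)
  have h2 := den_lowerGainP h.barrier.lower
    (posDef_lower_shift hX h.barrier.lower h.barrier.lower_pot hφ1)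
  simp only [stepP, den_letP, den_call, den_pair, den_fstP, den_sndP, den_arg, den_addR, den_v0,
    den_lift, h1, h2, hs, den_divR, den_oneR, den_pairFormP, pairEntry_encMat, den_tab, den_mulR,
    den_ent]
  congr 1
  refine tabList_eq_encMat fun k l => ?_
  rw [den_pairVecP (i' := i) (j' := j) (k' := k), den_pairVecP (i' := i) (j' := j) (k' := l),
    entry_encMat]
  · simp [Matrix.vecMulVec_apply]
  all_goals simp only [den_fstP, den_sndP, den_lift, den_v0]

theorem passes_const {α : Type} (f : α → α) (x : α) (n : ℕ) :
    passes (fun _ s => f s) x n = f^[n] x := by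
  induction n with
  | zero => rfl
  | succ n ih => rw [passes, ih, Function.iterate_succ_apply']

instance {a b : Ty} {N : (Ty.prod (.prod a .nat) b).Val → ℕ} :
    PolyTime N (lift (arg : Prog (.prod a .nat) a) : Prog (.prod (.prod a .nat) b) a) :=
  .of_cost _ (.const _) fun _ => ⟨_, Cost.prim.lift⟩

/-- The barrier method. -/
def sparsifyP : Prog (.prod (.prod .mat .nat) .nat) .mat :=
  letP (toR v0 / (toR v0 - toR (lit 2)))
    (letP (forP v2 (.pair (tab v2 (tab v3 zeroR))
        (.pair (zeroR - toR v2 * toR v1) (toR v2 * toR v1)))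
      (forP v3 v0 (forP v5 v0 (call stepP
        (.pair (.pair (lift (lift (lift (lift (lift (lift (lift (lift arg)))))))) (lift (lift v4))) v0)
        (lift (lift (lift v5)))))))
      (call combP (.pair (.pair (oneR / sndP (sndP v0)) (fstP v0)) (.pair zeroR (fstP v0))) v3))

instance : PolyTime size₂ sparsifyP := by unfold sparsifyP; infer_instance

theorem den_sparsifyP [Nonempty (Fin n)] {X : Matrix (Fin n) (Fin n) ℝ} (hX : X.PosDef)
    (hdd : DiagDom X) {d : ℕ} (hd : 0 < d) :
    ∃ N, den sparsifyP ((encMat X, n), 4 * d + 2) = encMat N ∧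
      IsSparsifier X N d (2 * (n * ((4 * d + 2) * (4 * d + 2)))) := by
  set q : ℕ := 4 * d + 2 with hq
  set δ : ℝ := (q : ℝ) / (q - 2) with hδ
  have hd' : (0 : ℝ) < d := by exact_mod_cast hd
  have hqR : (q : ℝ) = 4 * d + 2 := by rw [hq]; push_cast; ring
  have hq2 : (0 : ℝ) < q - 2 := by rw [hqR]; linarith
  have hq0 : (0 : ℝ) < q := by linarith
  have hn0 : (0 : ℝ) < n := by exact_mod_cast Fin.pos_iff_nonempty.mpr ‹_›
  have hδ0 : 0 < δ := div_pos hq0 hq2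
  have hφ : 1 / (q : ℝ) < 1 := by rw [div_lt_one hq0, hqR]; linarith
  -- The choice of δ makes this an equality: 1/δ = 1 - 2/q.
  have hbal : 1 / δ + 1 / q ≤ 1 - 1 / q := by
    apply le_of_eq; rw [hδ]; field_simp; ring
  set f : (Ty.prod .mat (.prod .real .real)).Val → (Ty.prod .mat (.prod .real .real)).Val :=
    fun s => den stepP (((encMat X, δ), s), n) with hf
  have inv : ∀ k : ℕ, ∃ Y, f^[k] (encMat (0 : Matrix (Fin n) (Fin n) ℝ), (-((n : ℝ) * q), (n : ℝ) * q)) =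
      (encMat Y, (-((n : ℝ) * q) + k, (n : ℝ) * q + k * δ)) ∧
      BarrierState X Y (-((n : ℝ) * q) + k) ((n : ℝ) * q + k * δ) (1 / q) k := by
    intro k
    induction k with
    | zero =>
      refine ⟨0, by simp, ?_⟩
      have := BarrierState.init hX hq0
      simpa using this
    | succ k ih =>
      obtain ⟨Y, h1, h2⟩ := ih
      obtain ⟨Y', h3, h4⟩ := den_stepP h2 hX hdd hδ0 hφ hbal
      refine ⟨Y', ?_, ?_⟩
      · rw [Function.iterate_succ_apply', h1, hf]
        simp only
        rw [h3]; push_cast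
        rw [add_assoc, add_assoc, add_mul, one_mul]
      · push_cast
        rwa [← add_assoc, add_mul, one_mul, ← add_assoc]
  obtain ⟨Y, h1, h2⟩ := inv (n * (q * q))
  have hz : tabList n (fun _ => tabList n fun _ => (0 : ℝ)) =
      encMat (0 : Matrix (Fin n) (Fin n) ℝ) := tabList_eq_encMat fun i j => by simp
  have hu0 : 0 < (n * q + (n * (q * q) : ℕ) * δ : ℝ) := by positivity
  have hl0 : 0 < (-(n * q) + (n * (q * q) : ℕ) : ℝ) := by
    push_cast
    have : (0 : ℝ) < n * q * (q - 1) := by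
      refine mul_pos (mul_pos hn0 hq0) ?_; linarith
    linarith
  refine ⟨_, ?_, (h2.isSparsifier (d := d) hX hl0 hu0 ?_)⟩
  -- The language cannot multiply natural numbers, so the nq² steps are run as three nested loops of
  -- n, q and q passes.
  · rw [mul_comm n, Function.iterate_mul, Function.iterate_mul] at h1
    simp only [sparsifyP, den_letP, den_forP, den_call, den_pair, den_divR, den_subR, den_mulR,
      den_toR, den_v0, den_lift, den_lit, den_zeroR, den_oneR, den_tab, den_fstP, den_sndP, den_arg]
    have h3 : passes (fun _ s => passes (fun _ s => passes (fun _ s => f s) s q) s q)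
        (tabList n fun _ => tabList n fun _ => (0 : ℝ), ((0 : ℝ) - n * q, (n : ℝ) * q)) n =
        (encMat Y, (-((n : ℝ) * q) + (n * (q * q) : ℕ),
          (n : ℝ) * q + (n * (q * q) : ℕ) * δ)) := by
      simp only [passes_const]
      rw [hz, zero_sub, mul_comm n]
      exact h1
    have h4 : (((2 : ℕ) : ℕ) : ℝ) = 2 := by norm_num
    rw [h4]
    erw [h3]
    simp only [den_combP]
    congr 1
    rw [zero_smul, add_zero, one_div]
  -- The final barriers are l = nq(q - 1) and u = nq(q - 1)(q + 2)/(q - 2), with ratio (q + 2)/(q -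
  -- 2) = (d + 1)/d.
  · push_cast
    rw [hδ, hqR]
    have : (4 * (d : ℝ) + 2 - 2) = 4 * d := by ring
    rw [this]
    field_simp
    ring

end WorkDepth

/-! ### Programs for the chain -/

namespace WorkDepth

open RealMatrix

variable {Γ : Ty} {n : ℕ}

set_option synthInstance.maxHeartbeats 200000
set_option synthInstance.maxSize 2000

theorem one_smul_add_neg (A B : Matrix (Fin n) (Fin n) ℝ) :
    (1 : ℝ) • A + (0 - 1 : ℝ) • B = A - B := by
  rw [one_smul, zero_sub, neg_one_smul, sub_eq_add_neg]

/-- The next level of the chain. -/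
def nextP : Prog (.prod (.prod .mat .nat) .nat) .mat :=
  letP (call combP (.pair (.pair oneR (call idP (lit 0) v1))
      (.pair (zeroR - oneR) (call mulP (.pair (lift arg) (lift arg)) v1))) v1)
    (letP (call₂ sparsifyP v0 v2 (v1 + v1 + v1 + v1 + lit 2))
      (call combP (.pair (.pair oneR (call idP (lit 0) v3)) (.pair (zeroR - oneR) v0)) v3))

instance : PolyTime size₂ nextP := by unfold nextP; infer_instance

theorem den_nextP [Nonempty (Fin n)] {a : Matrix (Fin n) (Fin n) ℝ} (ha : IsLevel a) {d : ℕ}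
    (hd : 0 < d) :
    ∃ a', den nextP ((encMat a, n), d) = encMat a' ∧
      IsSparsifier (1 - a * a) (1 - a') d (2 * (n * ((4 * d + 2) * (4 * d + 2)))) := by
  obtain ⟨N, h1, h2⟩ := den_sparsifyP ha.posDef_sq ha.diagDom_sq hd
  refine ⟨1 - N, ?_, by rwa [sub_sub_cancel]⟩
  have e : d + d + d + d + 2 = 4 * d + 2 := by ring
  simp only [nextP, den_letP, den_call, den_call₂, den_pair, den_oneR, den_zeroR, den_v0, den_lift,
    den_idP, den_subR, den_arg, den_mulP, den_combP, one_smul_add_neg, den_addN, den_lit, e, h1]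

/-- The levels of the chain. -/
def levelsP : Prog (.prod (.prod .mat .nat) .nat) (.arr .mat) :=
  forP v0 (tab (lit 1) (lift (lift arg))) (push v2 v0 (call₂ nextP (get v0 v1) v3 v2))

instance : PolyTime size₂ levelsP := by unfold levelsP; infer_instance

theorem tabList_succ {α : Type} (n : ℕ) (f : ℕ → α) : tabList (n + 1) f = tabList n f ++ [f n] := by
  rw [tabList, List.ofFn_succ', List.concat_eq_append]
  simp [tabList]

/-- The sequence of levels is infinite, as the iterates of one chosen step, which avoids bounds on
indices later; the program outputs only its first d + 1 members. -/
theorem den_levelsP [Nonempty (Fin n)] {a₀ : Matrix (Fin n) (Fin n) ℝ} (ha : IsLevel a₀) {d : ℕ}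
    (hd : 0 < d) :
    ∃ a : ℕ → Matrix (Fin n) (Fin n) ℝ, a 0 = a₀ ∧
      den levelsP ((encMat a₀, n), d) = tabList (d + 1) (fun i => encMat (a i)) ∧
      ∀ i, IsLevel (a i) ∧ IsSparsifier (1 - a i * a i) (1 - a (i + 1)) d
        (2 * (n * ((4 * d + 2) * (4 * d + 2)))) := by
  choose! f hf1 hf2 using fun (a : Matrix (Fin n) (Fin n) ℝ) (ha : IsLevel a) => den_nextP ha hd
  have hlev : ∀ i, IsLevel (f^[i] a₀) := fun i => by
    induction i with
    | zero => exact ha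
    | succ i ih =>
      rw [Function.iterate_succ_apply']
      simpa using ih.next (hf2 _ ih)
  refine ⟨fun i => f^[i] a₀, rfl, ?_, fun i => ⟨hlev i, ?_⟩⟩
  · simp only [levelsP, den_forP, den_v0, den_tab, den_lit, den_lift, den_arg]
    have h : ∀ k ≤ d, passes (fun i s => den (push v2 v0 (call₂ nextP (get v0 v1) v3 v2) :
        Prog (.prod (.prod (.prod (.prod .mat .nat) .nat) .nat) (.arr .mat)) (.arr .mat))
        ((((encMat a₀, n), d), i), s)) (tabList 1 fun _ => encMat a₀) k =
        tabList (k + 1) fun i => encMat (f^[i] a₀) := by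
      intro k
      induction k with
      | zero => intro _; rfl
      | succ k ih =>
        intro hk
        rw [passes, ih (by omega), den_push]
        · rw [tabList_succ (k + 1)]
          simp only [den_v0, den_call₂, den_get, den_lift]
          rw [getD_tabList, if_pos (by omega), hf1 _ (hlev k), Function.iterate_succ_apply']
        · simp only [den_v0, den_lift, length_tabList]
          exact hk
    exact h d le_rfl
  · simp only [Function.iterate_succ_apply']
    exact hf2 _ (hlev i)

/-- The sparse representation of a dense matrix. -/
def sparseP : Prog (.prod .mat .nat) .sparse :=
  tab v0 (forP v1 (tab (lit 0) (.pair (lit 0) zeroR))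
    (.ite (ltR (ent (lift (lift (lift arg))) v2 v1) zeroR)
      (push v3 v0 (.pair v1 (ent (lift (lift (lift arg))) v2 v1)))
      (.ite (ltR zeroR (ent (lift (lift (lift arg))) v2 v1))
        (push v3 v0 (.pair v1 (ent (lift (lift (lift arg))) v2 v1))) v0)))

instance : PolyTime size sparseP := by unfold sparseP; infer_instance

/-- Equality of reals is not an elementary test, so an entry is recognised as nonzero by two strict
comparisons. After m columns the list holds the nonzero entries among the first m. -/
theorem den_sparseP (A : Matrix (Fin n) (Fin n) ℝ) :
    den sparseP (no_index (encMat A, n)) = encodeSparse A := by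
  simp only [sparseP, den_tab, den_v0, den_forP, den_lift, den_lit, den_pair, den_zeroR]
  unfold encodeSparse
  rw [tabList]
  congr 1
  funext i
  set F := fun (j : ℕ) (s : (Ty.arr (.prod .nat .real)).Val) => den
    (.ite (ltR (ent (lift (lift (lift arg))) v2 v1) zeroR)
      (push v3 v0 (.pair v1 (ent (lift (lift (lift arg))) v2 v1)))
      (.ite (ltR zeroR (ent (lift (lift (lift arg))) v2 v1))
        (push v3 v0 (.pair v1 (ent (lift (lift (lift arg))) v2 v1))) v0) :
      Prog (.prod (.prod (.prod (.prod .mat .nat) .nat) .nat) (.arr (.prod .nat .real)))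
        (.arr (.prod .nat .real))) ((((encMat A, n), (i : ℕ)), j), s) with hF
  set G := fun m => List.map (fun j : Fin n => ((j : ℕ), A i j))
    (List.filter (fun j : Fin n => decide (A i j ≠ 0)) ((List.finRange n).take m)) with hG
  have h : ∀ m ≤ n, passes F (tabList 0 fun _ => ((0 : ℕ), (0 : ℝ))) m = G m := by
    intro m
    induction m with
    | zero => intro _; simp [passes, tabList, hG]
    | succ m ih =>
      intro hm
      rw [passes, ih (by omega)]
      have hlen : (G m).length ≤ n := by
        rw [hG, List.length_map]
        refine (List.length_filter_le _ _).trans ?_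
        rw [List.length_take]; omega
      have hs : G (m + 1) = G m ++ if A i ⟨m, hm⟩ ≠ 0 then [(m, A i ⟨m, hm⟩)] else [] := by
        simp only [hG]
        rw [List.take_succ_eq_append_getElem (by simpa using hm), List.filter_append,
          List.map_append]
        congr 1
        simp only [List.getElem_finRange, Fin.cast_mk, List.filter_cons, List.filter_nil]
        split_ifs with h1 h2 h2 <;> simp_all
      have he := entry_encMat A i ⟨m, hm⟩
      simp only at he
      rw [hF, hs]
      simp only [den_ite, den_ltR, den_ent, den_lift, den_arg, den_v0, den_zeroR,
        decide_eq_true_eq, he]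
      rw [den_push _ _ _ (by simpa using hlen)]
      simp only [den_v0, den_pair, den_lift, den_ent, den_arg, he]
      by_cases h1 : A i ⟨m, hm⟩ < 0
      · rw [if_pos h1, if_pos h1.ne]
      · by_cases h2 : 0 < A i ⟨m, hm⟩
        · rw [if_neg h1, if_pos h2, if_pos h2.ne']
        · rw [if_neg h1, if_neg h2, if_neg (by push Not; linarith), List.append_nil]
  have := h n le_rfl
  rw [hG] at this
  simp only at this
  rw [List.take_of_length_le (by simp)] at this
  exact this

/-- The dense representation of a sparse matrix. -/
def denseP : Prog (.prod .sparse .nat) .mat :=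
  tab v0 (tab v1 (sumP v2 (iteEq (fstP (get (get (lift (lift (lift arg))) v2) v0)) v1
    (sndP (get (get (lift (lift (lift arg))) v2) v0)) zeroR)))

instance : PolyTime size denseP := by unfold denseP; infer_instance

/-- A read beyond the end returns d, which adds nothing because g vanishes there. So a loop may run
up to any bound on the length. -/
theorem sum_getD {α : Type} (l : List α) (d : α) (g : α → ℝ) (hd : g d = 0) :
    ∀ m, l.length ≤ m → ∑ k ∈ Finset.range m, g (l.getD k d) = (l.map g).sum := by
  induction l with
  | nil => intro m _; simp [hd]
  | cons a l ih =>
    intro m hm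
    obtain ⟨m, rfl⟩ : ∃ k, m = k + 1 := ⟨m - 1, by simp at hm; omega⟩
    rw [Finset.sum_range_succ']
    simp only [List.getD_cons_succ, List.getD_cons_zero, List.map_cons, List.sum_cons]
    rw [ih m (by simpa using hm), add_comm]

theorem sum_filter_finRange (p : Fin n → Bool) (g : Fin n → ℝ) (h : ∀ j, p j = false → g j = 0) :
    (List.map g (List.filter p (List.finRange n))).sum = ∑ j, g j := by
  have : ∀ l : List (Fin n), (List.map g (List.filter p l)).sum = (l.map g).sum := by
    intro l
    induction l with
    | nil => rfl
    | cons a l ih =>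
      rw [List.filter_cons]
      by_cases ha : p a
      · rw [if_pos ha, List.map_cons, List.map_cons, List.sum_cons, List.sum_cons, ih]
      · rw [if_neg ha, List.map_cons, List.sum_cons, ih, h a (by simpa using ha), zero_add]
  rw [this, ← List.ofFn_eq_map, List.sum_ofFn]

theorem getD_encodeSparse (M : Matrix (Fin n) (Fin n) ℝ) (i : Fin n) (d) :
    @List.getD (List (ℕ × ℝ)) (encodeSparse M) i d = List.map (fun j : Fin n => ((j : ℕ), M i j))
      (List.filter (fun j : Fin n => decide (M i j ≠ 0)) (List.finRange n)) :=
  getD_ofFn _ _ _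

theorem length_row_le (M : Matrix (Fin n) (Fin n) ℝ) (i : Fin n) :
    (List.map (fun j : Fin n => ((j : ℕ), M i j))
      (List.filter (fun j : Fin n => decide (M i j ≠ 0)) (List.finRange n))).length ≤ n := by
  rw [List.length_map]
  exact (List.length_filter_le _ _).trans (by simp)

/-- Each entry is found by scanning n positions of the row. A position beyond its end reads as (0,
0) and adds 0 even to column 0. -/
theorem den_denseP (M : Matrix (Fin n) (Fin n) ℝ) :
    den denseP (encodeSparse M, n) = encMat M := by
  simp only [denseP, den_tab, den_v0, den_lift, den_sumP, den_iteEq, den_fstP, den_sndP, den_get,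
    den_zeroR, den_arg]
  refine tabList_eq_encMat fun i j => ?_
  have h1 := getD_encodeSparse M i []
  have h2 := sum_getD _ ((0 : ℕ), (0 : ℝ)) (fun p => if p.1 = (j : ℕ) then p.2 else 0) (by simp) n
    (length_row_le M i)
  rw [List.map_map, sum_filter_finRange] at h2
  · have h3 : ∑ k : Fin n, ((fun p : ℕ × ℝ => if p.1 = (j : ℕ) then p.2 else 0) ∘
        fun j : Fin n => ((j : ℕ), M i j)) k = M i j := by
      rw [Finset.sum_eq_single j]
      · simp
      · intro k _ hk
        have : (k : ℕ) ≠ j := fun h => hk (Fin.ext h)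
        simp [this]
      · simp
    rw [h3] at h2
    rw [← h2, ← h1]
    rfl
  · intro k hk
    simp at hk
    simp [hk]

/-- The largest of `0` and the diagonal entries. -/
def maxDiagP : Prog (.prod .mat .nat) .real :=
  forP v0 zeroR (.ite (ltR v0 (ent (lift (lift arg)) v1 v1)) (ent (lift (lift arg)) v1 v1) v0)

instance : PolyTime size maxDiagP := by unfold maxDiagP; infer_instance

theorem den_maxDiagP (M : Matrix (Fin n) (Fin n) ℝ) :
    ∃ m : ℝ, den maxDiagP (encMat M, n) = m ∧ 0 ≤ m ∧ (∀ i, M i i ≤ m) ∧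
      (m = 0 ∨ ∃ i, m = M i i) := by
  set F : ℕ → ℝ → ℝ := fun i s =>
    if s < entry (encMat M) i i then entry (encMat M) i i else s with hF
  have hp : den maxDiagP (encMat M, n) = passes F 0 n := by
    simp only [maxDiagP, den_forP, den_v0, den_zeroR]
    congr 1
    funext i s
    simp only [den_v0, den_ite, den_ltR, den_ent, den_lift, den_arg, hF]
    exact ite_congr decide_eq_true_eq (fun _ => rfl) fun _ => rfl
  have h : ∀ k ≤ n, 0 ≤ passes F 0 k ∧ (∀ i : Fin n, (i : ℕ) < k → M i i ≤ passes F 0 k) ∧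
      (passes F 0 k = 0 ∨ ∃ i, passes F 0 k = M i i) := by
    intro k
    induction k with
    | zero => intro _; exact ⟨le_rfl, fun i hi => absurd hi (Nat.not_lt_zero _), Or.inl rfl⟩
    | succ k ih =>
      intro hk
      obtain ⟨h0, h1, h2⟩ := ih (by omega)
      have he := entry_encMat M ⟨k, hk⟩ ⟨k, hk⟩
      simp only at he
      rw [passes, hF]
      simp only [he]
      rw [← hF]
      by_cases hlt : passes F 0 k < M ⟨k, hk⟩ ⟨k, hk⟩
      · rw [if_pos hlt]
        refine ⟨h0.trans hlt.le, fun i hi => ?_, Or.inr ⟨_, rfl⟩⟩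
        by_cases e : (i : ℕ) = k
        · have : i = ⟨k, hk⟩ := Fin.ext e
          rw [this]
        · exact (h1 i (by omega)).trans hlt.le
      · rw [if_neg hlt]
        refine ⟨h0, fun i hi => ?_, h2⟩
        by_cases e : (i : ℕ) = k
        · have : i = ⟨k, hk⟩ := Fin.ext e
          rw [this]; exact not_lt.mp hlt
        · exact h1 i (by omega)
  obtain ⟨h0, h1, h2⟩ := h n le_rfl
  exact ⟨_, hp, h0, fun i => h1 i i.2, h2⟩

/-- The chain of a matrix, from `((M, c), n)` and its length. -/
def chainP : Prog (.prod (.prod (.prod .mat .real) .nat) .nat) .chain :=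
  letP (call combP (.pair (.pair oneR (call idP (lit 0) v1))
      (.pair (zeroR - oneR / sndP (lift arg)) (fstP (lift arg)))) v1)
    (letP (call₂ levelsP v0 v2 v1)
      (tab (v2 + lit 1) (.pair (tab v4 (sndP (lift (lift (lift (lift (lift arg)))))))
        (call sparseP (call combP
          (.pair (.pair (sndP (lift (lift (lift (lift arg))))) (get v1 v0))
            (.pair zeroR (get v1 v0))) v4) v4))))

instance : PolyTime size₂ chainP := by unfold chainP; infer_instance

theorem den_chainP [Nonempty (Fin n)] {M : Matrix (Fin n) (Fin n) ℝ} {c : ℝ}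
    (h : IsLevel (1 - c⁻¹ • M)) {d : ℕ} (hd : 0 < d) :
    ∃ a : ℕ → Matrix (Fin n) (Fin n) ℝ, a 0 = 1 - c⁻¹ • M ∧
      den chainP (((encMat M, c), n), d) =
        encodeChain (fun _ : Fin (d + 1) => c • (1 : Matrix (Fin n) (Fin n) ℝ))
          (fun i => c • a i) ∧
      ∀ i, IsLevel (a i) ∧ IsSparsifier (1 - a i * a i) (1 - a (i + 1)) d
        (2 * (n * ((4 * d + 2) * (4 * d + 2)))) := by
  obtain ⟨a, h0, h1, h2⟩ := den_levelsP h hd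
  refine ⟨a, h0, ?_, h2⟩
  have e : (1 : ℝ) • (1 : Matrix (Fin n) (Fin n) ℝ) + (0 - 1 / c) • M = 1 - c⁻¹ • M := by
    rw [one_smul, zero_sub, neg_smul, one_div, sub_eq_add_neg]
  simp only [chainP, den_letP, den_call, den_call₂, den_pair, den_oneR, den_zeroR, den_v0, den_lift,
    den_idP, den_subR, den_divR, den_arg, den_fstP, den_sndP, den_combP, e, h1, den_tab, den_addN,
    den_lit, den_get]
  rw [tabList, encodeChain]
  congr 1
  funext i
  rw [getD_tabList, if_pos i.2, den_combP, den_sparseP]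
  have e2 : c • a i + (0 : ℝ) • a i = c • a i := by rw [zero_smul, add_zero]
  rw [e2]
  congr 1
  rw [tabList, encodeVec]
  congr 1
  funext j
  simp

end WorkDepth

/-! ### Chains of levels -/

namespace RealMatrix

open Matrix

variable {n : ℕ}

theorem form_eq_sum (A : Matrix (Fin n) (Fin n) ℝ) (x : Fin n → ℝ) :
    form A x x = ∑ i, ∑ j, A i j * x i * x j := by
  simp only [form, dotProduct, mulVec, Finset.mul_sum]
  exact Finset.sum_congr rfl fun i _ => Finset.sum_congr rfl fun j _ => by ring

theorem dotProduct_self_nonneg_real (x : Fin n → ℝ) : 0 ≤ x ⬝ᵥ x := by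
  simpa using dotProduct_star_self_nonneg x

/-- Dominance bounds the absolute row sums by twice the diagonal, and 2|x_i x_j| ≤ x_i² + x_j² then
gives M ≼ c. The factor 2 in c is what makes 1 - c⁻¹M positive semidefinite. -/
theorem isLevel_of_isSDDM {M : Matrix (Fin n) (Fin n) ℝ} (hM : IsSDDM M) {c : ℝ} (hc : 0 < c)
    (h : ∀ i, 2 * M i i ≤ c) : IsLevel (1 - c⁻¹ • M) := by
  have hdiag : ∀ i, 0 ≤ M i i := fun i =>
    (Finset.sum_nonneg fun j _ => abs_nonneg (M i j)).trans (hM.dominant i)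
  have habs : ∀ i, ∑ j, |M i j| ≤ 2 * M i i := fun i => by
    rw [← Finset.add_sum_erase _ _ (Finset.mem_univ i), abs_of_nonneg (hdiag i)]
    linarith [hM.dominant i]
  have hsum : ∀ i, 0 ≤ ∑ j, M i j := fun i => by
    rw [← Finset.add_sum_erase _ _ (Finset.mem_univ i)]
    have : -∑ j ∈ Finset.univ.erase i, |M i j| ≤ ∑ j ∈ Finset.univ.erase i, M i j := by
      rw [← Finset.sum_neg_distrib]
      exact Finset.sum_le_sum fun j _ => neg_abs_le _
    linarith [hM.dominant i]
  have hform : ∀ x, form M x x ≤ c * (x ⬝ᵥ x) := fun x => by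
    have h1 : ∀ i j, M i j * x i * x j ≤ |M i j| * (x i * x i) / 2 + |M i j| * (x j * x j) / 2 :=
      fun i j => by
      have e1 := abs_mul_abs_self (M i j)
      rcases le_total 0 (M i j) with h0 | h0
      · rw [abs_of_nonneg h0]; nlinarith [mul_nonneg h0 (sq_nonneg (x i - x j))]
      · rw [abs_of_nonpos h0]
        nlinarith [mul_nonneg (neg_nonneg.mpr h0) (sq_nonneg (x i + x j))]
    have h2 : ∑ i, ∑ j, |M i j| * (x j * x j) / 2 = ∑ i, ∑ j, |M i j| * (x i * x i) / 2 := by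
      rw [Finset.sum_comm]
      refine Finset.sum_congr rfl fun i _ => Finset.sum_congr rfl fun j _ => ?_
      rw [hM.symm.apply]
    calc form M x x = ∑ i, ∑ j, M i j * x i * x j := form_eq_sum M x
      _ ≤ ∑ i, ∑ j, (|M i j| * (x i * x i) / 2 + |M i j| * (x j * x j) / 2) :=
          Finset.sum_le_sum fun i _ => Finset.sum_le_sum fun j _ => h1 i j
      _ = ∑ i, (∑ j, |M i j|) * (x i * x i) := by
          simp only [Finset.sum_add_distrib]
          rw [h2, ← Finset.sum_add_distrib]
          refine Finset.sum_congr rfl fun i _ => ?_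
          rw [← Finset.sum_add_distrib, Finset.sum_mul]
          exact Finset.sum_congr rfl fun j _ => by ring
      _ ≤ ∑ i, c * (x i * x i) := Finset.sum_le_sum fun i _ =>
          mul_le_mul_of_nonneg_right ((habs i).trans (h i)) (mul_self_nonneg _)
      _ = c * (x ⬝ᵥ x) := by rw [dotProduct, Finset.mul_sum]
  have hci : 0 < c⁻¹ := inv_pos.mpr hc
  refine ⟨fun i j => ?_, fun i => ?_, ?_, ?_⟩
  · rw [Matrix.sub_apply, Matrix.smul_apply, smul_eq_mul]
    by_cases hij : i = j
    · subst hij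
      rw [one_apply_eq, sub_nonneg, inv_mul_le_iff₀ hc, mul_one]
      linarith [h i, hdiag i]
    · rw [one_apply_ne hij]
      have := mul_nonneg hci.le (neg_nonneg.mpr (hM.offDiag i j hij))
      linarith
  · simp only [Matrix.sub_apply, Matrix.smul_apply, smul_eq_mul, Finset.sum_sub_distrib,
      ← Finset.mul_sum]
    have h1 : ∑ j, (1 : Matrix (Fin n) (Fin n) ℝ) i j = 1 := by simp [Matrix.one_apply]
    rw [h1]
    linarith [mul_nonneg hci.le (hsum i)]
  · rw [posSemidef_iff]
    refine ⟨isSymm_one.sub (IsSymm.smul hM.symm _), fun x => ?_⟩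
    rw [form_sub, form_one, form_smul, sub_nonneg, inv_mul_le_iff₀ hc]
    exact hform x
  · rw [sub_sub_cancel]
    exact hM.posDef.smul hci

theorem nnz_smul_one_le (c : ℝ) : nnz (c • (1 : Matrix (Fin n) (Fin n) ℝ)) ≤ n := by
  have h : {p : Fin n × Fin n | (c • (1 : Matrix (Fin n) (Fin n) ℝ)) p.1 p.2 ≠ 0} ⊆
      ((Finset.univ.image fun i : Fin n => (i, i) : Finset (Fin n × Fin n)) : Set _) := by
    rintro ⟨i, j⟩ hp
    have : i = j := by
      by_contra hij
      exact hp (by simp [Matrix.one_apply_ne hij])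
    subst this
    simp
  refine (Set.ncard_le_ncard h (Finset.finite_toSet _)).trans ?_
  rw [Set.ncard_coe_finset]
  exact Finset.card_image_le.trans (by simp)

theorem nnz_le_offNnz {A B : Matrix (Fin n) (Fin n) ℝ}
    (h : ∀ i j, i ≠ j → A i j ≠ 0 → B i j ≠ 0) : nnz A ≤ n + offNnz B := by
  classical
  have hs : {p : Fin n × Fin n | A p.1 p.2 ≠ 0} ⊆
      ((Finset.univ.image fun i : Fin n => (i, i)) ∪
        Finset.univ.filter (fun p : Fin n × Fin n => p.1 ≠ p.2 ∧ B p.1 p.2 ≠ 0) :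
        Finset (Fin n × Fin n)) := by
    rintro ⟨i, j⟩ hp
    simp only [Finset.coe_union, Finset.coe_image, Finset.coe_univ, Set.image_univ,
      Finset.coe_filter, Finset.mem_univ, true_and, Set.mem_union, Set.mem_range, Prod.mk.injEq,
      Set.mem_ofPred_eq]
    by_cases hij : i = j
    · exact Or.inl ⟨i, rfl, hij⟩
    · exact Or.inr ⟨hij, h i j hij hp⟩
  refine (Set.ncard_le_ncard hs (Finset.finite_toSet _)).trans ?_
  rw [Set.ncard_coe_finset]
  refine (Finset.card_union_le _ _).trans ?_
  refine Nat.add_le_add (Finset.card_image_le.trans (by simp)) (le_of_eq ?_)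
  unfold offNnz
  congr!

theorem lowerBound_iterate {a : ℕ → Matrix (Fin n) (Fin n) ℝ} {d k : ℕ} (hd : 3 ≤ d)
    (ha : ∀ i, IsLevel (a i) ∧ IsSparsifier (1 - a i * a i) (1 - a (i + 1)) d k) {μ : ℝ}
    (hμ0 : 0 ≤ μ) (hμ : ∀ x, μ * (x ⬝ᵥ x) ≤ form (1 - a 0) x x) (i : ℕ) :
    ∀ x, min (1 / 2) ((9 / 8) ^ i * μ) * (x ⬝ᵥ x) ≤ form (1 - a i) x x := by
  induction i with
  | zero =>
    intro x
    rw [pow_zero, one_mul]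
    exact (mul_le_mul_of_nonneg_right (min_le_right _ _) (dotProduct_self_nonneg_real x)).trans (hμ x)
  | succ i ih =>
    intro x
    rw [pow_succ', mul_assoc]
    exact (ha i).1.lowerBound_min (ha i).2 hd (by positivity) ih x

theorem lowerBound_last {a : ℕ → Matrix (Fin n) (Fin n) ℝ} {d k : ℕ} (hd : 1 ≤ d)
    (ha : ∀ i, IsLevel (a i) ∧ IsSparsifier (1 - a i * a i) (1 - a (i + 1)) (6 * d) k)
    (hμ : ∀ x, (2 ^ d)⁻¹ * (x ⬝ᵥ x) ≤ form (1 - a 0) x x) (x : Fin n → ℝ) :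
    1 / 2 * (x ⬝ᵥ x) ≤ form (1 - a (6 * d)) x x := by
  have h := lowerBound_iterate (by omega) ha (by positivity) hμ (6 * d) x
  rw [min_eq_left] at h
  · exact h
  -- The number 6 of levels per factor 2 comes from (9/8)⁶ > 2.
  · have : (1 : ℝ) ≤ (9 / 8) ^ (6 * d) * (2 ^ d)⁻¹ := by
      rw [pow_mul, ← div_eq_mul_inv, ← div_pow]
      exact one_le_pow₀ (by norm_num)
    linarith

/-- All diagonal matrices are c·1, so the condition on consecutive ones is trivial and the others
reduce to the levels. -/
theorem isApproxInverseChain {M : Matrix (Fin n) (Fin n) ℝ} {a : ℕ → Matrix (Fin n) (Fin n) ℝ}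
    {d k : ℕ} (hd : 0 < d) {c : ℝ} (hc : 0 < c) (h0 : a 0 = 1 - c⁻¹ • M)
    (ha : ∀ i, IsLevel (a i) ∧ IsSparsifier (1 - a i * a i) (1 - a (i + 1)) d k)
    (hlast : ∀ x, 1 / 2 * (x ⬝ᵥ x) ≤ form (1 - a d) x x) :
    IsApproxInverseChain M (fun _ : Fin (d + 1) => c • (1 : Matrix (Fin n) (Fin n) ℝ))
      (fun i => c • a i) := by
  have hd0 : (0 : ℝ) < d := by exact_mod_cast hd
  have hsym : ∀ i, (a i).IsSymm := fun i => (ha i).1.posSemidef.isSymm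
  have hpsd : ∀ {X Y : Matrix (Fin n) (Fin n) ℝ}, X.IsSymm → Y.IsSymm → ∀ s t : ℝ,
      (∀ x, t * form Y x x ≤ s * form X x x) → (s • (c • X) - t • (c • Y)).PosSemidef := by
    intro X Y hX hY s t h
    rw [posSemidef_iff]
    refine ⟨((hX.smul _).smul _).sub ((hY.smul _).smul _), fun x => ?_⟩
    rw [form_sub, form_smul, form_smul, form_smul, form_smul]
    have := mul_le_mul_of_nonneg_left (h x) hc.le
    linarith
  have happ : ∀ {X Y : Matrix (Fin n) (Fin n) ℝ}, X.IsSymm → Y.IsSymm → ∀ ε : ℝ,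
      (∀ x, form Y x x ≤ Real.exp ε * form X x x) → (∀ x, Real.exp (-ε) * form X x x ≤ form Y x x) →
      SpectralApprox ε (c • X) (c • Y) := by
    intro X Y hX hY ε h1 h2
    have e1 := hpsd hX hY (Real.exp ε) 1 (fun x => by rw [one_mul]; exact h1 x)
    have e2 := hpsd hY hX 1 (Real.exp (-ε)) (fun x => by rw [one_mul]; exact h2 x)
    rw [one_smul] at e1 e2
    exact ⟨e1, e2⟩
  have hpos : ∀ i, (c • (1 : Matrix (Fin n) (Fin n) ℝ) - c • a i).PosDef := fun i => by
    rw [← smul_sub]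
    exact (ha i).1.posDef.smul hc
  refine ⟨?_, fun i => ?_, fun i j => ?_, fun i => (hsym _).smul c, fun i j k => ?_,
    fun i => hpos i, ?_⟩
  · simp only [Fin.val_zero, h0]
    rw [smul_sub, sub_sub_cancel, smul_smul, mul_inv_cancel₀ hc.ne', one_smul]
  · exact (isDiag_one).smul c
  · simp [hc.le]
  · exact mul_nonneg hc.le ((ha _).1.nonneg j k)
  have hexp1 : (1 : ℝ) ≤ Real.exp (1 / d) := Real.one_le_exp (by positivity)
  have hexp2 : Real.exp (-(1 / d)) ≤ (1 : ℝ) := Real.exp_le_one_iff.mpr (by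
    rw [Left.neg_nonpos_iff]; positivity)
  -- The d sparsifications contribute 1/d each and the last condition contributes 1, which adds up
  -- to the allowed 2.
  refine ⟨fun i => if i = Fin.last d then 1 else 1 / d, ?_, fun i => ?_, fun i => ?_, ?_⟩
  · rw [Fin.sum_univ_castSucc, if_pos rfl, Finset.sum_congr rfl (fun (i : Fin d) _ =>
      if_neg (Fin.castSucc_lt_last i).ne)]
    simp only [Finset.sum_const, Finset.card_univ, Fintype.card_fin, nsmul_eq_mul]
    rw [mul_one_div_cancel hd0.ne']; norm_num
  · beta_reduce
    rw [if_neg (Fin.castSucc_lt_last i).ne]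
    have e : c • (1 : Matrix (Fin n) (Fin n) ℝ) - c • a i.castSucc * (c • 1)⁻¹ * c • a i.castSucc =
        c • (1 - a i * a i) := by
      have : (c • (1 : Matrix (Fin n) (Fin n) ℝ))⁻¹ = c⁻¹ • 1 := by
        apply inv_eq_right_inv
        rw [smul_mul_smul_comm, mul_inv_cancel₀ hc.ne', one_smul, one_mul]
      rw [this, Fin.val_castSucc, smul_mul_smul_comm, mul_inv_cancel₀ hc.ne', one_smul, mul_one,
        mul_smul_comm, ← smul_sub]
    rw [e, ← smul_sub]
    obtain ⟨h1, h2⟩ := ha i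
    have hN := h2.posDef.posSemidef
    refine happ (isSymm_one.sub (hsym _)) h1.posDef_sq.isSymm _ (fun x => ?_) fun x => ?_
    · have h3 := h2.ge x
      have h4 : (d + 1 : ℝ) ≤ d * Real.exp (1 / d) := by
        have := mul_le_mul_of_nonneg_left (Real.add_one_le_exp (1 / d : ℝ)) hd0.le
        rw [mul_add, mul_one_div_cancel hd0.ne'] at this
        linarith
      have h5 := h3.trans (mul_le_mul_of_nonneg_right h4 (hN.form_nonneg x))
      rw [mul_assoc] at h5
      exact le_of_mul_le_mul_left h5 hd0
    · exact (mul_le_of_le_one_left (hN.form_nonneg x) hexp2).trans (h2.le x)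
  · beta_reduce
    rw [if_neg (Fin.castSucc_lt_last i).ne]
    refine happ isSymm_one isSymm_one _ (fun x => ?_) fun x => ?_
    · exact le_mul_of_one_le_left (by rw [form_one]; exact dotProduct_self_nonneg_real x) hexp1
    · exact mul_le_of_le_one_left (by rw [form_one]; exact dotProduct_self_nonneg_real x) hexp2
  · beta_reduce
    rw [if_pos rfl, ← smul_sub]
    refine happ isSymm_one (isSymm_one.sub (hsym _)) _ (fun x => ?_) fun x => ?_
    · have h1 := (ha (Fin.last d)).1.posSemidef.form_nonneg x
      rw [form_sub, form_one]
      have h2 := le_mul_of_one_le_left (dotProduct_self_nonneg_real x) (Real.one_le_exp zero_le_one)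
      linarith
    · rw [form_one]
      -- Here e⁻¹ ≤ 1/2 is compared with the lower bound 1/2 on the last level.
      refine le_trans (mul_le_mul_of_nonneg_right ?_ (dotProduct_self_nonneg_real x)) (hlast x)
      rw [Real.exp_neg, one_div]
      exact inv_anti₀ (by norm_num) (by have := Real.add_one_le_exp (1 : ℝ); linarith)

end RealMatrix

/-! ### The construction of the chain -/

namespace RealMatrix

open Matrix

variable {n : ℕ}

/-- The smallest bound `2 ^ d` that the trace method certifies for the inverse of `c⁻¹ • M`. -/
theorem exists_certified_bound (hn : 2 ≤ n) {M : Matrix (Fin n) (Fin n) ℝ} {κ c : ℝ}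
    (hM : M.PosDef) (hκ : 2 ≤ κ) (hcond : condNumber M ≤ κ) (hc : 0 < c)
    (hcM : ∃ i, c = M i i + M i i) :
    ∃ d : ℕ, 1 ≤ d ∧ ((c⁻¹ • M)⁻¹ ^ 2 ^ n).trace ≤ ((2 : ℝ) ^ 2 ^ n) ^ d ∧
      (∀ k, 1 ≤ k → k < d → ((2 : ℝ) ^ 2 ^ n) ^ k < ((c⁻¹ • M)⁻¹ ^ 2 ^ n).trace) ∧
      (d : ℝ) ≤ 8 * Real.log κ := by
  set N := c⁻¹ • M with hN
  set T := (N⁻¹ ^ 2 ^ n).trace with hT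
  have hci : 0 < c⁻¹ := inv_pos.mpr hc
  have hNp : N.PosDef := hM.smul hci
  obtain ⟨l, u, hl, hu, hlM, huM⟩ := exists_bounds_of_condNumber_le (by omega) hM hcond
  have hB : (1 : ℝ) < 2 ^ 2 ^ n := one_lt_pow₀ (by norm_num) (by positivity)
  -- Since c is twice a diagonal entry of M, c ≤ 2u ≤ 2κl, so c⁻¹M is at least 1/(2κ).
  have hQ : ∀ x, form N⁻¹ x x ≤ (2 * κ) * (x ⬝ᵥ x) := by
    obtain ⟨i, hi⟩ := hcM
    have h1 : c ≤ 2 * κ * l := by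
      have := huM (Pi.single i 1)
      rw [form_single] at this
      simp at this
      linarith
    have h2 : ∀ x, form 1 x x ≤ (2 * κ) * form N x x := fun x => by
      rw [form_one, hN, form_smul, ← mul_assoc, mul_comm (2 * κ), mul_assoc, inv_mul_eq_div,
        le_div_iff₀ hc]
      have h3 := hlM x
      have h4 := mul_le_mul_of_nonneg_left h1 (dotProduct_self_nonneg_real x)
      have h5 := mul_le_mul_of_nonneg_left h3 (show (0 : ℝ) ≤ 2 * κ by linarith)
      linarith
    intro x
    have := form_inv_le PosDef.one hNp h2 x
    rwa [inv_one, form_one] at this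
  have hTle : T ≤ (4 * κ) ^ 2 ^ n := by
    have h1 := trace_pow_le hNp.inv.posSemidef (by linarith) hQ n
    rw [Fintype.card_fin] at h1
    refine h1.trans ?_
    have h2 : (n : ℝ) ≤ 2 ^ 2 ^ n := by
      have := (Nat.lt_two_pow_self (n := n)).le.trans (Nat.lt_two_pow_self (n := 2 ^ n)).le
      exact_mod_cast this
    calc (n : ℝ) * (2 * κ) ^ 2 ^ n ≤ 2 ^ 2 ^ n * (2 * κ) ^ 2 ^ n :=
          mul_le_mul_of_nonneg_right h2 (by positivity)
      _ = (4 * κ) ^ 2 ^ n := by rw [← mul_pow]; congr 1; ring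
  -- The exponent k + 1 keeps d positive, in accordance with the loop of the program, which starts
  -- at the first power.
  have hex : ∃ k : ℕ, T ≤ ((2 : ℝ) ^ 2 ^ n) ^ (k + 1) := by
    obtain ⟨k, hk⟩ := pow_unbounded_of_one_lt T hB
    exact ⟨k, hk.le.trans (pow_le_pow_right₀ hB.le (Nat.le_succ k))⟩
  classical
  have hlt : ∀ k, 1 ≤ k → k < Nat.find hex + 1 → ((2 : ℝ) ^ 2 ^ n) ^ k < T := fun k h1 h2 => by
    obtain ⟨k, rfl⟩ : ∃ j, k = j + 1 := ⟨k - 1, by omega⟩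
    exact not_le.mp (Nat.find_min hex (by omega))
  refine ⟨Nat.find hex + 1, by omega, Nat.find_spec hex, hlt, ?_⟩
  have hlog2 : 1 / 2 < Real.log 2 := by have := Real.log_two_gt_d9; linarith
  have hlogκ : Real.log 2 ≤ Real.log κ := Real.log_le_log (by norm_num) hκ
  rcases Nat.eq_zero_or_pos (Nat.find hex) with h0 | h0
  · rw [h0]; push_cast; linarith
  -- The exponent d - 1 was rejected, so after taking 2^n-th roots 2^(d - 1) < 4κ.
  · have h1 := (hlt _ h0 (by omega)).trans_le hTle
    rw [← pow_mul, mul_comm (2 ^ n), pow_mul] at h1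
    have h2 : (2 : ℝ) ^ Nat.find hex < 4 * κ := lt_of_pow_lt_pow_left₀ _ (by positivity) h1
    have h3 := Real.log_lt_log (by positivity) h2
    rw [Real.log_pow, Real.log_mul (by norm_num) (by positivity),
      show (4 : ℝ) = 2 ^ 2 by norm_num, Real.log_pow] at h3
    push_cast at h3 ⊢
    have h4 : (Nat.find hex : ℝ) * (1 / 2) ≤ Nat.find hex * Real.log 2 :=
      mul_le_mul_of_nonneg_left hlog2.le (Nat.cast_nonneg _)
    have h5 : (1 : ℝ) ≤ Nat.find hex := by exact_mod_cast h0
    linarith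

theorem lowerBound_of_trace_le {N : Matrix (Fin n) (Fin n) ℝ} (hN : N.PosDef) {d : ℕ}
    (h : (N⁻¹ ^ 2 ^ n).trace ≤ ((2 : ℝ) ^ 2 ^ n) ^ d) (x : Fin n → ℝ) :
    (2 ^ d)⁻¹ * (x ⬝ᵥ x) ≤ form N x x := by
  rw [← pow_mul, mul_comm (2 ^ n), pow_mul] at h
  have h1 := form_le_of_trace_pow hN.inv.posSemidef (by positivity) n h
  have h2 := form_inv_le hN.inv PosDef.one (c := 2 ^ d) (fun x => by rw [form_one]; exact h1 x) x
  rw [inv_one, form_one, nonsing_inv_nonsing_inv _ ((isUnit_iff_isUnit_det N).mp hN.isUnit)] at h2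
  rwa [inv_mul_le_iff₀ (by positivity)]

end RealMatrix

/-! ### The certificate and the construction of the chain as programs. -/

namespace WorkDepth

open RealMatrix

set_option synthInstance.maxHeartbeats 200000
set_option synthInstance.maxSize 2000

variable {n : ℕ}

/-- The state of the trace method. -/
abbrev Ty.cert : Ty := .prod (.prod .real .real) (.prod .real .nat)

/-- The data of the trace method: `((M, c), ((T, B), (B, 1)))`. -/
def certP : Prog (.prod .sparse .nat)
    (.prod (.prod .mat .real) .cert) :=
  letP denseP (letP (call maxDiagP v0 v1) (letP (v0 + v0)
    (letP (call invP (call combP (.pair (.pair (oneR / v0) v2) (.pair zeroR v2)) v3) v3)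
      (letP (call traceP (forP v4 v0 (call mulP (.pair v0 v0) (lift v5))) v4)
        (letP (forP v5 (toR (lit 2)) (v0 * v0))
          (.pair (.pair v5 v3) (.pair (.pair v1 v0) (.pair v0 (lit 1)))))))))

instance : PolyTime size certP := by
  unfold certP
  infer_instance

/-- Each of the two 2^n-th powers takes n squarings. The positive diagonal excludes the value 0 that
the maximum starts from. -/
theorem den_certP {M : Matrix (Fin n) (Fin n) ℝ} (hM : IsSDDM M) (hn : 0 < n) :
    ∃ c : ℝ, 0 < c ∧ (∀ i, 2 * M i i ≤ c) ∧ (∃ i, c = M i i + M i i) ∧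
      den certP (encodeSparse M, n) =
        ((encMat M, c), ((((c⁻¹ • M)⁻¹ ^ 2 ^ n).trace, 2 ^ 2 ^ n), (2 ^ 2 ^ n, (1 : ℕ)))) := by
  obtain ⟨m, h1, h2, h3, h4⟩ := den_maxDiagP M
  have hd : 0 < M ⟨0, hn⟩ ⟨0, hn⟩ := hM.posDef.diag_pos
  have hm : 0 < m := hd.trans_le (h3 _)
  refine ⟨m + m, by linarith, fun i => by linarith [h3 i], ?_, ?_⟩
  · rcases h4 with h4 | ⟨i, hi⟩
    · exact absurd h4 hm.ne'
    · exact ⟨i, by rw [hi]⟩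
  have e : (1 / (m + m)) • M + (0 : ℝ) • M = (m + m)⁻¹ • M := by
    rw [zero_smul, add_zero, one_div]
  have hp : ((m + m)⁻¹ • M).PosDef := hM.posDef.smul (by positivity)
  have hpow : ∀ k, passes (fun _ s => den mulP ((s, s), n)) (encMat ((m + m)⁻¹ • M)⁻¹) k =
      encMat (((m + m)⁻¹ • M)⁻¹ ^ 2 ^ k) := fun k => by
    induction k with
    | zero => simp [passes]
    | succ k ih => rw [passes, ih, den_mulP, pow_succ 2 k, pow_mul, sq]
  have hpow2 : ∀ k, passes (fun _ s => @HMul.hMul ℝ ℝ ℝ _ s s) 2 k = 2 ^ 2 ^ k := fun k => by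
    induction k with
    | zero => simp [passes]
    | succ k ih => rw [passes, ih, pow_succ 2 k, pow_mul, sq]
  simp only [certP, den_letP, den_call, den_v0, den_lift, den_addR, den_pair, den_divR, den_oneR,
    den_zeroR, den_forP, den_mulR, den_toR, den_lit]
  rw [den_denseP, h1, den_combP, e, den_invP hp, hpow, den_traceP, Nat.cast_ofNat, hpow2]

/-- The loop that finds the length of the chain. -/
def certLoopP : Prog .cert
    .cert :=
  .loop (ltR (fstP v0) (fstP (.prim .fst)))
    (.pair (.prim .fst) (.pair (fstP v0 * sndP (.prim .fst)) (sndP v0 + lit 1)))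

/-- The number of passes depends on the real data and not on the size of the input, so this loop is
outside `PolyTime` and is costed directly. -/
theorem certLoopP_spec {T B : ℝ} {d : ℕ} (hd : 1 ≤ d) (h1 : T ≤ B ^ d)
    (h2 : ∀ k, 1 ≤ k → k < d → B ^ k < T) :
    den certLoopP ((T, B), (B, (1 : ℕ))) = ((T, B), (B ^ d, d)) ∧
      ∃ t, Cost certLoopP ((T, B), (B, (1 : ℕ))) (200 * (d + 1)) t := by
  set f : Prog .cert
    .cert :=
    .pair (.prim .fst) (.pair (fstP v0 * sndP (.prim .fst)) (sndP v0 + lit 1)) with hf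
  set c : Prog .cert .bool :=
    ltR (fstP v0) (fstP (.prim .fst)) with hc
  have hit : ∀ k : ℕ, (den f)^[k] ((T, B), (B, (1 : ℕ))) = ((T, B), (B ^ (k + 1), k + 1)) := by
    intro k
    induction k with
    | zero => simp
    | succ k ih =>
      rw [Function.iterate_succ_apply', ih, hf]
      simp only [den_pair, den_fst, den_mulR, den_fstP, den_v0, den_sndP, den_addN, den_lit]
      rw [← pow_succ]
  have hcond : ∀ k : ℕ, den c ((T, B), (B ^ (k + 1), k + 1)) = decide (B ^ (k + 1) < T) :=
    fun k => rfl
  have hk : ∀ i < d - 1, den c ((den f)^[i] ((T, B), (B, (1 : ℕ)))) = true := fun i hi => by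
    rw [hit, hcond]; exact decide_eq_true (h2 _ (by omega) (by omega))
  have hs : den c ((den f)^[d - 1] ((T, B), (B, (1 : ℕ)))) = false := by
    rw [hit, hcond, Nat.sub_add_cancel hd]; exact decide_eq_false (not_lt.mpr h1)
  constructor
  · rw [certLoopP, den_loop, ← hf, ← hc, stopTime_eq hk hs, hit, Nat.sub_add_cancel hd]
  · refine ⟨_, (Cost.loop (W := fun _ => 50) (T := fun _ => 50) (Wc := 50) (Tc := 50) hk hs
      (fun i _ => ?_) (fun i _ => ?_)).mono ?_ le_rfl⟩
    · exact (Cost.ltR Cost.v0.fstP Cost.prim.fstP).mono (by norm_num) (by norm_num)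
    · exact (Cost.prim.pair ((Cost.v0.fstP.mulR Cost.prim.sndP).pair
        (Cost.v0.sndP.addN Cost.lit))).mono (by norm_num) (by norm_num)
    · rw [Finset.sum_const, Finset.card_range, smul_eq_mul]
      omega

/-- The chain, from the data of the trace method. -/
def certChainP : Prog (.prod (.prod .sparse .nat) (.prod (.prod .mat .real) .cert)) .chain :=
  letP (.comp (sndP v0) certLoopP) (call₂ chainP (fstP v1) v2 (sndP (sndP v0) + sndP (sndP v0) +
    sndP (sndP v0) + sndP (sndP v0) + sndP (sndP v0) + sndP (sndP v0)))

/-- The construction of the chain. -/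
def buildP : Prog .sparse .chain :=
  .comp (.pair (.prim .id) (.prim .length)) (letP certP certChainP)

/-- The length 6d is a computed value. The two parts polynomial in given sizes, before and after its
computation, are therefore joined by the rules for `Cost`, with the value of d supplied by the
semantics. -/
theorem buildP_spec : ∃ K k : ℕ, ∀ (n : ℕ) (M : Matrix (Fin n) (Fin n) ℝ) (κ : ℝ),
    2 ≤ n → IsSDDM M → 2 ≤ κ → condNumber M ≤ κ →
    ∃ (d : ℕ) (c : ℝ) (a : ℕ → Matrix (Fin n) (Fin n) ℝ),
      1 ≤ d ∧ (d : ℝ) ≤ 8 * Real.log κ ∧ 0 < c ∧ a 0 = 1 - c⁻¹ • M ∧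
      (∀ i, IsLevel (a i) ∧ IsSparsifier (1 - a i * a i) (1 - a (i + 1)) (6 * d)
        (2 * (n * ((4 * (6 * d) + 2) * (4 * (6 * d) + 2))))) ∧
      (∀ x, 1 / 2 * (x ⬝ᵥ x) ≤ form (1 - a (6 * d)) x x) ∧
      den buildP (encodeSparse M) = encodeChain
        (fun _ : Fin (6 * d + 1) => c • (1 : Matrix (Fin n) (Fin n) ℝ)) (fun i => c • a i) ∧
      ∃ t, Cost buildP (encodeSparse M) (K * (n + d + 1) ^ k) t := by
  obtain ⟨K₁, k₁, hK₁⟩ := (inferInstance : PolyTime size certP).bdd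
  obtain ⟨K₂, k₂, hK₂⟩ := (inferInstance : PolyTime size₂ chainP).bdd
  refine ⟨K₁ + 500 + K₂ * 6 ^ k₂, k₁ + k₂ + 1, fun n M κ hn hM hκ hcond => ?_⟩
  have : Nonempty (Fin n) := ⟨⟨0, by omega⟩⟩
  obtain ⟨c, hc, hc1, hc2, hden⟩ := den_certP hM (by omega)
  obtain ⟨d, hd, hT, hTlt, hdκ⟩ := exists_certified_bound hn hM.posDef hκ hcond hc hc2
  obtain ⟨hl1, tl, hl2⟩ := certLoopP_spec hd hT hTlt
  have hlev := isLevel_of_isSDDM hM hc hc1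
  obtain ⟨a, h0, h1, h2⟩ := den_chainP hlev (d := 6 * d) (by omega)
  have hlow := lowerBound_of_trace_le (hM.posDef.smul (inv_pos.mpr hc)) hT
  have e6 : d + d + d + d + d + d = 6 * d := by ring
  have hlen : @List.length (List (ℕ × ℝ)) (encodeSparse M) = n := by simp [encodeSparse]
  refine ⟨d, c, a, hd, hdκ, hc, h0, h2, lowerBound_last hd h2 (by
    rw [h0, sub_sub_cancel]; exact hlow), ?_, ?_⟩
  · rw [← h1, ← e6]
    have : den (.prim .length) (encodeSparse M) = n := hlen
    simp only [buildP, certChainP, den_comp, den_pair, den_id, this, den_letP, hden, den_sndP, den_v0, hl1,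
      den_call₂, den_fstP, den_lift, den_addN]
  · have c1 : Cost certP (encodeSparse M, n) (K₁ * (n + 1) ^ k₁) (depth certP (encodeSparse M, n)) :=
      ((inferInstance : PolyTime size certP).cost _).mono (hK₁ _) le_rfl
    have c2 : Cost chainP (((encMat M, c), n), 6 * d) (K₂ * (n + 6 * d + 1) ^ k₂)
        (depth chainP (((encMat M, c), n), 6 * d)) :=
      ((inferInstance : PolyTime size₂ chainP).cost _).mono (hK₂ _) le_rfl
    set y := ((encMat M, c), ((((c⁻¹ • M)⁻¹ ^ 2 ^ n).trace, (2 : ℝ) ^ 2 ^ n),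
      ((2 : ℝ) ^ 2 ^ n, (1 : ℕ)))) with hy
    have hden' : den (.pair (.prim .id) (.prim .length)) (encodeSparse M) = (encodeSparse M, n) :=
      Prod.ext rfl hlen
    have c3 : Cost certChainP ((encodeSparse M, n), y) _ _ :=
      Cost.letP (Cost.v0.sndP.comp hl2) ((((Cost.v0.lift.fstP.pair Cost.v0.lift.lift).pair
        (((((Cost.v0.sndP.sndP.addN Cost.v0.sndP.sndP).addN Cost.v0.sndP.sndP).addN
          Cost.v0.sndP.sndP).addN Cost.v0.sndP.sndP).addN Cost.v0.sndP.sndP)).comp (g := chainP) (by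
          simp only [den_pair, den_fstP, den_lift, den_v0, den_sndP, den_addN, den_comp, hy, hl1, e6]
          exact c2)))
    refine ⟨_, ((Cost.prim.pair Cost.prim).comp (g := letP certP certChainP) (Cost.letP (by
      rw [hden']; exact c1) (by rw [hden', hden]; exact c3))).mono ?_ le_rfl⟩
    have e1 : (n + 1) ^ k₁ ≤ (n + d + 1) ^ (k₁ + k₂ + 1) :=
      (Nat.pow_le_pow_left (by omega) _).trans (Nat.pow_le_pow_right (by omega) (by omega))
    have e2 : (n + 6 * d + 1) ^ k₂ ≤ 6 ^ k₂ * (n + d + 1) ^ (k₁ + k₂ + 1) := by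
      calc (n + 6 * d + 1) ^ k₂ ≤ (6 * (n + d + 1)) ^ k₂ := Nat.pow_le_pow_left (by omega) _
        _ = 6 ^ k₂ * (n + d + 1) ^ k₂ := mul_pow _ _ _
        _ ≤ _ := Nat.mul_le_mul_left _ (Nat.pow_le_pow_right (by omega) (by omega))
    have e3 : n + d + 1 ≤ (n + d + 1) ^ (k₁ + k₂ + 1) := Nat.le_self_pow (by omega) _
    have e4 := Nat.mul_le_mul_left K₁ e1
    have e5 := Nat.mul_le_mul_left K₂ e2
    rw [← mul_assoc] at e5
    rw [add_mul, add_mul]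
    omega

end WorkDepth

/-! ### Parallel sums and sparse matrix-vector products -/

namespace WorkDepth

variable {Γ a : Ty} {n : ℕ}

/-! ### Unfolding of a loop. -/

section loop

variable {c : Prog a .bool} {f : Prog a a} {x : a.Val} {W T W' T' W'' T'' : ℕ}

theorem Cost.loop_stop (h : den c x = false) (hc : Cost c x W T) :
    den (.loop c f) x = x ∧ Cost (.loop c f) x (W + 1) (T + 1) := by
  have hs : stopTime (den c) (den f) x = 0 := stopTime_eq (fun i hi => absurd hi (by omega)) h
  refine ⟨by rw [den_loop, hs]; rfl, ?_⟩
  have := Cost.loop (c := c) (f := f) (x := x) (k := 0) (W := fun _ => 0) (T := fun _ => 0)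
    (fun i hi => absurd hi (by omega)) h (Wc := W) (Tc := T)
    (fun i hi => by obtain rfl : i = 0 := by omega
                    exact hc) (fun i hi => absurd hi (by omega))
  simpa using this

/-- Together with `Cost.loop_stop` this permits induction on a quantity that decreases along a loop,
without a formula for its iterates. -/
theorem Cost.loop_step (h : den c x = true) (hc : Cost c x W T) (hf : Cost f x W' T')
    (hl : Cost (.loop c f) (den f x) W'' T'') :
    den (.loop c f) x = den (.loop c f) (den f x) ∧
      Cost (.loop c f) x (W + W' + 1 + W'') (T + T' + 1 + T'') := by
  obtain ⟨⟨hk, h1, h2⟩, hw, ht⟩ := hl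
  set k := stopTime (den c) (den f) (den f x) with hkdef
  have hs : stopTime (den c) (den f) x = k + 1 := by
    refine stopTime_eq (fun i hi => ?_) ?_
    · rcases i with _ | i
      · exact h
      · change den c ((den f)^[i] (den f x)) = true
        exact stopTime_lt (show i < k by omega)
    · exact stopTime_spec hk
  refine ⟨by rw [den_loop, hs]; rfl, ⟨⟨k + 1, stopTime_spec hk⟩, ?_, ?_⟩, ?_, ?_⟩
  · rw [hs]
    intro i hi
    rcases i with _ | i
    · exact ⟨hc.1, hf.1⟩
    · exact h1 i (by omega)
  · rw [hs]; exact h2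
  · simp only [work] at hw ⊢
    rw [← hkdef] at hw
    rw [hs, Finset.sum_range_succ']
    have := hc.2.1; have := hf.2.1
    simp only [Function.iterate_succ, Function.comp, Function.iterate_zero, id_eq]
    omega
  · simp only [depth] at ht ⊢
    rw [← hkdef] at ht
    rw [hs, Finset.sum_range_succ']
    have := hc.2.2; have := hf.2.2
    simp only [Function.iterate_succ, Function.comp, Function.iterate_zero, id_eq]
    omega

end loop

/-- The sums of pairs of consecutive entries. -/
def pairSumsP : Prog .vec .vec :=
  tab (half (len (.prim .id) + lit 1))
    (get (.prim .fst) (v0 + v0) + get (.prim .fst) (v0 + v0 + lit 1))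

/-- The condition that a vector has at least two entries. -/
def longP : Prog .vec .bool := ltN (lit 1) (len (.prim .id))

theorem den_longP (l : List ℝ) : den longP l = decide (1 < l.length) := rfl

theorem cost_longP (l : List ℝ) : Cost longP l 5 5 := Cost.lit.ltN Cost.prim.len

/-- The sum of a vector, along a binary tree. -/
def treeSumP : Prog .vec .real :=
  .comp (.loop longP pairSumsP) (get (.prim .id) (lit 0))

theorem sum_tabList (m : ℕ) (f : ℕ → ℝ) : (tabList m f).sum = ∑ i ∈ Finset.range m, f i := by
  rw [tabList, List.sum_ofFn, Fin.sum_univ_eq_sum_range]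

theorem sum_range_pairs (f : ℕ → ℝ) (m : ℕ) :
    ∑ i ∈ Finset.range m, (f (i + i) + f (i + i + 1)) = ∑ i ∈ Finset.range (2 * m), f i := by
  induction m with
  | zero => simp
  | succ m ih =>
    rw [Finset.sum_range_succ, ih, show 2 * (m + 1) = 2 * m + 1 + 1 by ring,
      Finset.sum_range_succ, Finset.sum_range_succ, ← two_mul, add_assoc]

theorem den_pairSumsP (l : List ℝ) : den pairSumsP l =
    tabList ((l.length + 1) / 2) fun i => l.getD (i + i) 0 + l.getD (i + i + 1) 0 := rfl

/-- For odd length the missing partner of the last entry reads as 0. -/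
theorem sum_pairSums (l : List ℝ) : (tabList ((l.length + 1) / 2) fun i =>
    l.getD (i + i) 0 + l.getD (i + i + 1) 0).sum = l.sum := by
  rw [sum_tabList, sum_range_pairs (fun i => l.getD i 0)]
  have := sum_getD l (0 : ℝ) id rfl (2 * ((l.length + 1) / 2)) (by omega)
  simpa using this

theorem cost_pairSumsP (l : List ℝ) :
    Cost pairSumsP l (50 * ((l.length + 1) / 2) + 50) 100 := by
  have h : Cost pairSumsP l (1 + _ + 1 + (∑ _i ∈ Finset.range ((l.length + 1) / 2), 50 + 1)) _ :=
    Cost.tab (Cost.prim.len.addN Cost.lit).half (Wf := fun _ => 50) (Tf := 50)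
    fun i _ => ((Cost.prim.get (Cost.v0.addN Cost.v0)).addR
      (Cost.prim.get ((Cost.v0.addN Cost.v0).addN Cost.lit))).mono (by omega) (by omega)
  rw [Finset.sum_const, Finset.card_range, smul_eq_mul] at h
  exact h.mono (by omega) (by omega)

/-- The length l drops to ⌈l/2⌉ in each pass, in constant depth and linear work. The work is
geometric and therefore linear; the depth follows the recursion of `Nat.clog`. -/
theorem treeLoop_spec (m : ℕ) : ∀ l : List ℝ, l.length ≤ m →
    (den (.loop longP pairSumsP) l : List ℝ).getD 0 0 = l.sum ∧
    Cost (.loop longP pairSumsP) l (400 * l.length + 20)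
      (200 * Nat.clog 2 l.length + 20) := by
  induction m with
  | zero =>
    intro l hl
    obtain rfl : l = [] := List.length_eq_zero_iff.mp (by omega)
    obtain ⟨h1, h2⟩ := Cost.loop_stop (f := pairSumsP) (den_longP []) (cost_longP [])
    rw [h1]
    exact ⟨by simp, h2.mono (by simp) (by simp)⟩
  | succ m ih =>
    intro l hl
    by_cases h : 1 < l.length
    · have hd : den pairSumsP l = _ := den_pairSumsP l
      obtain ⟨h1, h2⟩ := ih (den pairSumsP l) (by rw [den_pairSumsP, length_tabList]; omega)
      obtain ⟨h3, h4⟩ := Cost.loop_step ((den_longP l).trans (decide_eq_true h)) (cost_longP l)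
        (cost_pairSumsP l) h2
      rw [h3, h1]
      refine ⟨by rw [den_pairSumsP, sum_pairSums], h4.mono ?_ ?_⟩
      · rw [den_pairSumsP, length_tabList]; omega
      · rw [den_pairSumsP, length_tabList, Nat.clog_of_two_le one_lt_two h,
          show l.length + 2 - 1 = l.length + 1 by omega]
        omega
    · obtain ⟨h1, h2⟩ := Cost.loop_stop (f := pairSumsP) ((den_longP l).trans (decide_eq_false h))
        (cost_longP l)
      rw [h1]
      refine ⟨?_, h2.mono (by omega) (by omega)⟩
      rcases l with _ | ⟨a, _ | ⟨b, l⟩⟩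
      · rfl
      · simp
      · simp at h

@[simp] theorem den_treeSumP (l : List ℝ) : den treeSumP l = l.sum :=
  (treeLoop_spec _ l le_rfl).1

theorem cost_treeSumP (l : List ℝ) :
    Cost treeSumP l (400 * l.length + 40) (200 * Nat.clog 2 l.length + 40) :=
  ((treeLoop_spec _ l le_rfl).2.comp (Cost.prim.get Cost.lit)).mono (by omega) (by omega)

/-- The product of a sparse matrix and a vector. -/
def matVecP : Prog (.prod .sparse .vec) .vec :=
  tab (len (.prim .fst)) (.comp (tab (len (get (fstP (.prim .fst)) v0))
    (sndP (get (get (fstP (lift (.prim .fst))) v1) v0) *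
      get (sndP (lift (.prim .fst))) (fstP (get (get (fstP (lift (.prim .fst))) v1) v0)))) treeSumP)

/-- The nonzero entries of a row. -/
noncomputable def sparseRow (A : Matrix (Fin n) (Fin n) ℝ) (i : Fin n) : List (ℕ × ℝ) :=
  List.map (fun j : Fin n => ((j : ℕ), A i j))
    (List.filter (fun j : Fin n => decide (A i j ≠ 0)) (List.finRange n))

theorem sum_length_sparseRow (A : Matrix (Fin n) (Fin n) ℝ) :
    ∑ i, (sparseRow A i).length = nnz A := by
  classical
  have h1 : ∀ i, (sparseRow A i).length = (Finset.univ.filter fun j => A i j ≠ 0).card := fun i => by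
    rw [sparseRow, List.length_map, ← List.toFinset_card_of_nodup
      ((List.nodup_finRange n).filter _), List.toFinset_filter]
    congr 1
    ext j
    simp
  have h2 : {p : Fin n × Fin n | A p.1 p.2 ≠ 0} =
      ((Finset.univ.filter fun p : Fin n × Fin n => A p.1 p.2 ≠ 0 : Finset _) : Set _) := by simp
  rw [nnz, h2, Set.ncard_coe_finset, Finset.sum_congr rfl fun i _ => h1 i]
  simp only [Finset.card_filter]
  rw [← Finset.univ_product_univ, Finset.sum_product]

theorem getD_encodeSparse_eq_sparseRow (A : Matrix (Fin n) (Fin n) ℝ) (i : Fin n) (d) :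
    @List.getD (List (ℕ × ℝ)) (encodeSparse A) i d = sparseRow A i := getD_ofFn _ _ _

theorem getD_encodeVec (x : Fin n → ℝ) (i : Fin n) (d) :
    @List.getD ℝ (encodeVec x) i d = x i := getD_ofFn _ _ _

theorem den_matVecP (A : Matrix (Fin n) (Fin n) ℝ) (x : Fin n → ℝ) :
    den matVecP (encodeSparse A, encodeVec x) = encodeVec (A.mulVec x) := by
  have hl : @List.length (List (ℕ × ℝ)) (encodeSparse A) = n := by simp [encodeSparse]
  simp only [matVecP, den_tab, den_comp, den_len, den_fst, den_fstP, den_sndP, den_get, den_lift,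
    den_v0, den_mulR, hl]
  rw [tabList, encodeVec]
  congr 1
  funext i
  rw [getD_encodeSparse_eq_sparseRow, den_treeSumP, sum_tabList]
  have h := sum_getD (sparseRow A i) (0, 0) (fun p => p.2 * (encodeVec x).getD p.1 0) (by simp) _
    le_rfl
  refine h.trans ?_
  rw [sparseRow, List.map_map, sum_filter_finRange]
  · simp only [Function.comp, getD_encodeVec]
    rfl
  · intro j hj
    simp at hj
    simp [hj]

/-- The rows are processed in parallel, each along a tree. The work adds up the row lengths and a
constant per row; the depth is governed by the longest row, of length at most n. -/
theorem cost_matVecP (A : Matrix (Fin n) (Fin n) ℝ) (x : Fin n → ℝ) :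
    Cost matVecP (encodeSparse A, encodeVec x) (500 * (nnz A + n) + 100)
      (200 * Nat.clog 2 n + 200) := by
  have hl : @List.length (List (ℕ × ℝ)) (encodeSparse A) = n := by simp [encodeSparse]
  have h := Cost.tab (x := (encodeSparse A, encodeVec x)) (n := len (.prim .fst))
    (f := .comp (tab (len (get (fstP (.prim .fst)) v0))
      (sndP (get (get (fstP (lift (.prim .fst))) v1) v0) *
        get (sndP (lift (.prim .fst))) (fstP (get (get (fstP (lift (.prim .fst))) v1) v0)))) treeSumP)
    Cost.prim.len (Wf := fun i => 450 * (if h : i < n then (sparseRow A ⟨i, h⟩).length else 0) + 80)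
    (Tf := 200 * Nat.clog 2 n + 120) fun i hi => by
      have hi' : i < n := by rw [den_len, den_fst, hl] at hi; exact hi
      have hd : den (len (get (fstP (.prim .fst)) v0)) ((encodeSparse A, encodeVec x), i) =
          (sparseRow A ⟨i, hi'⟩).length := by
        simp only [den_len, den_get, den_fstP, den_fst, den_v0]
        rw [getD_encodeSparse_eq_sparseRow A ⟨i, hi'⟩]
      have h1 := Cost.tab (x := ((encodeSparse A, encodeVec x), i))
        (n := len (get (fstP (.prim .fst)) v0))
        (f := sndP (get (get (fstP (lift (.prim .fst))) v1) v0) *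
          get (sndP (lift (.prim .fst))) (fstP (get (get (fstP (lift (.prim .fst))) v1) v0)))
        (Cost.prim.fstP.get Cost.v0).len (Wf := fun _ => 50) (Tf := 50) fun k _ =>
          (Cost.mulR ((Cost.prim.lift.fstP.get Cost.v0.lift).get Cost.v0).sndP
          (Cost.prim.lift.sndP.get ((Cost.prim.lift.fstP.get Cost.v0.lift).get Cost.v0).fstP)).mono
            (by omega) (by omega)
      rw [Finset.sum_const, Finset.card_range, smul_eq_mul, hd] at h1
      have h2 := h1.comp (cost_treeSumP _)
      rw [den_tab, length_tabList, hd] at h2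
      have h3 : (sparseRow A ⟨i, hi'⟩).length ≤ n := length_row_le A ⟨i, hi'⟩
      have h4 := Nat.clog_mono_right 2 h3
      rw [dif_pos hi']
      exact h2.mono (by omega) (by omega)
  rw [Finset.sum_add_distrib, ← Finset.mul_sum, Finset.sum_const, Finset.card_range, smul_eq_mul,
    den_len, den_fst, hl, Finset.sum_range] at h
  simp only [Fin.is_lt, dite_true, Fin.eta] at h
  rw [sum_length_sparseRow] at h
  exact h.mono (by omega) (by omega)

end WorkDepth

/-! ### Programs for the preconditioner -/

namespace WorkDepth

open RealMatrix Matrix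

variable {n : ℕ}

theorem length_encodeVec (x : Fin n → ℝ) : @List.length ℝ (encodeVec x) = n := by simp [encodeVec]

theorem tabList_eq_encodeVec {F : ℕ → ℝ} {x : Fin n → ℝ} (h : ∀ i : Fin n, F i = x i) :
    tabList n F = encodeVec x := by
  unfold tabList encodeVec
  simp_rw [h]

/-- The vector `x + c⁻¹ A x`, from `((A, x), c)`. -/
def smoothP : Prog (.prod (.prod .sparse .vec) .real) .vec :=
  letP (.comp (.prim .fst) matVecP)
    (tab (len v0) (get (lift (lift (sndP (.prim .fst)))) v0 + get v1 v0 / v2))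

theorem den_smoothP {a : Matrix (Fin n) (Fin n) ℝ} {c : ℝ} (hc : c ≠ 0) (x : Fin n → ℝ) :
    den smoothP ((encodeSparse (c • a), encodeVec x), c) = encodeVec (x + a *ᵥ x) := by
  simp only [smoothP, den_letP, den_comp, den_fst, den_tab, den_len, den_v0, den_addR, den_divR,
    den_get, den_lift, den_sndP]
  rw [den_matVecP, length_encodeVec]
  refine tabList_eq_encodeVec fun i => ?_
  rw [getD_encodeVec, getD_encodeVec, smul_mulVec, Pi.add_apply, Pi.smul_apply, smul_eq_mul,
    mul_div_cancel_left₀ _ hc]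

theorem cost_smoothP (A : Matrix (Fin n) (Fin n) ℝ) (c : ℝ) (x : Fin n → ℝ) :
    Cost smoothP ((encodeSparse A, encodeVec x), c) (600 * (nnz A + n) + 200)
      (200 * Nat.clog 2 n + 300) := by
  have h0 : Cost (.comp (.prim .fst) matVecP : Prog (.prod (.prod .sparse .vec) .real) _)
    ((encodeSparse A, encodeVec x), c) _ _ := Cost.comp Cost.prim (cost_matVecP A x)
  have h := Cost.letP (f := tab (len v0) (get (lift (lift (sndP (.prim .fst)))) v0 + get v1 v0 / v2))
    h0 (Cost.tab Cost.v0.len (Wf := fun _ => 50) (Tf := 50) fun i _ =>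
      ((Cost.prim.sndP.lift.lift.get Cost.v0).addR
        ((Cost.v0.lift.get Cost.v0).divR Cost.v0.lift.lift)).mono (by omega) (by omega))
  rw [Finset.sum_const, Finset.card_range, smul_eq_mul, den_len, den_v0, den_comp, den_fst,
    den_matVecP, length_encodeVec] at h
  exact h.mono (by omega) (by omega)

/-- The vector `(r + x + c⁻¹ A x) / 2`, from `(((A, x), c), r)`. -/
def averageP : Prog (.prod (.prod (.prod .sparse .vec) .real) .vec) .vec :=
  letP (.comp (.prim .fst) smoothP) (tab (len v0) ((get v2 v0 + get v1 v0) / toR (lit 2)))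

theorem den_averageP {a : Matrix (Fin n) (Fin n) ℝ} {c : ℝ} (hc : c ≠ 0) (x r : Fin n → ℝ) :
    den averageP (((encodeSparse (c • a), encodeVec x), c), encodeVec r) =
      encodeVec ((1 / 2 : ℝ) • (r + (x + a *ᵥ x))) := by
  simp only [averageP, den_letP, den_comp, den_fst, den_smoothP hc, den_tab, den_len, den_v0,
    den_addR, den_divR, den_get, den_lift, den_toR, den_lit]
  rw [length_encodeVec]
  refine tabList_eq_encodeVec fun i => ?_
  rw [getD_encodeVec, getD_encodeVec, Pi.smul_apply, smul_eq_mul, Nat.cast_ofNat]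
  simp only [Pi.add_apply]
  ring

theorem cost_averageP {a : Matrix (Fin n) (Fin n) ℝ} {c : ℝ} (hc : c ≠ 0) (x r : Fin n → ℝ) :
    Cost averageP (((encodeSparse (c • a), encodeVec x), c), encodeVec r)
      (700 * (nnz (c • a) + n) + 300) (200 * Nat.clog 2 n + 400) := by
  have h0 : Cost (.comp (.prim .fst) smoothP :
      Prog (.prod (.prod (.prod .sparse .vec) .real) .vec) _)
    (((encodeSparse (c • a), encodeVec x), c), encodeVec r) _ _ :=
    Cost.comp Cost.prim (cost_smoothP (c • a) c x)
  have h := Cost.letP (f := tab (len v0) ((get v2 v0 + get v1 v0) / toR (lit 2)))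
    h0 (Cost.tab Cost.v0.len (Wf := fun _ => 50) (Tf := 50) fun i _ =>
      (((Cost.v0.lift.lift.get Cost.v0).addR (Cost.v0.lift.get Cost.v0)).divR
        Cost.lit.toR).mono (by omega) (by omega))
  rw [Finset.sum_const, Finset.card_range, smul_eq_mul, den_len, den_v0, den_comp, den_fst,
    den_smoothP hc, length_encodeVec] at h
  exact h.mono (by omega) (by omega)

/-! ### The passes down and up the levels. -/

section chain

variable {d : ℕ} (c : ℝ) (a : ℕ → Matrix (Fin n) (Fin n) ℝ)

/-- The data of a chain with scalar diagonal matrices. -/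
noncomputable def scalarChain (d : ℕ) : Ty.chain.Val :=
  encodeChain (fun _ : Fin (d + 1) => c • (1 : Matrix (Fin n) (Fin n) ℝ)) fun i => c • a i

theorem length_scalarChain :
    @List.length (List ℝ × List (List (ℕ × ℝ))) (scalarChain c a d) = d + 1 := by
  simp [scalarChain, encodeChain]

theorem getD_scalarChain {i : ℕ} (hi : i < d + 1) (x) :
    @List.getD (List ℝ × List (List (ℕ × ℝ))) (scalarChain c a d) i x =
      (encodeVec (c • (1 : Matrix (Fin n) (Fin n) ℝ)).diag, encodeSparse (c • a i)) :=
  getD_ofFn _ ⟨i, hi⟩ _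

/-- The residuals on the levels of a chain. -/
noncomputable def restrictions (v : Fin n → ℝ) : ℕ → Fin n → ℝ
  | 0 => v
  | i + 1 => restrictions v i + a i *ᵥ restrictions v i

/-- The solutions on the levels of a chain, from the last one to the first. -/
noncomputable def prolongations (d : ℕ) (v : Fin n → ℝ) : ℕ → Fin n → ℝ
  | 0 => restrictions a v d
  | k + 1 => (1 / 2 : ℝ) • (restrictions a v (d - 1 - k) +
      (prolongations d v k + a (d - 1 - k) *ᵥ prolongations d v k))

/-- The recursion of `precond` is unfolded along the chain: its inner factor at level i + 1 acts on
(1 + a i) applied to the residual of level i, which is the next residual. After k steps of the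
upward pass the level is d - k. -/
theorem prolongations_eq (v : Fin n → ℝ) (k : ℕ) (hk : k ≤ d) :
    prolongations a d v k = precond a k (d - k) *ᵥ restrictions a v (d - k) := by
  induction k with
  | zero => simp [prolongations, precond]
  | succ k ih =>
    have e1 : d - 1 - k = d - (k + 1) := by omega
    have e2 : d - k = d - (k + 1) + 1 := by omega
    rw [prolongations, ih (by omega), e1, e2, restrictions, precond, smul_mulVec, add_mulVec,
      one_mulVec, ← mulVec_mulVec, ← mulVec_mulVec, add_mulVec, add_mulVec, one_mulVec, one_mulVec]

/-- The residuals on the levels of a chain. -/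
def restrictP : Prog (.prod (.prod (.prod .chain .vec) .real) .nat) (.arr .vec) :=
  forP v0 (tab (lit 1) v3) (push (v1 + lit 1) v0 (.comp (.pair (.pair
    (sndP (get (lift (lift (lift (lift (.prim .fst))))) v1)) (get v0 v1)) v3) smoothP))

/-- The solution on the first level of a chain. -/
def prolongP : Prog (.prod (.prod (.prod (.prod .chain .vec) .real) .nat) (.arr .vec)) .vec :=
  forP v1 (get v0 v1) (.comp (.pair (.pair (.pair
    (sndP (get (lift (lift (lift (lift (lift (.prim .fst)))))) (v3 - lit 1 - v1))) v0) v4)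
      (get v2 (v3 - lit 1 - v1))) averageP)

variable {c}

theorem restrictP_passes (hc : c ≠ 0) (v : Fin n → ℝ) (k : ℕ) (hk : k ≤ d) :
    passes (fun i s => den (push (v1 + lit 1) v0 (.comp (.pair (.pair
      (sndP (get (lift (lift (lift (lift (.prim .fst))))) v1)) (get v0 v1)) v3) smoothP) :
      Prog (.prod (.prod (.prod (.prod (.prod .chain .vec) .real) .nat) .nat) (.arr .vec))
        (.arr .vec))
      (((((scalarChain c a d, encodeVec v), c), d), i), s)) (tabList 1 fun _ => encodeVec v) k =
    tabList (k + 1) fun i => encodeVec (restrictions a v i) := by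
  induction k with
  | zero => rfl
  | succ k ih =>
    rw [passes, ih (by omega), den_push]
    · rw [tabList_succ (k + 1)]
      simp only [den_v0, den_comp, den_pair, den_sndP, den_get, den_lift, den_fst]
      rw [getD_scalarChain c a (by omega), getD_tabList, if_pos (by omega), den_smoothP hc,
        restrictions]
    · simp only [den_v0, den_lift, den_addN, den_lit, length_tabList]
      exact le_rfl

theorem den_restrictP (hc : c ≠ 0) (v : Fin n → ℝ) :
    den restrictP (((scalarChain c a d, encodeVec v), c), d) =
      tabList (d + 1) fun i => encodeVec (restrictions a v i) := by
  rw [← restrictP_passes a hc v d le_rfl]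
  simp only [restrictP, den_forP, den_v0, den_tab, den_lit, den_lift]

/-- The term (d + 1)² pays for `push`, which rebuilds the array of residuals at every level; each
vector in it is copied at unit cost. -/
theorem cost_restrictP (hc : c ≠ 0) (v : Fin n → ℝ) :
    Cost restrictP (((scalarChain c a d, encodeVec v), c), d)
      (1000 * (∑ i ∈ Finset.range d, (nnz (c • a i) + n) + (d + 1) ^ 2))
      (1000 * ((d + 1) * (Nat.clog 2 n + 1))) := by
  have h := Cost.forP (x := (((scalarChain c a d, encodeVec v), c), d)) (n := v0)
    (s := tab (lit 1) v3) (f := push (v1 + lit 1) v0 (.comp (.pair (.pair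
      (sndP (get (lift (lift (lift (lift (.prim .fst))))) v1)) (get v0 v1)) v3) smoothP))
    (Wf := fun i => 600 * (nnz (c • a i) + n) + (30 * i + 400))
    (Tf := fun i => 200 * Nat.clog 2 n + 600) Cost.v0
    (Cost.tab Cost.lit (Wf := fun _ => 10) (Tf := 10) fun _ _ =>
      (Cost.v0.lift.lift.lift).mono (by omega) (by omega)) fun i hi => by
      have hi' : @LT.lt ℕ _ i d := hi
      have hp := restrictP_passes a hc v i hi'.le
      have e : den (tab (lit 1) v3 : Prog (.prod (.prod (.prod .chain .vec) .real) .nat) _)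
        (((scalarChain c a d, encodeVec v), c), d) = tabList 1 fun _ => encodeVec v := rfl
      rw [e, hp]
      refine (Cost.push (Cost.v0.lift.addN Cost.lit) Cost.v0
        ((((Cost.prim.lift.lift.lift.lift.get Cost.v0.lift).sndP.pair
          (Cost.v0.get Cost.v0.lift)).pair Cost.v0.lift.lift.lift).comp
          (W' := 600 * (nnz (c • a i) + n) + 200) (T' := 200 * Nat.clog 2 n + 300) ?_)).mono ?_ ?_
      · simp only [den_v0, den_pair, den_sndP, den_get, den_lift, den_fst]
        rw [getD_scalarChain c a (by omega), getD_tabList, if_pos (by omega)]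
        exact cost_smoothP _ _ _
      · simp only [den_addN, den_lift, den_v0, den_lit]
        omega
      · omega
  have hb : ∑ i ∈ Finset.range d, i ≤ d * d := by
    refine (Finset.sum_le_sum fun i hi => (Finset.mem_range.mp hi).le).trans ?_
    rw [Finset.sum_const, Finset.card_range, smul_eq_mul]
  have hb' : ∑ i ∈ Finset.range d, 30 * i ≤ 30 * (d * d) := by
    rw [← Finset.mul_sum]; exact Nat.mul_le_mul_left _ hb
  simp only [den_v0, den_lit, Finset.sum_const, Finset.card_range, smul_eq_mul,
    Finset.sum_add_distrib, ← Finset.mul_sum] at h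
  simp only [Finset.sum_add_distrib, Finset.sum_const, Finset.card_range, smul_eq_mul]
  refine h.mono ?_ ?_
  · nlinarith [Nat.zero_le (d * n), Nat.zero_le (∑ i ∈ Finset.range d, nnz (c • a i))]
  · nlinarith [Nat.zero_le (d * Nat.clog 2 n)]

theorem prolongP_passes (hc : c ≠ 0) (v : Fin n → ℝ) (k : ℕ) (hk : k ≤ d) :
    passes (fun i s => den (.comp (.pair (.pair (.pair
      (sndP (get (lift (lift (lift (lift (lift (.prim .fst)))))) (v3 - lit 1 - v1))) v0) v4)
      (get v2 (v3 - lit 1 - v1))) averageP :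
      Prog (.prod (.prod (.prod (.prod (.prod (.prod .chain .vec) .real) .nat) (.arr .vec)) .nat)
        .vec) .vec)
      ((((((scalarChain c a d, encodeVec v), c), d),
        tabList (d + 1) fun i => encodeVec (restrictions a v i)), i), s))
      (encodeVec (restrictions a v d)) k = encodeVec (prolongations a d v k) := by
  induction k with
  | zero => rfl
  | succ k ih =>
    rw [passes, ih (by omega)]
    simp only [den_v0, den_comp, den_pair, den_sndP, den_get, den_lift, den_fst, den_subN, den_lit]
    rw [getD_scalarChain c a (by omega), getD_tabList, if_pos (by omega), den_averageP hc,
      prolongations]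

theorem den_prolongP (hc : c ≠ 0) (v : Fin n → ℝ) :
    den prolongP ((((scalarChain c a d, encodeVec v), c), d),
      tabList (d + 1) fun i => encodeVec (restrictions a v i)) =
      encodeVec (precond a d 0 *ᵥ v) := by
  have h := prolongations_eq a v d le_rfl
  rw [Nat.sub_self, restrictions] at h
  rw [← h, ← prolongP_passes a hc v d le_rfl]
  simp only [prolongP, den_forP, den_v0, den_get, den_lift]
  rw [getD_tabList, if_pos (by omega)]

theorem sum_range_sub (f : ℕ → ℕ) :
    ∑ i ∈ Finset.range d, f (d - 1 - i) = ∑ i ∈ Finset.range d, f i := Finset.sum_range_reflect f d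

theorem cost_prolongP (hc : c ≠ 0) (v : Fin n → ℝ) :
    Cost prolongP ((((scalarChain c a d, encodeVec v), c), d),
      tabList (d + 1) fun i => encodeVec (restrictions a v i))
      (1000 * (∑ i ∈ Finset.range d, (nnz (c • a i) + n) + (d + 1) ^ 2))
      (1000 * ((d + 1) * (Nat.clog 2 n + 1))) := by
  have h := Cost.forP (x := ((((scalarChain c a d, encodeVec v), c), d),
      tabList (d + 1) fun i => encodeVec (restrictions a v i))) (n := v1)
    (s := get v0 v1) (f := .comp (.pair (.pair (.pair
      (sndP (get (lift (lift (lift (lift (lift (.prim .fst)))))) (v3 - lit 1 - v1))) v0) v4)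
      (get v2 (v3 - lit 1 - v1))) averageP)
    (Wf := fun i => 700 * (nnz (c • a (d - 1 - i)) + n) + 400)
    (Tf := fun i => 200 * Nat.clog 2 n + 600) Cost.v0.lift (Cost.v0.get Cost.v0.lift) fun i hi => by
      have hi' : @LT.lt ℕ _ i d := hi
      have hp := prolongP_passes a hc v i hi'.le
      have e : den (get v0 v1 : Prog (.prod (.prod (.prod (.prod .chain .vec) .real) .nat)
          (.arr .vec)) _) ((((scalarChain c a d, encodeVec v), c), d),
        tabList (d + 1) fun i => encodeVec (restrictions a v i)) =
          encodeVec (restrictions a v d) := by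
        simp only [den_get, den_v0, den_lift]
        rw [getD_tabList, if_pos (by omega)]
      rw [e, hp]
      have hj : Cost (v3 - lit 1 - v1 : Prog (.prod (.prod (.prod (.prod (.prod (.prod .chain .vec)
          .real) .nat) (.arr .vec)) .nat) .vec) .nat) ((((((scalarChain c a d, encodeVec v), c), d),
          tabList (d + 1) fun i => encodeVec (restrictions a v i)), i),
            encodeVec (prolongations a d v i)) _ _ :=
        (Cost.v0.lift.lift.lift.subN Cost.lit).subN Cost.v0.lift
      refine (((((Cost.prim.lift.lift.lift.lift.lift.get hj).sndP.pair Cost.v0).pair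
        Cost.v0.lift.lift.lift.lift).pair (Cost.v0.lift.lift.get hj)).comp
          (W' := 700 * (nnz (c • a (d - 1 - i)) + n) + 300) (T' := 200 * Nat.clog 2 n + 400)
          ?_).mono ?_ ?_
      · simp only [den_v0, den_pair, den_sndP, den_get, den_lift, den_fst, den_subN, den_lit]
        rw [getD_scalarChain c a (by omega), getD_tabList, if_pos (by omega)]
        exact cost_averageP hc _ _
      · omega
      · omega
  have hr := sum_range_sub (d := d) fun i => nnz (c • a i)
  simp only [den_v0, den_lift, Finset.sum_const, Finset.card_range, smul_eq_mul,
    Finset.sum_add_distrib, ← Finset.mul_sum, hr] at h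
  simp only [Finset.sum_add_distrib, Finset.sum_const, Finset.card_range, smul_eq_mul]
  refine h.mono ?_ ?_
  · nlinarith [Nat.zero_le (d * n), Nat.zero_le (∑ i ∈ Finset.range d, nnz (c • a i))]
  · nlinarith [Nat.zero_le (d * Nat.clog 2 n)]

/-- The preconditioner of a chain. -/
def precondP : Prog (.prod (.prod (.prod .chain .vec) .real) .nat) .vec := letP restrictP prolongP

theorem den_precondP (hc : c ≠ 0) (v : Fin n → ℝ) :
    den precondP (((scalarChain c a d, encodeVec v), c), d) = encodeVec (precond a d 0 *ᵥ v) := by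
  rw [precondP, den_letP, den_restrictP a hc, den_prolongP a hc]

theorem cost_precondP (hc : c ≠ 0) (v : Fin n → ℝ) :
    Cost precondP (((scalarChain c a d, encodeVec v), c), d)
      (2100 * (∑ i ∈ Finset.range d, (nnz (c • a i) + n) + (d + 1) ^ 2))
      (2100 * ((d + 1) * (Nat.clog 2 n + 1))) := by
  refine (Cost.letP (cost_restrictP a hc v) (by
    rw [den_restrictP a hc]; exact cost_prolongP a hc v)).mono ?_ ?_
  · have : 1 ≤ (d + 1) ^ 2 := Nat.one_le_pow _ _ (by omega)
    omega
  · have : 1 ≤ (d + 1) * (Nat.clog 2 n + 1) := Nat.mul_pos (by omega) (by omega)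
    omega

end chain

end WorkDepth

/-! ### The solver -/

namespace RealMatrix

open Matrix

variable {n : ℕ}

/-- One step of the preconditioned Richardson iteration for `c (1 - a 0) x = b`. -/
noncomputable def richardson (a : ℕ → Matrix (Fin n) (Fin n) ℝ) (d : ℕ) (c : ℝ) (b x : Fin n → ℝ) :
    Fin n → ℝ :=
  x + (1 / 3 : ℝ) • (precond a d 0 *ᵥ (c⁻¹ • b - (x - a 0 *ᵥ x)))

/-- The error x - y is mapped to (1 - Z(1 - a 0)/3)(x - y), where the constant 3 bounds (1 + 1/d)^d.
So `richardson_step` applies in every iteration. -/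
theorem richardson_iterate_le {a : ℕ → Matrix (Fin n) (Fin n) ℝ} {d k : ℕ} (hd : 0 < d)
    (ha : ∀ i, IsLevel (a i) ∧ IsSparsifier (1 - a i * a i) (1 - a (i + 1)) d k)
    (hlast : ∀ x, 1 / 2 * (x ⬝ᵥ x) ≤ form (1 - a d) x x) {c : ℝ} {b x : Fin n → ℝ}
    (hx : (1 - a 0) *ᵥ x = c⁻¹ • b) (j : ℕ) :
    form (1 - a 0) (x - (richardson a d c b)^[j] 0) (x - (richardson a d c b)^[j] 0) ≤
      (5 / 6) ^ j * form (1 - a 0) x x := by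
  have hb := fun y => precond_bounds hd (fun i _ => (ha i).1)
    (fun i _ => ⟨(ha i).2.le, (ha i).2.ge⟩) hlast d 0 (zero_add d) y
  have hN := (ha 0).1.posDef
  have h3 := one_add_inv_pow_le d hd
  induction j with
  | zero => simp
  | succ j ih =>
    rw [Function.iterate_succ_apply']
    set y := (richardson a d c b)^[j] 0 with hy
    have e : x - richardson a d c b y =
        (x - y) - (1 / 3 : ℝ) • precond a d 0 *ᵥ ((1 - a 0) *ᵥ (x - y)) := by
      have e1 : y - a 0 *ᵥ y = (1 - a 0) *ᵥ y := by rw [sub_mulVec, one_mulVec]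
      rw [richardson, ← hx, e1, ← mulVec_sub, sub_add_eq_sub_sub]
    rw [e, pow_succ', mul_assoc]
    exact (richardson_step hN (precond_isSymm (fun i => (ha i).1.posSemidef.isSymm) d 0)
      (fun y => (hb y).1) (fun y => (hb y).2.trans (mul_le_mul_of_nonneg_right h3
        (hN.inv.posSemidef.form_nonneg y))) (x - y)).trans
      (mul_le_mul_of_nonneg_left ih (by norm_num))

theorem isApproxSolution_richardson {M : Matrix (Fin n) (Fin n) ℝ} (hM : M.PosDef)
    {a : ℕ → Matrix (Fin n) (Fin n) ℝ} {d k : ℕ} (hd : 0 < d)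
    (ha : ∀ i, IsLevel (a i) ∧ IsSparsifier (1 - a i * a i) (1 - a (i + 1)) d k)
    (hlast : ∀ x, 1 / 2 * (x ⬝ᵥ x) ≤ form (1 - a d) x x) {c : ℝ} (hc : 0 < c)
    (h0 : a 0 = 1 - c⁻¹ • M) (b : Fin n → ℝ) {ε : ℝ} (hε : 0 < ε) {j : ℕ}
    (hj : (12 / 13 : ℝ) ^ j ≤ ε) : IsApproxSolution M b ε ((richardson a d c b)^[j] 0) := by
  have e0 : 1 - a 0 = c⁻¹ • M := by rw [h0, sub_sub_cancel]
  have hx : M *ᵥ (M⁻¹ *ᵥ b) = b := by rw [mulVec_mulVec, mul_inv_posDef hM, one_mulVec]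
  refine ⟨M⁻¹ *ᵥ b, hx, ?_⟩
  set x := M⁻¹ *ᵥ b with hxdef
  have h1 := richardson_iterate_le hd ha hlast (c := c) (b := b) (x := x) (by
    rw [e0, smul_mulVec, hx]) j
  rw [e0, form_smul, form_smul] at h1
  set y := x - (richardson a d c b)^[j] 0
  have h2 : form M y y ≤ (5 / 6) ^ j * form M x x := by
    have : c⁻¹ * form M y y ≤ c⁻¹ * ((5 / 6) ^ j * form M x x) := by linarith
    exact le_of_mul_le_mul_left this (inv_pos.mpr hc)
  have hxx := hM.posSemidef.form_nonneg x
  have h3 : (5 / 6 : ℝ) ^ j ≤ ε ^ 2 := by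
    -- The rational number 12/13 has a square above 5/6. The program can thus count down an error
    -- bound for the norm without square roots.
    calc (5 / 6 : ℝ) ^ j ≤ ((12 / 13 : ℝ) ^ 2) ^ j := pow_le_pow_left₀ (by norm_num) (by norm_num) j
      _ = ((12 / 13 : ℝ) ^ j) ^ 2 := by rw [← pow_mul, ← pow_mul, mul_comm]
      _ ≤ ε ^ 2 := pow_le_pow_left₀ (by positivity) hj 2
  have h4 : form M y y ≤ ε ^ 2 * form M x x := h2.trans (mul_le_mul_of_nonneg_right h3 hxx)
  calc energyNorm M y = Real.sqrt (form M y y) := rfl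
    _ ≤ Real.sqrt (ε ^ 2 * form M x x) := Real.sqrt_le_sqrt h4
    _ = ε * energyNorm M x := by
        rw [Real.sqrt_mul (sq_nonneg ε), Real.sqrt_sq hε.le]; rfl

end RealMatrix

/-! ### The solver as a program. -/

namespace WorkDepth

open RealMatrix Matrix

variable {n : ℕ}

/-- The state of the solver: `((((chain, (b, ε)), c), d), (x, e))`. -/
abbrev Ty.solver : Ty :=
  .prod (.prod (.prod (.prod .chain (.prod .vec .real)) .real) .nat) (.prod .vec .real)

/-- The chain of the solver. -/
def chainV : Prog .solver .chain := lift (lift (lift (.prim .fst)))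
/-- The right hand side of the solver. -/
def rhsV : Prog .solver .vec := lift (lift (lift (fstP v0)))

/-- One step of the preconditioned Richardson iteration. -/
def richardsonP : Prog .solver .vec :=
  letP (.comp (.pair (sndP (get chainV (lit 0))) (fstP v0)) matVecP)
    (letP (tab (len v0) (get (lift (lift rhsV)) v0 / v4 -
        (get (fstP v2) v0 - get v1 v0 / v4)))
      (letP (.comp (.pair (.pair (.pair (lift (lift chainV)) v0) v4) v3) precondP)
        (tab (len v0) (get (fstP v4) v0 + get v1 v0 / toR (lit 3)))))

variable {d : ℕ} {c : ℝ} (a : ℕ → Matrix (Fin n) (Fin n) ℝ)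

theorem den_residual (hc : c ≠ 0) (b x : Fin n → ℝ) :
    tabList n (fun i => (encodeVec b).getD i 0 / c - ((encodeVec x).getD i 0 -
      (encodeVec ((c • a 0) *ᵥ x)).getD i 0 / c)) = encodeVec (c⁻¹ • b - (x - a 0 *ᵥ x)) := by
  refine tabList_eq_encodeVec fun i => ?_
  rw [getD_encodeVec, getD_encodeVec, getD_encodeVec, smul_mulVec]
  simp only [Pi.sub_apply, Pi.smul_apply, smul_eq_mul]
  rw [mul_div_cancel_left₀ _ hc, div_eq_inv_mul]

theorem richardsonP_spec (hd : 1 ≤ d) (hc : c ≠ 0) (b x : Fin n → ℝ) (ε e : ℝ) :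
    den richardsonP ((((scalarChain c a d, (encodeVec b, ε)), c), d), (encodeVec x, e)) =
      encodeVec (richardson a d c b x) ∧
    Cost richardsonP ((((scalarChain c a d, (encodeVec b, ε)), c), d), (encodeVec x, e))
      (3000 * (∑ i ∈ Finset.range d, (nnz (c • a i) + n) + (d + 1) ^ 2))
      (3000 * ((d + 1) * (Nat.clog 2 n + 1))) := by
  set s : Ty.solver.Val :=
    ((((scalarChain c a d, (encodeVec b, ε)), c), d), (encodeVec x, e)) with hs
  have d1 : den (.comp (.pair (sndP (get chainV (lit 0))) (fstP v0)) matVecP) s =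
      encodeVec ((c • a 0) *ᵥ x) := by
    simp only [den_comp, den_pair, den_sndP, den_get, chainV, den_lift, den_fst, den_fstP, den_v0,
      den_lit, hs]
    rw [getD_scalarChain c a (by omega), den_matVecP]
  have c1 : Cost (.comp (.pair (sndP (get chainV (lit 0))) (fstP v0)) matVecP) s
      (500 * (nnz (c • a 0) + n) + 130) (200 * Nat.clog 2 n + 230) := by
    refine (Cost.comp (((Cost.lift (Cost.lift (Cost.lift Cost.prim))).get Cost.lit).sndP.pair
      Cost.v0.fstP) (W' := 500 * (nnz (c • a 0) + n) + 100) (T' := 200 * Nat.clog 2 n + 200)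
      ?_).mono (by omega) (by omega)
    simp only [den_pair, den_sndP, den_get, den_lift, den_fst, den_fstP, den_v0, den_lit, hs]
    rw [getD_scalarChain c a (by omega)]
    exact cost_matVecP _ _
  set y := encodeVec ((c • a 0) *ᵥ x) with hy
  set r := c⁻¹ • b - (x - a 0 *ᵥ x) with hr
  have d2 : den (tab (len v0) (get (lift (lift rhsV)) v0 / v4 -
      (get (fstP v2) v0 - get v1 v0 / v4))) (s, y) = encodeVec r := by
    rw [← den_residual a hc]
    simp only [den_tab, den_len, den_v0, den_subR, den_divR, den_get, den_lift, rhsV, den_fstP, hs,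
      hy]
    rw [length_encodeVec]
    rfl
  have c2 : Cost (tab (len v0) (get (lift (lift rhsV)) v0 / v4 -
      (get (fstP v2) v0 - get v1 v0 / v4))) (s, y) (70 * n + 20) 100 := by
    have h := Cost.tab (x := (s, y)) (n := len v0) (f := get (lift (lift rhsV)) v0 / v4 -
      (get (fstP v2) v0 - get v1 v0 / v4)) Cost.v0.len (Wf := fun _ => 70) (Tf := 70) fun i _ =>
        (Cost.subR ((Cost.get (Cost.lift (Cost.lift (Cost.lift (Cost.lift (Cost.lift
          Cost.v0.fstP))))) Cost.v0).divR Cost.v0.lift.lift.lift.lift)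
          (Cost.subR (Cost.v0.lift.lift.fstP.get Cost.v0) ((Cost.v0.lift.get Cost.v0).divR
            Cost.v0.lift.lift.lift.lift))).mono (by omega) (by omega)
    rw [Finset.sum_const, Finset.card_range, smul_eq_mul, den_len, den_v0, hy,
      length_encodeVec] at h
    exact h.mono (by omega) (by omega)
  have d3 : den (.comp (.pair (.pair (.pair (lift (lift chainV)) v0) v4) v3) precondP)
      ((s, y), encodeVec r) = encodeVec (precond a d 0 *ᵥ r) := by
    rw [← den_precondP a hc]
    rfl
  have c3 : Cost (.comp (.pair (.pair (.pair (lift (lift chainV)) v0) v4) v3) precondP)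
      ((s, y), encodeVec r)
      (2100 * (∑ i ∈ Finset.range d, (nnz (c • a i) + n) + (d + 1) ^ 2) + 50)
      (2100 * ((d + 1) * (Nat.clog 2 n + 1)) + 50) :=
    (Cost.comp ((((Cost.lift (Cost.lift (Cost.lift (Cost.lift (Cost.lift Cost.prim))))).pair
      Cost.v0).pair Cost.v0.lift.lift.lift.lift).pair Cost.v0.lift.lift.lift)
      (cost_precondP a hc r)).mono (by omega) (by omega)
  set z := encodeVec (precond a d 0 *ᵥ r) with hz
  have d4 : den (tab (len v0) (get (fstP v4) v0 + get v1 v0 / toR (lit 3)))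
      (((s, y), encodeVec r), z) = encodeVec (richardson a d c b x) := by
    simp only [den_tab, den_len, den_v0, den_addR, den_divR, den_get, den_lift, den_fstP, den_toR,
      den_lit, hs, hz]
    rw [length_encodeVec]
    refine tabList_eq_encodeVec fun i => ?_
    rw [getD_encodeVec, getD_encodeVec, richardson, Pi.add_apply, Pi.smul_apply, smul_eq_mul,
      Nat.cast_ofNat]
    ring
  have c4 : Cost (tab (len v0) (get (fstP v4) v0 + get v1 v0 / toR (lit 3)))
      (((s, y), encodeVec r), z) (50 * n + 20) 100 := by
    have h := Cost.tab (x := (((s, y), encodeVec r), z)) (n := len v0)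
      (f := get (fstP v4) v0 + get v1 v0 / toR (lit 3)) Cost.v0.len (Wf := fun _ => 50)
        (Tf := 50) fun i _ => (Cost.addR (Cost.v0.lift.lift.lift.lift.fstP.get Cost.v0)
          ((Cost.v0.lift.get Cost.v0).divR Cost.lit.toR)).mono (by omega) (by omega)
    rw [Finset.sum_const, Finset.card_range, smul_eq_mul, den_len, den_v0, hz,
      length_encodeVec] at h
    exact h.mono (by omega) (by omega)
  constructor
  · rw [richardsonP, den_letP, d1, den_letP, d2, den_letP, d3, d4]
  · refine (Cost.letP c1 (d1 ▸ Cost.letP c2 (d2 ▸ Cost.letP c3 (d3 ▸ c4)))).mono ?_ ?_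
    · have h1 : nnz (c • a 0) + n ≤ ∑ i ∈ Finset.range d, (nnz (c • a i) + n) :=
        Finset.single_le_sum (f := fun i => nnz (c • a i) + n) (fun _ _ => Nat.zero_le _)
          (Finset.mem_range.mpr hd)
      have h2 : 4 ≤ (d + 1) ^ 2 := Nat.pow_le_pow_left (show 2 ≤ d + 1 by omega) 2
      omega
    · have h1 : Nat.clog 2 n + 1 ≤ (d + 1) * (Nat.clog 2 n + 1) :=
        Nat.le_mul_of_pos_left _ (by omega)
      omega

/-- The solver. -/
def solveP : Prog (.prod .chain (.prod .vec .real)) .vec :=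
  letP (get (fstP (get (.prim .fst) (lit 0))) (lit 0))
    (letP (len (lift (.prim .fst)) - lit 1)
      (.comp (.pair (.prim .id) (.pair (tab (len (lift (lift (fstP v0)))) zeroR) oneR))
        (.comp (.loop (ltR (lift (lift (lift (sndP v0)))) (sndP v0))
          (.pair (.prim .fst) (.pair richardsonP (sndP v0 * (toR (lit 12) / toR (lit 13))))))
          (fstP v0))))

/-- The chain alone carries the parameters: c is the first diagonal entry of its first member, which
exists as n > 0, and d is its length minus 1. The loop carries the power of 12/13 along with the
iterate, so it stops at the first exponent that certifies ε. -/
theorem solveP_spec (hn : 0 < n) (hd : 1 ≤ d) (hc : c ≠ 0) (b : Fin n → ℝ) (ε : ℝ) {k : ℕ}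
    (hk : (12 / 13 : ℝ) ^ k ≤ ε) (hlt : ∀ j < k, ε < (12 / 13 : ℝ) ^ j) :
    den solveP (scalarChain c a d, (encodeVec b, ε)) = encodeVec ((richardson a d c b)^[k] 0) ∧
    Cost solveP (scalarChain c a d, (encodeVec b, ε))
      (4000 * ((k + 1) * (∑ i ∈ Finset.range d, (nnz (c • a i) + n) + (d + 1) ^ 2)))
      (4000 * ((k + 1) * ((d + 1) * (Nat.clog 2 n + 1)))) := by
  set S := ∑ i ∈ Finset.range d, (nnz (c • a i) + n) + (d + 1) ^ 2 with hS
  set L := (d + 1) * (Nat.clog 2 n + 1) with hL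
  set x : (Ty.prod .chain (.prod .vec .real)).Val := (scalarChain c a d, (encodeVec b, ε)) with hx
  set f : Prog .solver .solver := .pair (.prim .fst)
    (.pair richardsonP (sndP v0 * (toR (lit 12) / toR (lit 13)))) with hf
  set q : Prog .solver .bool := ltR (lift (lift (lift (sndP v0)))) (sndP v0) with hq
  have d1 : den (get (fstP (get (.prim .fst) (lit 0))) (lit 0)) x = c := by
    simp only [den_get, den_fstP, den_fst, den_lit, hx]
    rw [getD_scalarChain c a (by omega)]
    have := getD_encodeVec (c • (1 : Matrix (Fin n) (Fin n) ℝ)).diag ⟨0, hn⟩ 0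
    simp only at this
    refine this.trans ?_
    simp
  have d2 : den (len (lift (.prim .fst)) - lit 1 :
      Prog (.prod (.prod .chain (.prod .vec .real)) .real) .nat) (x, c) = d := by
    simp only [den_subN, den_len, den_lift, den_fst, den_lit, hx]
    rw [length_scalarChain, Nat.add_sub_cancel]
  have d3 : den (.pair (.prim .id) (.pair (tab (len (lift (lift (fstP v0)))) zeroR) oneR) :
      Prog (.prod (.prod (.prod .chain (.prod .vec .real)) .real) .nat) .solver)
      ((x, c), d) = (((x, c), d), (encodeVec (0 : Fin n → ℝ), (1 : ℝ))) := by
    simp only [den_pair, den_id, den_tab, den_len, den_lift, den_fstP, den_v0, den_zeroR, den_oneR,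
      hx]
    rw [length_encodeVec, tabList_eq_encodeVec (x := 0) fun _ => rfl]
  have hit : ∀ j : ℕ, (den f)^[j] (((x, c), d), (encodeVec (0 : Fin n → ℝ), (1 : ℝ))) =
      (((x, c), d), (encodeVec ((richardson a d c b)^[j] 0), (12 / 13) ^ j)) := by
    intro j
    induction j with
    | zero => simp
    | succ j ih =>
      rw [Function.iterate_succ_apply', ih, hf]
      simp only [den_pair, den_fst, den_mulR, den_sndP, den_v0, den_divR, den_toR, den_lit]
      rw [hx, (richardsonP_spec a hd hc b _ ε _).1, Function.iterate_succ_apply', pow_succ,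
        Nat.cast_ofNat, Nat.cast_ofNat]
  have hqd : ∀ (y : List ℝ) (e : ℝ), den q (((x, c), d), (y, e)) = decide (ε < e) :=
    fun _ _ => rfl
  have hk1 : ∀ i < k, den q ((den f)^[i] (((x, c), d), (encodeVec (0 : Fin n → ℝ), (1 : ℝ)))) = true :=
    fun i hi => by rw [hit, hqd]; exact decide_eq_true (hlt i hi)
  have hk2 : den q ((den f)^[k] (((x, c), d), (encodeVec (0 : Fin n → ℝ), (1 : ℝ)))) = false := by
    rw [hit, hqd]; exact decide_eq_false (not_lt.mpr hk)
  constructor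
  · rw [solveP, den_letP, d1, den_letP, d2, den_comp, d3, den_comp, den_loop, ← hf, ← hq,
      stopTime_eq hk1 hk2, hit]
    rfl
  · have c3 : Cost (.pair (.prim .id) (.pair (tab (len (lift (lift (fstP v0)))) zeroR) oneR) :
        Prog (.prod (.prod (.prod .chain (.prod .vec .real)) .real) .nat) .solver)
        ((x, c), d) (5 * n + 50) 50 := by
      have h := Cost.tab (x := ((x, c), d)) (n := (len (lift (lift (fstP v0))) :
        Prog (.prod (.prod (.prod .chain (.prod .vec .real)) .real) .nat) .nat)) (f := zeroR)
        Cost.v0.fstP.lift.lift.len (Wf := fun _ => 2) (Tf := 2) fun i _ => Cost.lit.toR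
      have e : den (len (lift (lift (fstP v0))) :
          Prog (.prod (.prod (.prod .chain (.prod .vec .real)) .real) .nat) .nat) ((x, c), d) = n := by
        simp only [den_len, den_lift, den_fstP, den_v0, hx]
        exact length_encodeVec b
      rw [Finset.sum_const, Finset.card_range, smul_eq_mul, e] at h
      exact (Cost.prim.pair (h.pair Cost.lit.toR)).mono (by omega) (by omega)
    have c4 : Cost (.loop q f) (((x, c), d), (encodeVec (0 : Fin n → ℝ), (1 : ℝ)))
        (k * (3000 * S + 60) + 20) (k * (3000 * L + 60) + 20) := by
      refine (Cost.loop (W := fun _ => 3000 * S + 40) (T := fun _ => 3000 * L + 40) hk1 hk2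
        (Wc := 10) (Tc := 10) (fun i _ => ?_) fun i _ => ?_).mono ?_ ?_
      · exact (Cost.ltR (Cost.lift (Cost.lift (Cost.lift Cost.v0.sndP))) Cost.v0.sndP).mono
          (by omega) (by omega)
      · rw [hit]
        exact (Cost.pair Cost.prim (Cost.pair (richardsonP_spec a hd hc b _ ε _).2
          (Cost.v0.sndP.mulR (Cost.lit.toR.divR Cost.lit.toR)))).mono (by omega) (by omega)
      · rw [Finset.sum_const, Finset.card_range, smul_eq_mul]
        nlinarith
      · rw [Finset.sum_const, Finset.card_range, smul_eq_mul]
        nlinarith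
    refine (Cost.letP ((Cost.get (Cost.prim.get Cost.lit).fstP Cost.lit)) (d1 ▸ Cost.letP
      ((Cost.lift Cost.prim).len.subN Cost.lit) (d2 ▸ Cost.comp c3 (d3 ▸ Cost.comp c4
        Cost.v0.fstP)))).mono ?_ ?_
    · have h1 : n ≤ S := by
        have : nnz (c • a 0) + n ≤ ∑ i ∈ Finset.range d, (nnz (c • a i) + n) :=
          Finset.single_le_sum (f := fun i => nnz (c • a i) + n) (fun _ _ => Nat.zero_le _)
            (Finset.mem_range.mpr hd)
        omega
      have h2 : 4 ≤ S := by
        have : 4 ≤ (d + 1) ^ 2 := Nat.pow_le_pow_left (show 2 ≤ d + 1 by omega) 2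
        omega
      have h3 : k * (3000 * S + 60) = 3000 * (k * S) + 60 * k := by ring
      have h4 : k * 4 ≤ k * S := Nat.mul_le_mul_left k h2
      rw [h3, add_one_mul]
      omega
    · have h1 : 2 ≤ d + 1 := by omega
      have h2 : 2 ≤ L := h1.trans (Nat.le_mul_of_pos_right _ (by omega))
      have h3 : k * (3000 * L + 60) = 3000 * (k * L) + 60 * k := by ring
      have h4 : k * 2 ≤ k * L := Nat.mul_le_mul_left k h2
      rw [h3, add_one_mul]
      omega

end WorkDepth

/-! ### Sizes of the chain and the main theorem -/

namespace RealMatrix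

open Matrix

variable {n : ℕ}

theorem offNnz_le_nnz (M : Matrix (Fin n) (Fin n) ℝ) : offNnz M ≤ nnz M := by
  rw [offNnz, ← Set.ncard_coe_finset]
  refine Set.ncard_le_ncard (fun p hp => ?_) (Set.toFinite _)
  simp only [Finset.coe_filter, Set.mem_ofPred_eq] at hp
  exact hp.2.2

theorem nnz_smul_level_zero {M a : Matrix (Fin n) (Fin n) ℝ} {c : ℝ} (h : a = 1 - c⁻¹ • M) :
    nnz (c • a) ≤ n + nnz M := by
  refine (nnz_le_offNnz (B := M) fun i j hij hne hM => hne ?_).trans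
    (Nat.add_le_add_left (offNnz_le_nnz M) n)
  simp [h, Matrix.one_apply_ne hij, hM]

theorem nnz_smul_level_succ {a b : Matrix (Fin n) (Fin n) ℝ} {d k : ℕ}
    (h : IsSparsifier b (1 - a) d k) (c : ℝ) : nnz (c • a) ≤ n + k := by
  refine (nnz_le_offNnz (B := 1 - a) fun i j hij hne hz => hne ?_).trans
    (Nat.add_le_add_left h.sparse n)
  rw [Matrix.sub_apply, Matrix.one_apply_ne hij, zero_sub, neg_eq_zero] at hz
  rw [Matrix.smul_apply, hz, smul_zero]

/-- Minimality of j and log(13/12) ≥ 1/13 give j - 1 ≤ 13 log(1/ε) for j > 0. The remaining 2 is at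
most 4 log(1/ε), because ε ≤ 1/2. -/
theorem exists_pow_le {ε : ℝ} (hε : 0 < ε) (hε' : ε ≤ 1 / 2) :
    ∃ j : ℕ, (12 / 13 : ℝ) ^ j ≤ ε ∧ (∀ i < j, ε < (12 / 13 : ℝ) ^ i) ∧
      (j : ℝ) + 1 ≤ 17 * Real.log (1 / ε) := by
  have hex : ∃ j : ℕ, (12 / 13 : ℝ) ^ j ≤ ε :=
    (exists_pow_lt_of_lt_one hε (by norm_num)).imp fun _ h => h.le
  classical
  refine ⟨Nat.find hex, Nat.find_spec hex, fun i hi => not_le.mp (Nat.find_min hex hi), ?_⟩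
  have hlog : 1 / 2 ≤ Real.log (1 / ε) := by
    have h1 : Real.log 2 ≤ Real.log (1 / ε) :=
      Real.log_le_log (by norm_num) (by rw [le_div_iff₀ hε]; linarith)
    have := Real.log_two_gt_d9
    linarith
  rcases Nat.eq_zero_or_pos (Nat.find hex) with h0 | h0
  · rw [h0]; push_cast; linarith
  · obtain ⟨i, hi⟩ : ∃ i, Nat.find hex = i + 1 := ⟨Nat.find hex - 1, by omega⟩
    have h1 : ε < (12 / 13 : ℝ) ^ i := not_le.mp (Nat.find_min hex (by omega))
    have h2 := Real.log_lt_log hε h1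
    have h3 : (1 : ℝ) / 13 ≤ Real.log (13 / 12) := by
      have := Real.one_sub_inv_le_log_of_pos (show (0 : ℝ) < 13 / 12 by norm_num)
      norm_num at this ⊢
      exact this
    have h4 : Real.log (12 / 13) = -Real.log (13 / 12) := by
      rw [← Real.log_inv]; norm_num
    rw [Real.log_pow, h4] at h2
    rw [one_div ε, Real.log_inv] at hlog ⊢
    have h5 : (i : ℝ) * (1 / 13) ≤ i * Real.log (13 / 12) :=
      mul_le_mul_of_nonneg_left h3 (Nat.cast_nonneg i)
    rw [hi]
    push_cast
    linarith

theorem clog_add_one_le (hn : 2 ≤ n) : (Nat.clog 2 n : ℝ) + 1 ≤ 6 * Real.log n := by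
  have hn' : (2 : ℝ) ≤ n := by exact_mod_cast hn
  have h2 := Real.log_two_gt_d9
  have hlog : Real.log 2 ≤ Real.log n := Real.log_le_log (by norm_num) hn'
  obtain ⟨m, hm⟩ : ∃ m, Nat.clog 2 n = m + 1 :=
    ⟨Nat.clog 2 n - 1, by have := Nat.clog_pos one_lt_two hn; omega⟩
  have h1 : 2 ^ m < n := Nat.pow_lt_of_lt_clog (by omega)
  have h3 : (2 : ℝ) ^ m ≤ n := by exact_mod_cast h1.le
  have h4 := Real.log_le_log (by positivity) h3
  rw [Real.log_pow] at h4
  have h5 : (m : ℝ) * (1 / 2) ≤ m * Real.log 2 :=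
    mul_le_mul_of_nonneg_left (by linarith) (Nat.cast_nonneg m)
  rw [hm]
  push_cast
  linarith

/-- The bound for the number of off-diagonal entries of a sparsifier, in terms of `log κ`. -/
theorem sparsity_le {e : ℕ} {L : ℝ} (hL : 1 / 2 ≤ L) (he : (e : ℝ) ≤ 8 * L) :
    ((2 * (n * ((4 * (6 * e) + 2) * (4 * (6 * e) + 2))) : ℕ) : ℝ) ≤ 76832 * (n * L ^ 2) := by
  -- Here 24e ≤ 192L and 2 ≤ 4L; the constant of the claim is 2 · 196².
  have h1 : (4 * (6 * e) + 2 : ℝ) ≤ 196 * L := by linarith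
  have h2 : (4 * (6 * e) + 2 : ℝ) ^ 2 ≤ (196 * L) ^ 2 := pow_le_pow_left₀ (by positivity) h1 2
  have h3 := mul_le_mul_of_nonneg_left h2 (Nat.cast_nonneg (α := ℝ) n)
  push_cast
  nlinarith

end RealMatrix

theorem theorem1 :
    ∃ (build : WorkDepth.Prog WorkDepth.Ty.sparse WorkDepth.Ty.chain)
      (solve : WorkDepth.Prog
        (.prod WorkDepth.Ty.chain (.prod WorkDepth.Ty.vec .real)) WorkDepth.Ty.vec)
      (C : ℝ) (k : ℕ),
      ∀ (n : ℕ) (M : Matrix (Fin n) (Fin n) ℝ) (κ : ℝ),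
        2 ≤ n → IsSDDM M → 2 ≤ κ → condNumber M ≤ κ →
        ∃ (d : ℕ) (D A : Fin (d + 1) → Matrix (Fin n) (Fin n) ℝ),
          -- `D`, `A` is a sparse approximate inverse chain for `M`
          IsApproxInverseChain M D A ∧
          (d : ℝ) ≤ C * Real.log κ ∧
          (∑ i : Fin d, ((nnz (D i.succ) : ℝ) + (nnz (A i.succ) : ℝ)))
            ≤ C * ((n : ℝ) * Real.log κ ^ 3) ∧
          -- the first program produces it from `M` in polynomial time
          (∃ w t : ℕ,
            WorkDepth.Runs build (WorkDepth.encodeSparse M) (WorkDepth.encodeChain D A) w t ∧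
            (w : ℝ) ≤ C * ((n : ℝ) + Real.log κ) ^ k) ∧
          -- the second program solves systems in `M` with it
          ∀ (b : Fin n → ℝ) (ε : ℝ), 0 < ε → ε ≤ 1 / 2 →
            ∃ (y : Fin n → ℝ) (w t : ℕ),
              WorkDepth.Runs solve
                (WorkDepth.encodeChain D A, (WorkDepth.encodeVec b, ε))
                (WorkDepth.encodeVec y) w t ∧
              IsApproxSolution M b ε y ∧
              (w : ℝ) ≤ C * (((nnz M : ℝ) + (n : ℝ) * Real.log κ ^ 3) * Real.log (1 / ε)) ∧
              (t : ℝ) ≤ C * (Real.log n * Real.log κ * Real.log (1 / ε)) := by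
  obtain ⟨K, k, hbuild⟩ := WorkDepth.buildP_spec
  -- The first summand of the constant absorbs n + e + 1 ≤ 10(n + L) in the construction; 10¹²
  -- covers the constants of the sizes and of the solver.
  refine ⟨WorkDepth.buildP, WorkDepth.solveP, K * 10 ^ k + 10 ^ 12, k, fun n M κ hn hM hκ hcond => ?_⟩
  obtain ⟨e, c, a, he1, he, hc, h0, ha, hlast, hden, t, hcost⟩ := hbuild n M κ hn hM hκ hcond
  set L := Real.log κ with hL
  have hL2 : 1 / 2 ≤ L := by
    have h1 : Real.log 2 ≤ L := Real.log_le_log (by norm_num) hκ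
    have := Real.log_two_gt_d9
    linarith
  have hn2 : (2 : ℝ) ≤ n := by exact_mod_cast hn
  set F := 2 * (n * ((4 * (6 * e) + 2) * (4 * (6 * e) + 2))) with hF
  have hFL : (F : ℝ) ≤ 76832 * (n * L ^ 2) := RealMatrix.sparsity_le hL2 he
  have hC : (10 : ℝ) ^ 12 ≤ K * 10 ^ k + 10 ^ 12 := by
    have : (0 : ℝ) ≤ K * 10 ^ k := by positivity
    linarith
  have hlen : ((6 * e : ℕ) : ℝ) ≤ 48 * L := by push_cast; linarith
  have hlevel : ((6 * e : ℕ) : ℝ) * (2 * n + F) ≤ 4 * 10 ^ 6 * (n * L ^ 3) := by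
    have h1 : (2 * n + F : ℝ) ≤ 76840 * (n * L ^ 2) := by
      have h2 : 1 / 4 ≤ L ^ 2 := by nlinarith
      have h3 := mul_le_mul_of_nonneg_left h2 (Nat.cast_nonneg (α := ℝ) n)
      linarith
    calc ((6 * e : ℕ) : ℝ) * (2 * n + F) ≤ 48 * L * (76840 * (n * L ^ 2)) :=
          mul_le_mul hlen h1 (by positivity) (by positivity)
      _ = 3688320 * (n * L ^ 3) := by ring
      _ ≤ _ := mul_le_mul_of_nonneg_right (by norm_num) (by positivity)
  refine ⟨6 * e, fun _ => c • 1, fun i => c • a i,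
    RealMatrix.isApproxInverseChain (by omega) hc h0 ha hlast, ?_, ?_, ?_, ?_⟩
  · nlinarith
  · calc ∑ i : Fin (6 * e), ((nnz (c • (1 : Matrix (Fin n) (Fin n) ℝ)) : ℝ) +
        (nnz (c • a (i.succ : Fin (6 * e + 1))) : ℝ)) ≤ ∑ i : Fin (6 * e), (2 * n + F : ℝ) := by
          refine Finset.sum_le_sum fun i _ => ?_
          have h1 : (nnz (c • (1 : Matrix (Fin n) (Fin n) ℝ)) : ℝ) ≤ n := by
            exact_mod_cast RealMatrix.nnz_smul_one_le c
          have h2 : (nnz (c • a (i.succ : Fin (6 * e + 1))) : ℝ) ≤ n + F := by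
            exact_mod_cast RealMatrix.nnz_smul_level_succ (ha i).2 c
          linarith
      _ = ((6 * e : ℕ) : ℝ) * (2 * n + F) := by
          rw [Finset.sum_const, Finset.card_univ, Fintype.card_fin, nsmul_eq_mul]
      _ ≤ 4 * 10 ^ 6 * (n * L ^ 3) := hlevel
      _ ≤ _ := mul_le_mul_of_nonneg_right (by linarith) (by positivity)
  · obtain ⟨w, t', hrun, hw, -⟩ := hcost.runs
    rw [hden] at hrun
    refine ⟨w, t', hrun, ?_⟩
    have h1 : (w : ℝ) ≤ K * (n + e + 1) ^ k := by exact_mod_cast hw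
    have h2 : (n + e + 1 : ℝ) ^ k ≤ (10 * (n + L)) ^ k :=
      pow_le_pow_left₀ (by positivity) (by linarith) k
    calc (w : ℝ) ≤ K * (10 * (n + L)) ^ k :=
          h1.trans (mul_le_mul_of_nonneg_left h2 (Nat.cast_nonneg K))
      _ = K * 10 ^ k * (n + L) ^ k := by rw [mul_pow]; ring
      _ ≤ _ := mul_le_mul_of_nonneg_right (by linarith [show (0 : ℝ) ≤ 10 ^ 12 by positivity])
          (by positivity)
  · intro b ε hε hε'
    obtain ⟨j, hj1, hj2, hj3⟩ := RealMatrix.exists_pow_le hε hε'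
    obtain ⟨hd, hcost⟩ := WorkDepth.solveP_spec (d := 6 * e) a (by omega) (by omega) hc.ne' b ε hj1 hj2
    obtain ⟨w, t', hrun, hw, ht⟩ := hcost.runs
    rw [hd] at hrun
    set l := Real.log (1 / ε) with hl
    have hl0 : 0 ≤ l := by linarith [Nat.cast_nonneg (α := ℝ) j]
    have hD : ((6 * e : ℕ) : ℝ) + 1 ≤ 50 * L := by linarith
    refine ⟨_, w, t', hrun, RealMatrix.isApproxSolution_richardson hM.posDef (by omega) ha hlast hc h0 b hε hj1,
      ?_, ?_⟩
    -- The first level is counted separately: it is not sparsified and inherits the entries of M,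
    -- whereas every later one has at most n + F.
    · have h1 : ∑ i ∈ Finset.range (6 * e), (nnz (c • a i) + n) ≤ nnz M + 6 * e * (2 * n + F) := by
        obtain ⟨m, hm⟩ : ∃ m, 6 * e = m + 1 := ⟨6 * e - 1, by omega⟩
        rw [hm, Finset.sum_range_succ']
        have h2 : ∑ i ∈ Finset.range m, (nnz (c • a (i + 1)) + n) ≤ m * (2 * n + F) := by
          refine (Finset.sum_le_sum (g := fun _ => 2 * n + F) fun i _ => ?_).trans (by simp)
          have := RealMatrix.nnz_smul_level_succ (ha i).2 c
          omega
        have h3 := RealMatrix.nnz_smul_level_zero (c := c) h0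
        rw [add_one_mul]
        omega
      have h2 : ((∑ i ∈ Finset.range (6 * e), (nnz (c • a i) + n) + (6 * e + 1) ^ 2 : ℕ) : ℝ) ≤
          5 * 10 ^ 6 * (nnz M + n * L ^ 3) := by
        have h3 : ((∑ i ∈ Finset.range (6 * e), (nnz (c • a i) + n) : ℕ) : ℝ) ≤
            nnz M + ((6 * e : ℕ) : ℝ) * (2 * n + F) := by exact_mod_cast h1
        have h4 : (((6 * e : ℕ) : ℝ) + 1) ^ 2 ≤ (50 * L) ^ 2 := pow_le_pow_left₀ (by positivity) hD 2
        -- This absorbs the term (d + 1)² for rebuilding arrays, by nL ≥ 1.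
        have h5 : L ^ 2 ≤ n * L ^ 3 := by
          have : 1 ≤ n * L := by nlinarith
          calc L ^ 2 = 1 * L ^ 2 := (one_mul _).symm
            _ ≤ n * L * L ^ 2 := mul_le_mul_of_nonneg_right this (by positivity)
            _ = n * L ^ 3 := by ring
        have h6 : (0 : ℝ) ≤ nnz M := Nat.cast_nonneg _
        have h7 : (0 : ℝ) ≤ n * L ^ 3 := by positivity
        rw [Nat.cast_add, Nat.cast_pow, Nat.cast_add, Nat.cast_one]
        linarith
      have h3 : (w : ℝ) ≤ 4000 * (((j : ℝ) + 1) *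
          ((∑ i ∈ Finset.range (6 * e), (nnz (c • a i) + n) + (6 * e + 1) ^ 2 : ℕ) : ℝ)) := by
        exact_mod_cast hw
      calc (w : ℝ) ≤ 4000 * ((17 * l) * (5 * 10 ^ 6 * (nnz M + n * L ^ 3))) :=
            h3.trans (mul_le_mul_of_nonneg_left (mul_le_mul hj3 h2 (Nat.cast_nonneg _)
              (by positivity)) (by norm_num))
        _ = 340000000000 * ((nnz M + n * L ^ 3) * l) := by ring
        _ ≤ _ := mul_le_mul_of_nonneg_right (by linarith) (by positivity)
    · have h1 := RealMatrix.clog_add_one_le hn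
      have h2 : (t' : ℝ) ≤ 4000 * (((j : ℝ) + 1) * ((((6 * e : ℕ) : ℝ) + 1) *
          ((Nat.clog 2 n : ℝ) + 1))) := by
        exact_mod_cast ht
      have hlog : 0 ≤ Real.log n := Real.log_nonneg (by linarith)
      calc (t' : ℝ) ≤ 4000 * ((17 * l) * ((50 * L) * (6 * Real.log n))) :=
            h2.trans (mul_le_mul_of_nonneg_left (mul_le_mul hj3 (mul_le_mul hD h1 (by positivity)
              (by positivity)) (by positivity) (by positivity)) (by norm_num))
        _ = 20400000 * (Real.log n * L * l) := by ring
        _ ≤ _ := mul_le_mul_of_nonneg_right (by linarith) (by positivity)
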